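/- **Theorem 4.1 (isomorphism between $\widetilde H^{s,p,\delta}(\Omega)$ and $\widetilde W^{1,p}(\Omega)$).** Let $n\ge 1$, $s\in(0,1)$, $\delta>0$, $p\in[1,\infty]$, and let $\Omega\subset\mathbb R^n$ be a bounded Lipschitz domain (nonempty, open, connected). Put $\Omega_\delta=\{x:\operatorname{dist}(x,\Omega)<\delta\}$. Let $w_\delta=\overline w_\delta(|\cdot|):\mathbb R^n\to[0,\infty)$, with $\overline w_\delta:\mathbb R\to[0,\infty)$, be a radial function in $C_c^\infty(B_\delta(0))$ that equals $1$ on $B_{\mu\delta}(0)$ for some $\mu\in(0,1)$ and is radially decreasing, i.e. $w_\delta(z)\ge w_\delta(\tilde z)$ if $|z|\le|\tilde z|$. Let $$\rho_\delta^s(z)=c_{n,s,\delta}\frac{w_\delta(z)}{|z|^{n+s-1}},\qquad Q_\delta^s(z)=c_{n,s,\delta}\int_{|z|}^{\delta}\frac{\overline w_\delta(r)}{r^{n+s}}\,dr \qquad(z\neq0),$$ where $c_{n,s,\delta}>0$ is determined by $c_{n,s,\delta}\int_{B_\delta(0)}\frac{w_\delta(z)}{|z|^{n+s-1}}\,dz=n$.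 For $\psi\in C_c^\infty(\Omega;\mathbb R^n)$ let $$\operatorname{div}_\delta^s\psi(x)=\int_{\mathbb R^n}\frac{\psi(x)-\psi(y)}{|x-y|}\cdot\frac{x-y}{|x-y|}\,\rho_\delta^s(x-y)\,dy .$$ For $u\in L^p(\Omega_\delta)$, the weak nonlocal gradient $D_\delta^su$ is the function $v$ on $\Omega$ (unique if it exists) with $\int_\Omega v\cdot\psi\,dx=-\int_{\Omega_\delta}u\operatorname{div}_\delta^s\psi\,dx$ for all $\psi\in C_c^\infty(\Omega;\mathbb R^n)$. Define $$H^{s,p,\delta}(\Omega)=\{u\in L^p(\Omega_\delta): D_\delta^su\in L^p(\Omega;\mathbb R^n)\},\qquad N^{s,p,\delta}(\Omega)=\{h\in H^{s,p,\delta}(\Omega): D_\delta^sh=0\text{ a.e. in }\Omega\},$$ and let $\widetilde H^{s,p,\delta}(\Omega)=H^{s,p,\delta}(\Omega)/N^{s,p,\delta}(\Omega)$ and $\widetilde W^{1,p}(\Omega)=W^{1,p}(\Omega)/\{\text{constants}\}$, with norms $\|[u]\|=\|D_\delta^su\|_{L^p(\Omega;\mathbb R^n)}$ and $\|[v]\|=\|\nabla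 v\|_{L^p(\Omega;\mathbb R^n)}$. Let $\widetilde D_\delta^s[u]=D_\delta^su$ and $\widetilde\nabla[v]=\nabla v$. Then, for every $u\in H^{s,p,\delta}(\Omega)$, the convolution $\mathcal Q_\delta^su=Q_\delta^s*u$, restricted to $\Omega$ (with $u$ extended by zero outside $\Omega_\delta$), belongs to $W^{1,p}(\Omega)$, and $$\widetilde{\mathcal Q}_\delta^s:\widetilde H^{s,p,\delta}(\Omega)\to\widetilde W^{1,p}(\Omega),\qquad [u]\mapsto[\mathcal Q_\delta^su],$$ is a well-defined linear isometric isomorphism (in particular, bijective). Moreover, with $\widetilde{\mathcal P}_\delta^s=(\widetilde{\mathcal Q}_\delta^s)^{-1}$, $$\widetilde\nabla\circ\widetilde{\mathcal Q}_\delta^s=\widetilde D_\delta^s\qquad\text{and}\qquad\widetilde D_\delta^s\circ\widetilde{\mathcal P}_\delta^s=\widetilde\nabla .$$ -/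

import Mathlib

open MeasureTheory TopologicalSpace
open scoped ENNReal Distributions

noncomputable section

namespace NonlocalGradient

/-- The Euclidean space `ℝⁿ`. -/
abbrev E (n : ℕ) := EuclideanSpace ℝ (Fin n)

/-- The horizon neighbourhood `Ω_δ = {x | dist(x, Ω) < δ}`. -/
abbrev enlarge {n : ℕ} (δ : ℝ) (Ω : Opens (E n)) : Set (E n) :=
  Metric.thickening δ (Ω : Set (E n))

/-- A bounded Lipschitz domain: a nonempty bounded connected open set which, near each of its
boundary points, is the region strictly above the graph of a Lipschitz function over a hyperplane.
In the direction of the unit vector `e` the height of a point `x` is `⟪e, x⟫`, and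
`x - ⟪e, x⟫ • e` is its projection to the hyperplane orthogonal to `e`. -/
structure IsBoundedLipschitzDomain {n : ℕ} (Ω : Opens (E n)) : Prop where
  connected : IsConnected (Ω : Set (E n))
  bounded : Bornology.IsBounded (Ω : Set (E n))
  lipschitz_boundary : ∀ x₀ ∈ frontier (Ω : Set (E n)),
    ∃ r > 0, ∃ e : E n, ‖e‖ = 1 ∧ ∃ K : NNReal, ∃ γ : E n → ℝ, LipschitzWith K γ ∧
      ∀ x ∈ Metric.ball x₀ r, x ∈ Ω ↔ γ (x - inner ℝ e x • e) < inner ℝ e x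

/-- The assumptions on the cut-off function `w = w_δ : ℝⁿ → [0, ∞)` with radial profile
`wbar : ℝ → [0, ∞)`. -/
structure IsCutoff {n : ℕ} (δ : ℝ) (w : E n → ℝ) (wbar : ℝ → ℝ) : Prop where
  profile_nonneg : ∀ r, 0 ≤ wbar r
  radial : ∀ z, w z = wbar ‖z‖
  smooth : ContDiff ℝ (⊤ : ℕ∞) w
  hasCompactSupport : HasCompactSupport w
  tsupport_subset : tsupport w ⊆ Metric.ball 0 δ
  normalized : ∃ μ : ℝ, 0 < μ ∧ μ < 1 ∧ ∀ z ∈ Metric.ball (0 : E n) (μ * δ), w z = 1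
  antitone : ∀ z z' : E n, ‖z‖ ≤ ‖z'‖ → w z' ≤ w z

/-- The scaling constant `c_{n,s,δ}`, i.e. the solution `c` of
`c * ∫_{B_δ(0)} w(z) / |z|^(n+s-1) dz = n`. -/
def scaling {n : ℕ} (s δ : ℝ) (w : E n → ℝ) : ℝ :=
  n / ∫ z in Metric.ball (0 : E n) δ, w z / ‖z‖ ^ ((n : ℝ) + s - 1)

/-- The kernel `ρ_δ^s(z) = c_{n,s,δ} w(z) / |z|^(n+s-1)`. -/
def kernel {n : ℕ} (s δ : ℝ) (w : E n → ℝ) (z : E n) : ℝ :=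
  scaling s δ w * (w z / ‖z‖ ^ ((n : ℝ) + s - 1))

/-- The nonlocal divergence
`div_δ^s ψ(x) = ∫ (ψ(x) - ψ(y)) / |x - y| · (x - y) / |x - y| ρ_δ^s(x - y) dy`. -/
def nonlocalDiv {n : ℕ} (s δ : ℝ) (w : E n → ℝ) (ψ : E n → E n) (x : E n) : ℝ :=
  ∫ y, inner ℝ (‖x - y‖⁻¹ • (ψ x - ψ y)) (‖x - y‖⁻¹ • (x - y)) * kernel s δ w (x - y)

/-- The kernel `Q_δ^s(x) = c_{n,s,δ} ∫_{|x|}^δ wbar(r) / r^(n+s) dr`. -/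
def Q {n : ℕ} (s δ : ℝ) (w : E n → ℝ) (wbar : ℝ → ℝ) (x : E n) : ℝ :=
  scaling s δ w * ∫ r in ‖x‖..δ, wbar r / r ^ ((n : ℝ) + s)

/-- The convolution `Q_δ^s ∗ u` of the kernel with (the extension by zero of) a function `u`
on `Ω_δ`. -/
def convQ {n : ℕ} (s δ : ℝ) (w : E n → ℝ) (wbar : ℝ → ℝ) (Ω : Opens (E n)) (u : E n → ℝ)
    (x : E n) : ℝ :=
  ∫ y in enlarge δ Ω, Q s δ w wbar (x - y) * u y

/-- `v` is the weak nonlocal gradient `D_δ^s u` in `Ω` of the function `u` on `Ω_δ`: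
`∫_Ω v · ψ = - ∫_{Ω_δ} u div_δ^s ψ` for all `ψ ∈ C_c^∞(Ω; ℝⁿ)`, where the integral on the right
is required to converge absolutely (as it always does for the functions and kernels of interest,
`div_δ^s ψ` being then bounded with compact support in `Ω_δ`). -/
def HasWeakNonlocalGrad {n : ℕ} (s δ : ℝ) (w : E n → ℝ) (Ω : Opens (E n))
    (u : E n → ℝ) (v : E n → E n) : Prop :=
  ∀ ψ : 𝓓(Ω, E n),
    IntegrableOn (fun x => u x * nonlocalDiv s δ w ψ x) (enlarge δ Ω) ∧
    ∫ x in (Ω : Set (E n)), inner ℝ (v x) (ψ x) =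
      - ∫ x in enlarge δ Ω, u x * nonlocalDiv s δ w ψ x

/-- `v` is the weak gradient `∇u` of `u` in `Ω`: `∫_Ω u ∇φ = - ∫_Ω φ v` for all
`φ ∈ C_c^∞(Ω)`. -/
def HasWeakGrad {n : ℕ} (Ω : Opens (E n)) (u : E n → ℝ) (v : E n → E n) : Prop :=
  ∀ φ : 𝓓(Ω, ℝ),
    ∫ x in (Ω : Set (E n)), u x • gradient φ x = - ∫ x in (Ω : Set (E n)), φ x • v x

/-- `L^p(Ω)`. -/
abbrev LpΩ {n : ℕ} (p : ℝ≥0∞) (Ω : Opens (E n)) :=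
  Lp ℝ p (volume.restrict (Ω : Set (E n)))

/-- `L^p(Ω; ℝⁿ)`, with the Euclidean norm on `ℝⁿ`. -/
abbrev LpVec {n : ℕ} (p : ℝ≥0∞) (Ω : Opens (E n)) :=
  Lp (E n) p (volume.restrict (Ω : Set (E n)))

/-- `L^p(Ω_δ)`. -/
abbrev LpEnl {n : ℕ} (p : ℝ≥0∞) (δ : ℝ) (Ω : Opens (E n)) :=
  Lp ℝ p (volume.restrict (enlarge δ Ω))

section aux

set_option linter.unusedSectionVars false

variable {n : ℕ} {p : ℝ≥0∞} [Fact (1 ≤ p)] {Ω : Opens (E n)}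

theorem locInt {F : Type*} [NormedAddCommGroup F] (f : Lp F p (volume.restrict (Ω : Set (E n)))) :
    LocallyIntegrable f (volume.restrict (Ω : Set (E n))) :=
  (Lp.memLp f).locallyIntegrable Fact.out

theorem integrable_inner_test (v : LpVec p Ω) (ψ : 𝓓(Ω, E n)) :
    Integrable (fun x => inner ℝ (v x) (ψ x)) (volume.restrict (Ω : Set (E n))) := by
  have h : Integrable (fun x => ‖ψ x‖ • v x) (volume.restrict (Ω : Set (E n))) :=
    (locInt v).integrable_smul_left_of_hasCompactSupport ψ.continuous.norm
      ψ.hasCompactSupport.norm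
  refine h.norm.mono' ((Lp.aestronglyMeasurable v).inner ψ.continuous.aestronglyMeasurable) ?_
  refine Filter.Eventually.of_forall fun x => ?_
  rw [norm_smul, norm_norm, mul_comm]
  exact norm_inner_le_norm _ _

theorem integrable_test_smul (v : LpVec p Ω) (φ : 𝓓(Ω, ℝ)) :
    Integrable (fun x => φ x • v x) (volume.restrict (Ω : Set (E n))) :=
  (locInt v).integrable_smul_left_of_hasCompactSupport φ.continuous φ.hasCompactSupport

theorem integrable_smul_gradient (u : LpΩ p Ω) (φ : 𝓓(Ω, ℝ)) :
    Integrable (fun x => u x • gradient φ x) (volume.restrict (Ω : Set (E n))) := by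
  have hc : Continuous (gradient φ) :=
    (InnerProductSpace.toDual ℝ (E n)).symm.continuous.comp
      (φ.contDiff.continuous_fderiv (by simp))
  have hs : HasCompactSupport (gradient φ) :=
    (φ.hasCompactSupport.fderiv (𝕜 := ℝ)).comp_left (map_zero _)
  exact (locInt u).integrable_smul_right_of_hasCompactSupport hc hs

/-- The fundamental lemma of the calculus of variations on `Ω`. -/
theorem eq_of_forall_test {v v' : LpVec p Ω}
    (h : ∀ φ : 𝓓(Ω, ℝ), ∫ x in (Ω : Set (E n)), φ x • v x = ∫ x in (Ω : Set (E n)), φ x • v' x) :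
    v = v' := by
  have h0 := Ω.isOpen.ae_eq_zero_of_integral_contDiff_smul_eq_zero
    (μ := volume.restrict (Ω : Set (E n))) (f := fun x => v x - v' x)
    (((locInt v).sub (locInt v')).locallyIntegrableOn _) (by
      intro g hg hgc hgs
      let φ : 𝓓(Ω, ℝ) := ⟨g, hg, hgc, hgs⟩
      have h1 : ∀ x, g x • (v x - v' x) = φ x • v x - φ x • v' x := fun x => smul_sub _ _ _
      simp_rw [h1]
      rw [integral_sub (integrable_test_smul v φ) (integrable_test_smul v' φ), h φ, sub_self])
  apply Lp.ext
  filter_upwards [h0, ae_restrict_mem Ω.isOpen.measurableSet] with x hx hx'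
  exact sub_eq_zero.1 (hx hx')

theorem HasWeakGrad.unique {u : E n → ℝ} {v v' : LpVec p Ω} (h : HasWeakGrad Ω u v)
    (h' : HasWeakGrad Ω u v') : v = v' :=
  eq_of_forall_test fun φ => neg_injective ((h φ).symm.trans (h' φ))

theorem HasWeakNonlocalGrad.unique {s δ : ℝ} {w : E n → ℝ} {u : E n → ℝ} {v v' : LpVec p Ω}
    (h : HasWeakNonlocalGrad s δ w Ω u v) (h' : HasWeakNonlocalGrad s δ w Ω u v') : v = v' := by
  refine eq_of_forall_test fun φ => ext_inner_left ℝ fun e => ?_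
  let ψ : 𝓓(Ω, E n) := ⟨fun x => φ x • e, φ.contDiff.smul contDiff_const,
    φ.hasCompactSupport.smul_right,
    (closure_mono (Function.support_smul_subset_left _ _)).trans φ.tsupport_subset⟩
  have key : ∀ v : LpVec p Ω, inner ℝ e (∫ x in (Ω : Set (E n)), φ x • v x) =
      ∫ x in (Ω : Set (E n)), inner ℝ (v x) (ψ x) := by
    intro v
    rw [← integral_inner (integrable_test_smul v φ)]
    refine integral_congr_ae (Filter.Eventually.of_forall fun x => ?_)
    change inner ℝ e (φ x • v x) = inner ℝ (v x) (φ x • e)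
    rw [inner_smul_right, inner_smul_right, real_inner_comm]
  rw [key, key, (h ψ).2, (h' ψ).2]

theorem HasWeakNonlocalGrad.add {s δ : ℝ} {w : E n → ℝ} {u u' : LpEnl p δ Ω} {v v' : LpVec p Ω}
    (h : HasWeakNonlocalGrad s δ w Ω u v) (h' : HasWeakNonlocalGrad s δ w Ω u' v') :
    HasWeakNonlocalGrad s δ w Ω ↑(u + u') ↑(v + v') := by
  intro ψ
  have e1 : (fun x => u x * nonlocalDiv s δ w ψ x + u' x * nonlocalDiv s δ w ψ x)
      =ᵐ[volume.restrict (enlarge δ Ω)] fun x => (u + u') x * nonlocalDiv s δ w ψ x := by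
    filter_upwards [Lp.coeFn_add u u'] with x hx
    rw [hx, Pi.add_apply, add_mul]
  have e2 : (fun x => inner ℝ ((v + v') x) (ψ x)) =ᵐ[volume.restrict (Ω : Set (E n))]
      fun x => inner ℝ (v x) (ψ x) + inner ℝ (v' x) (ψ x) := by
    filter_upwards [Lp.coeFn_add v v'] with x hx
    rw [hx, Pi.add_apply, inner_add_left]
  refine ⟨((h ψ).1.add (h' ψ).1).congr e1, ?_⟩
  rw [integral_congr_ae e2, ← integral_congr_ae e1,
    integral_add (integrable_inner_test v ψ) (integrable_inner_test v' ψ),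
    integral_add (h ψ).1 (h' ψ).1, (h ψ).2, (h' ψ).2]
  ring

theorem HasWeakNonlocalGrad.smul {s δ : ℝ} {w : E n → ℝ} {u : LpEnl p δ Ω} {v : LpVec p Ω}
    (h : HasWeakNonlocalGrad s δ w Ω u v) (c : ℝ) :
    HasWeakNonlocalGrad s δ w Ω ↑(c • u) ↑(c • v) := by
  intro ψ
  have e1 : (fun x => c * (u x * nonlocalDiv s δ w ψ x))
      =ᵐ[volume.restrict (enlarge δ Ω)] fun x => (c • u) x * nonlocalDiv s δ w ψ x := by
    filter_upwards [Lp.coeFn_smul c u] with x hx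
    rw [hx, Pi.smul_apply, smul_eq_mul, mul_assoc]
  have e2 : (fun x => inner ℝ ((c • v) x) (ψ x)) =ᵐ[volume.restrict (Ω : Set (E n))]
      fun x => c * inner ℝ (v x) (ψ x) := by
    filter_upwards [Lp.coeFn_smul c v] with x hx
    rw [hx, Pi.smul_apply, real_inner_smul_left]
  refine ⟨((h ψ).1.const_mul c).congr e1, ?_⟩
  rw [integral_congr_ae e2, ← integral_congr_ae e1, integral_const_mul, integral_const_mul,
    (h ψ).2, mul_neg]

theorem hasWeakNonlocalGrad_zero {s δ : ℝ} {w : E n → ℝ} :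
    HasWeakNonlocalGrad s δ w Ω ↑(0 : LpEnl p δ Ω) ↑(0 : LpVec p Ω) := by
  intro ψ
  have e1 : (fun _ => (0 : ℝ)) =ᵐ[volume.restrict (enlarge δ Ω)]
      fun x => (0 : LpEnl p δ Ω) x * nonlocalDiv s δ w ψ x := by
    filter_upwards [Lp.coeFn_zero ℝ p (volume.restrict (enlarge δ Ω))] with x hx
    rw [hx, Pi.zero_apply, zero_mul]
  have e2 : (fun x => inner ℝ ((0 : LpVec p Ω) x) (ψ x)) =ᵐ[volume.restrict (Ω : Set (E n))]
      fun _ => (0 : ℝ) := by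
    filter_upwards [Lp.coeFn_zero (E n) p (volume.restrict (Ω : Set (E n)))] with x hx
    rw [hx, Pi.zero_apply, inner_zero_left]
  refine ⟨(integrable_zero _ _ _).congr e1, ?_⟩
  rw [integral_congr_ae e2, ← integral_congr_ae e1]
  simp

theorem HasWeakGrad.add {u u' : LpΩ p Ω} {v v' : LpVec p Ω}
    (h : HasWeakGrad Ω u v) (h' : HasWeakGrad Ω u' v') :
    HasWeakGrad Ω ↑(u + u') ↑(v + v') := by
  intro φ
  have e1 : (fun x => (u + u') x • gradient φ x) =ᵐ[volume.restrict (Ω : Set (E n))]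
      fun x => u x • gradient φ x + u' x • gradient φ x := by
    filter_upwards [Lp.coeFn_add u u'] with x hx
    rw [hx, Pi.add_apply, add_smul]
  have e2 : (fun x => φ x • (v + v') x) =ᵐ[volume.restrict (Ω : Set (E n))]
      fun x => φ x • v x + φ x • v' x := by
    filter_upwards [Lp.coeFn_add v v'] with x hx
    rw [hx, Pi.add_apply, smul_add]
  rw [integral_congr_ae e1, integral_congr_ae e2,
    integral_add (integrable_smul_gradient u φ) (integrable_smul_gradient u' φ),
    integral_add (integrable_test_smul v φ) (integrable_test_smul v' φ), h φ, h' φ, neg_add]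

theorem HasWeakGrad.smul {u : LpΩ p Ω} {v : LpVec p Ω} (h : HasWeakGrad Ω u v) (c : ℝ) :
    HasWeakGrad Ω ↑(c • u) ↑(c • v) := by
  intro φ
  have e1 : (fun x => (c • u) x • gradient φ x) =ᵐ[volume.restrict (Ω : Set (E n))]
      fun x => c • (u x • gradient φ x) := by
    filter_upwards [Lp.coeFn_smul c u] with x hx
    rw [hx, Pi.smul_apply, smul_assoc]
  have e2 : (fun x => φ x • (c • v) x) =ᵐ[volume.restrict (Ω : Set (E n))]
      fun x => c • (φ x • v x) := by
    filter_upwards [Lp.coeFn_smul c v] with x hx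
    rw [hx, Pi.smul_apply, smul_comm]
  rw [integral_congr_ae e1, integral_congr_ae e2, integral_smul, integral_smul, h φ, smul_neg]

/-- A constant function has vanishing weak gradient. -/
theorem hasWeakGrad_const {u : LpΩ p Ω} {c : ℝ}
    (hu : u =ᵐ[volume.restrict (Ω : Set (E n))] fun _ => c) :
    HasWeakGrad Ω u ↑(0 : LpVec p Ω) := by
  intro φ
  have e1 : (fun x => u x • gradient φ x) =ᵐ[volume.restrict (Ω : Set (E n))]
      fun x => c • gradient φ x := by
    filter_upwards [hu] with x hx
    rw [hx]
  have e2 : (fun x => φ x • (0 : LpVec p Ω) x) =ᵐ[volume.restrict (Ω : Set (E n))]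
      fun _ => (0 : E n) := by
    filter_upwards [Lp.coeFn_zero (E n) p (volume.restrict (Ω : Set (E n)))] with x hx
    rw [hx, Pi.zero_apply, smul_zero]
  have hc : Continuous (gradient φ) :=
    (InnerProductSpace.toDual ℝ (E n)).symm.continuous.comp
      (φ.contDiff.continuous_fderiv (by simp))
  have hs : HasCompactSupport (gradient φ) :=
    (φ.hasCompactSupport.fderiv (𝕜 := ℝ)).comp_left (map_zero _)
  have hi : Integrable (gradient φ) := hc.integrable_of_hasCompactSupport hs
  have hsub : Function.support (gradient φ) ⊆ Ω := fun x hx => by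
    apply φ.tsupport_subset
    apply support_fderiv_subset ℝ
    intro h0
    exact hx (by simp only [gradient, h0, map_zero])
  have hd : Differentiable ℝ φ := φ.contDiff.differentiable (by simp)
  have h0 : ∫ x in (Ω : Set (E n)), gradient φ x = 0 := by
    rw [setIntegral_eq_integral_of_forall_compl_eq_zero
      (fun x hx => by_contra fun h => hx (hsub h))]
    refine ext_inner_left ℝ fun e => ?_
    rw [← integral_inner hi, inner_zero_right]
    have h1 : ∀ x, inner ℝ e (gradient φ x) = fderiv ℝ φ x e := fun x => by
      rw [real_inner_comm, gradient, InnerProductSpace.toDual_symm_apply]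
    simp_rw [h1]
    have h2 := integral_mul_fderiv_eq_neg_fderiv_mul_of_integrable (𝕜 := ℝ)
      (μ := (volume : Measure (E n))) (f := fun _ => (1 : ℝ)) (g := φ) (v := e)
      (by simp) (by
        simp_rw [one_mul, ← h1]
        exact hi.const_inner e)
      (by simpa using φ.continuous.integrable_of_hasCompactSupport φ.hasCompactSupport)
      (fun _ _ => by fun_prop) (fun x _ => hd x)
    simpa using h2
  rw [integral_congr_ae e1, integral_congr_ae e2, integral_smul, h0]
  simp

end aux

section spaces

variable {n : ℕ} (s δ : ℝ) (w : E n → ℝ) (p : ℝ≥0∞) [Fact (1 ≤ p)] (Ω : Opens (E n))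

/-- The nonlocal Sobolev space `H^{s,p,δ}(Ω) = {u ∈ L^p(Ω_δ) | D_δ^s u ∈ L^p(Ω; ℝⁿ)}`. -/
def H : Submodule ℝ (LpEnl p δ Ω) where
  carrier := {u | ∃ v : LpVec p Ω, HasWeakNonlocalGrad s δ w Ω u v}
  add_mem' := fun ⟨v, hv⟩ ⟨v', hv'⟩ => ⟨v + v', hv.add hv'⟩
  zero_mem' := ⟨0, hasWeakNonlocalGrad_zero⟩
  smul_mem' := fun c _ ⟨v, hv⟩ => ⟨c • v, hv.smul c⟩

/-- The weak nonlocal gradient `D_δ^s : H^{s,p,δ}(Ω) → L^p(Ω; ℝⁿ)`. -/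
def D : H s δ w p Ω →ₗ[ℝ] LpVec p Ω where
  toFun u := u.2.choose
  map_add' u u' := (u + u').2.choose_spec.unique (u.2.choose_spec.add u'.2.choose_spec)
  map_smul' c u := (c • u).2.choose_spec.unique (u.2.choose_spec.smul c)

theorem D_spec (u : H s δ w p Ω) : HasWeakNonlocalGrad s δ w Ω u.1 (D s δ w p Ω u) :=
  u.2.choose_spec

/-- `N^{s,p,δ}(Ω) = {h ∈ H^{s,p,δ}(Ω) | D_δ^s h = 0}`. -/
def N : Submodule ℝ (H s δ w p Ω) := LinearMap.ker (D s δ w p Ω)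

/-- The quotient space `H^{s,p,δ}(Ω) / N^{s,p,δ}(Ω)`. -/
def Htilde : Type := H s δ w p Ω ⧸ N s δ w p Ω

instance : AddCommGroup (Htilde s δ w p Ω) :=
  inferInstanceAs (AddCommGroup (H s δ w p Ω ⧸ N s δ w p Ω))

instance : Module ℝ (Htilde s δ w p Ω) :=
  inferInstanceAs (Module ℝ (H s δ w p Ω ⧸ N s δ w p Ω))

/-- The class map `u ↦ [u] = u + N^{s,p,δ}(Ω)`. -/
def Htilde.mk : H s δ w p Ω →ₗ[ℝ] Htilde s δ w p Ω := (N s δ w p Ω).mkQ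

/-- The map `[u] ↦ D_δ^s u` on `H^{s,p,δ}(Ω) / N^{s,p,δ}(Ω)`. -/
def Dtilde : Htilde s δ w p Ω →ₗ[ℝ] LpVec p Ω := (N s δ w p Ω).liftQ (D s δ w p Ω) le_rfl

theorem Dtilde_injective : Function.Injective (Dtilde s δ w p Ω) :=
  LinearMap.ker_eq_bot.1 (Submodule.ker_liftQ_eq_bot _ _ _ le_rfl)

/-- The norm `‖[u]‖ = ‖D_δ^s u‖_{L^p(Ω; ℝⁿ)}`. -/
instance : NormedAddCommGroup (Htilde s δ w p Ω) :=
  NormedAddCommGroup.induced (Htilde s δ w p Ω) (LpVec p Ω) (Dtilde s δ w p Ω)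
    (Dtilde_injective s δ w p Ω)

instance : NormedSpace ℝ (Htilde s δ w p Ω) :=
  NormedSpace.induced ℝ (Htilde s δ w p Ω) (LpVec p Ω) (Dtilde s δ w p Ω)

/-- The Sobolev space `W^{1,p}(Ω) = {v ∈ L^p(Ω) | ∇v ∈ L^p(Ω; ℝⁿ)}`. -/
def W : Submodule ℝ (LpΩ p Ω) where
  carrier := {u | ∃ v : LpVec p Ω, HasWeakGrad Ω u v}
  add_mem' := fun ⟨v, hv⟩ ⟨v', hv'⟩ => ⟨v + v', hv.add hv'⟩
  zero_mem' := ⟨0, hasWeakGrad_const (c := 0) (Lp.coeFn_zero _ _ _)⟩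
  smul_mem' := fun c _ ⟨v, hv⟩ => ⟨c • v, hv.smul c⟩

/-- The weak gradient `∇ : W^{1,p}(Ω) → L^p(Ω; ℝⁿ)`. -/
def grad : W p Ω →ₗ[ℝ] LpVec p Ω where
  toFun u := u.2.choose
  map_add' u u' := (u + u').2.choose_spec.unique (u.2.choose_spec.add u'.2.choose_spec)
  map_smul' c u := (c • u).2.choose_spec.unique (u.2.choose_spec.smul c)

theorem grad_spec (u : W p Ω) : HasWeakGrad Ω u.1 (grad p Ω u) := u.2.choose_spec

/-- The constant functions in `W^{1,p}(Ω)`. -/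
def Const : Submodule ℝ (W p Ω) where
  carrier := {v | ∃ c : ℝ, v.1 =ᵐ[volume.restrict (Ω : Set (E n))] fun _ => c}
  add_mem' := fun {v v'} ⟨c, hc⟩ ⟨c', hc'⟩ => ⟨c + c', by
    filter_upwards [Lp.coeFn_add v.1 v'.1, hc, hc'] with x hx h h'
    exact hx.trans (congrArg₂ (· + ·) h h')⟩
  zero_mem' := ⟨0, Lp.coeFn_zero _ _ _⟩
  smul_mem' := fun a v ⟨c, hc⟩ => ⟨a * c, by
    filter_upwards [Lp.coeFn_smul a v.1, hc] with x hx h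
    exact hx.trans (congrArg (a * ·) h)⟩

theorem Const_le_ker_grad : Const p Ω ≤ LinearMap.ker (grad p Ω) := fun v ⟨_, hc⟩ =>
  LinearMap.mem_ker.2 ((grad_spec p Ω v).unique (hasWeakGrad_const hc))

/-- The quotient space `W^{1,p}(Ω) / {constants}`. -/
def Wtilde : Type := W p Ω ⧸ Const p Ω

instance : AddCommGroup (Wtilde p Ω) := inferInstanceAs (AddCommGroup (W p Ω ⧸ Const p Ω))

instance : Module ℝ (Wtilde p Ω) := inferInstanceAs (Module ℝ (W p Ω ⧸ Const p Ω))

/-- The class map `v ↦ [v] = v + {constants}`. -/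
def Wtilde.mk : W p Ω →ₗ[ℝ] Wtilde p Ω := (Const p Ω).mkQ

/-- The map `[v] ↦ ∇v` on `W^{1,p}(Ω) / {constants}`. -/
def gradTilde : Wtilde p Ω →ₗ[ℝ] LpVec p Ω :=
  (Const p Ω).liftQ (grad p Ω) (Const_le_ker_grad p Ω)

/-- The norm `‖[v]‖ = ‖∇v‖_{L^p(Ω; ℝⁿ)}` (on an arbitrary open set only a seminorm). -/
instance : SeminormedAddCommGroup (Wtilde p Ω) :=
  SeminormedAddCommGroup.induced (Wtilde p Ω) (LpVec p Ω) (gradTilde p Ω)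

instance : NormedSpace ℝ (Wtilde p Ω) :=
  NormedSpace.induced ℝ (Wtilde p Ω) (LpVec p Ω) (gradTilde p Ω)

end spaces

end NonlocalGradient

end

/-! `Q` is the radial antiderivative of the nonlocal kernel: `∇Q(z) = -ρ(z) z / |z|²` off the
origin. Integration by parts therefore turns the nonlocal divergence into `Q * div ψ`
(`nonlocalDiv_eq`). Since `Q` is even, convolution with it is symmetric, so `v` is the weak nonlocal
gradient of `u` exactly when it is the weak gradient of `Q * u` on `Ω` (`hasWeakNonlocalGrad_iff`).
With Young's inequality (`memLp_conv`) this gives the map into `W^{1,p}`, the relation between the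
two gradients and the isometry. Well-definedness on classes uses that a function with zero weak
gradient on a connected open set is constant (`HasWeakGrad.ae_eq_const`).

The main work is surjectivity: every `v` in `W^{1,p}(Ω)` equals `Q * u` on `Ω` for some `u` in
`L^p(Ω_δ)` (`HasWeakGrad.exists_convQ_ae_eq`). The smooth and the rough part of `v` are treated
separately.

Smooth part: the Fourier transform of `Q` is positive and bounded below by a multiple of `1 / (1 +
|ξ|)` (`exists_symbolQ_ge`). Dividing by it solves `Q * u = f` for test functions `f`, with `u`
bounded and continuous (`exists_integral_Q_mul_eq`).

Rough part: near a point of the closure of the Lipschitz domain, averaging over the directions of an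
interior cone represents `χ v` on `Ω` as a smooth function plus a sum of `k_j * X_j`
(`HasWeakGrad.ae_mul_eq`). Here `X_j` is the zero extension of `∂_j(χ v)`, and `k_j = ∫_0^1 t^{-n}
Φ_j(· / t) dt` with `Φ_j(z) = z_j M(z)` for a bump `M`. Up to a smooth function, `Q` is a multiple
of the Riesz kernel of order `1 - s`. The Riesz potential of the fractional Laplacian of `Φ_j` is a
multiple of `Φ_j` (`integral_rieszKernel_mul_fracLap`), and by homogeneity this passes to mixtures
of dilations. Hence `k_j * X = Q * (G_j * X)` plus a smooth function, with `G_j` integrable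
(`exists_conv_dilationMix_eq`). Only integrable kernels act on `X_j`, so Young's inequality covers
all `p` in `[1, ∞]`, endpoints included. A partition of unity adds up the local pieces, and the
smooth remainders fall under the Fourier argument. -/

namespace NonlocalGradient

open Set Filter Topology Metric

variable {n : ℕ} {s δ : ℝ} {w : E n → ℝ} {wbar : ℝ → ℝ}

/-! ### Integrability of powers of the norm. -/

section powers

theorem integrableOn_ball_norm_rpow (hn : 1 ≤ n) {β : ℝ} (hβ : β < n) (R : ℝ) :
    IntegrableOn (fun z : E n => ‖z‖ ^ (-β)) (ball 0 R) := by
  refine integrableOn_ball_of_norm_le_rpow (C := 1) (α := β) (by simpa using hn) (by simpa using hβ)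
    (Eventually.of_forall fun x => ?_)
    (by fun_prop : Measurable fun z : E n => ‖z‖ ^ (-β)).aestronglyMeasurable
  rw [one_mul, Real.norm_of_nonneg (by positivity)]

theorem integrableOn_compl_ball_norm_rpow {β : ℝ} (hβ : (n : ℝ) < β) {R : ℝ} (hR : 0 < R) :
    IntegrableOn (fun z : E n => ‖z‖ ^ (-β)) (ball 0 R)ᶜ := by
  have hβ0 : 0 < β := lt_of_le_of_lt (Nat.cast_nonneg n) hβ
  have h1 : Integrable (fun z : E n => (1 + ‖z‖) ^ (-β)) :=
    integrable_one_add_norm (by simpa using hβ)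
  refine Integrable.mono' ((h1.const_mul ((1 / R + 1) ^ β)).integrableOn (s := (ball 0 R)ᶜ))
    (by fun_prop : Measurable fun z : E n => ‖z‖ ^ (-β)).aestronglyMeasurable ?_
  filter_upwards [ae_restrict_mem measurableSet_ball.compl] with z hz
  have hz' : R ≤ ‖z‖ := by simpa using hz
  have hz0 : 0 < ‖z‖ := hR.trans_le hz'
  rw [Real.norm_of_nonneg (by positivity), Real.rpow_neg (by positivity),
    Real.rpow_neg (by positivity), ← div_eq_mul_inv, le_div_iff₀ (by positivity),
    inv_mul_le_iff₀ (by positivity), ← Real.mul_rpow (by positivity) (by positivity)]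
  refine Real.rpow_le_rpow (by positivity) ?_ hβ0.le
  have : 1 ≤ ‖z‖ / R := (one_le_div hR).2 hz'
  calc 1 + ‖z‖ ≤ ‖z‖ / R + ‖z‖ := by linarith
    _ = ‖z‖ * (1 / R + 1) := by ring

end powers

/-! ### The cut-off function and the normalizing constant. -/

namespace IsCutoff

variable (hw : IsCutoff δ w wbar)
include hw

theorem nonneg (z : E n) : 0 ≤ w z := hw.radial z ▸ hw.profile_nonneg _

theorem continuous : Continuous w := hw.smooth.continuous

theorem le_one (hδ : 0 < δ) (z : E n) : w z ≤ 1 := by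
  obtain ⟨μ, h0, -, h⟩ := hw.normalized
  rw [← h 0 (mem_ball_self (by positivity))]
  exact hw.antitone _ _ (by simp)

theorem abs_le_one (hδ : 0 < δ) (z : E n) : |w z| ≤ 1 := by
  rw [abs_of_nonneg (hw.nonneg z)]; exact hw.le_one hδ z

theorem eq_zero {z : E n} (hz : δ ≤ ‖z‖) : w z = 0 := by
  by_contra h
  have := hw.tsupport_subset (subset_tsupport _ h)
  rw [mem_ball_zero_iff] at this
  linarith

theorem congr_norm {z z' : E n} (h : ‖z‖ = ‖z'‖) : w z = w z' := by
  rw [hw.radial, hw.radial, h]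

theorem profile_eq {e : E n} (he : ‖e‖ = 1) {r : ℝ} (hr : 0 ≤ r) : wbar r = w (r • e) := by
  rw [hw.radial, norm_smul, he, mul_one, Real.norm_of_nonneg hr]

theorem integrable_div_rpow (hδ : 0 < δ) (hn : 1 ≤ n) {β : ℝ} (hβ : β < n) :
    Integrable (fun z : E n => w z / ‖z‖ ^ β) := by
  have h : IntegrableOn (fun z : E n => w z / ‖z‖ ^ β) (ball 0 δ) := by
    refine Integrable.mono' (integrableOn_ball_norm_rpow hn hβ δ)
      ((hw.continuous.measurable.div (by fun_prop)).aestronglyMeasurable) ?_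
    refine Eventually.of_forall fun z => ?_
    rw [norm_div, Real.norm_of_nonneg (by positivity : 0 ≤ ‖z‖ ^ β), Real.rpow_neg (norm_nonneg _),
      div_eq_mul_inv]
    exact mul_le_of_le_one_left (by positivity) (hw.abs_le_one hδ z)
  refine (integrableOn_iff_integrable_of_support_subset fun z hz => ?_).1 h
  rw [mem_ball_zero_iff]
  by_contra hz'
  exact hz (by simp [hw.eq_zero (not_lt.1 hz')])

/-- The exponent `n + s - 1` is below `n`, so the normalizing integral converges and does not take
the default value `0`. It is positive because the integrand is positive on a punctured ball where `w
= 1`. -/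
theorem scaling_pos (hδ : 0 < δ) (hn : 1 ≤ n) (hs1 : s < 1) : 0 < scaling s δ w := by
  refine div_pos (by exact_mod_cast hn) ?_
  obtain ⟨μ, h0, h1, h⟩ := hw.normalized
  have hint := (hw.integrable_div_rpow hδ hn (β := (n : ℝ) + s - 1) (by linarith)).integrableOn
    (s := ball 0 δ)
  rw [setIntegral_pos_iff_support_of_nonneg_ae (Eventually.of_forall fun z =>
    div_nonneg (hw.nonneg z) (by positivity)) hint]
  have hsub : ball (0 : E n) (μ * δ) \ {0} ⊆
      Function.support (fun z : E n => w z / ‖z‖ ^ ((n : ℝ) + s - 1)) ∩ ball 0 δ := by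
    intro z hz
    have hz0 : 0 < ‖z‖ := norm_pos_iff.2 hz.2
    refine ⟨?_, ball_subset_ball (by nlinarith) hz.1⟩
    simp only [Function.mem_support, h z hz.1]
    positivity
  refine lt_of_lt_of_le ?_ (measure_mono hsub)
  have : Nonempty (Fin n) := ⟨⟨0, hn⟩⟩
  rw [measure_sdiff_null (by simp)]
  exact measure_ball_pos _ _ (by positivity)

end IsCutoff

theorem kernel_nonneg (hw : IsCutoff δ w wbar) (hδ : 0 < δ) (hn : 1 ≤ n) (hs1 : s < 1) (z : E n) :
    0 ≤ kernel s δ w z :=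
  mul_nonneg (hw.scaling_pos hδ hn hs1).le (div_nonneg (hw.nonneg z) (by positivity))

theorem measurable_kernel (hw : IsCutoff δ w wbar) : Measurable (kernel s δ w) := by
  unfold kernel
  exact (hw.continuous.measurable.div (by fun_prop)).const_mul _

theorem integrable_kernel (hw : IsCutoff δ w wbar) (hδ : 0 < δ) (hn : 1 ≤ n) (hs1 : s < 1) :
    Integrable (kernel s δ w) :=
  (hw.integrable_div_rpow hδ hn (by linarith)).const_mul _

/-! ### Support, size, singularity and derivative of `Q`. -/

section Qfacts

variable (hw : IsCutoff δ w wbar)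
include hw

/-- No regularity of `wbar` is assumed. On the positive half-line it is `w` along a ray, `wbar r = w
(r • e)` with `e` a unit vector, and inherits continuity from there. -/
theorem profile_intervalIntegrable (hn : 1 ≤ n) {a b : ℝ} (ha : 0 < a) (hb : 0 < b) :
    IntervalIntegrable (fun r => wbar r / r ^ ((n : ℝ) + s)) volume a b := by
  have : Nonempty (Fin n) := ⟨⟨0, hn⟩⟩
  obtain ⟨e, he⟩ := exists_norm_eq (E n) zero_le_one
  refine ContinuousOn.intervalIntegrable ?_
  have hpos : ∀ r ∈ uIcc a b, 0 < r := fun r hr => (lt_min ha hb).trans_le hr.1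
  refine ContinuousOn.div (f := wbar) ?_ ?_ fun r hr => (Real.rpow_pos_of_pos (hpos r hr) _).ne'
  · refine ContinuousOn.congr (f := fun r => w (r • e)) ?_
      fun r hr => hw.profile_eq he (hpos r hr).le
    exact (hw.continuous.comp (by fun_prop)).continuousOn
  · exact continuousOn_id.rpow_const fun r hr => Or.inl (hpos r hr).ne'

theorem Q_eq_zero (hδ : 0 < δ) {x : E n} (hx : δ ≤ ‖x‖) : Q s δ w wbar x = 0 := by
  -- For `‖x‖ > δ` the interval is traversed backwards, but the profile vanishes on all of it.
  rw [Q, intervalIntegral.integral_symm, intervalIntegral.integral_congr (g := fun _ => 0)]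
  · simp
  · intro r hr
    rw [uIcc_of_le hx] at hr
    have h1 : ‖(r / ‖x‖) • x‖ = r := by
      have : 0 < ‖x‖ := hδ.trans_le hx
      rw [norm_smul, Real.norm_of_nonneg (div_nonneg (hδ.le.trans hr.1) this.le)]
      field_simp
    have h2 : wbar r = 0 := by
      rw [← h1, ← hw.radial]; exact hw.eq_zero (by rw [h1]; exact hr.1)
    simp [h2]

omit hw in
theorem Q_congr_norm {x y : E n} (h : ‖x‖ = ‖y‖) : Q s δ w wbar x = Q s δ w wbar y := by
  simp only [Q, h]

omit hw in
theorem Q_neg (x : E n) : Q s δ w wbar (-x) = Q s δ w wbar x := Q_congr_norm (norm_neg x)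

theorem Q_nonneg (hδ : 0 < δ) (hn : 1 ≤ n) (hs1 : s < 1) (x : E n) : 0 ≤ Q s δ w wbar x := by
  rcases le_total δ ‖x‖ with h | h
  · exact (Q_eq_zero hw hδ h).ge
  · refine mul_nonneg (hw.scaling_pos hδ hn hs1).le (intervalIntegral.integral_nonneg h ?_)
    intro r hr
    exact div_nonneg (hw.profile_nonneg r) (Real.rpow_nonneg ((norm_nonneg x).trans hr.1) _)

theorem Q_le (hδ : 0 < δ) (hn : 1 ≤ n) (hs0 : 0 < s) (hs1 : s < 1) (x : E n) (hx : x ≠ 0) :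
    Q s δ w wbar x ≤ scaling s δ w / ((n : ℝ) + s - 1) * ‖x‖ ^ (-((n : ℝ) + s - 1)) := by
  have hc := hw.scaling_pos hδ hn hs1
  have hn' : (1 : ℝ) ≤ n := by exact_mod_cast hn
  have hx0 := norm_pos_iff.2 hx
  have hβ : 0 < (n : ℝ) + s - 1 := by linarith
  rcases le_total δ ‖x‖ with h | h
  · rw [Q_eq_zero hw hδ h]; positivity
  · rw [Q, div_mul_eq_mul_div, mul_div_assoc]
    refine mul_le_mul_of_nonneg_left ?_ hc.le
    have hI : IntervalIntegrable (fun r : ℝ => r ^ (-((n : ℝ) + s))) volume ‖x‖ δ := by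
      refine ContinuousOn.intervalIntegrable (continuousOn_id.rpow_const fun r hr => Or.inl ?_)
      exact ((lt_min hx0 hδ).trans_le hr.1).ne'
    calc ∫ r in ‖x‖..δ, wbar r / r ^ ((n : ℝ) + s)
        ≤ ∫ r in ‖x‖..δ, r ^ (-((n : ℝ) + s)) := by
          refine intervalIntegral.integral_mono_on h
            (profile_intervalIntegrable hw hn hx0 hδ) hI fun r hr => ?_
          have hr0 : 0 < r := hx0.trans_le hr.1
          rw [Real.rpow_neg hr0.le, div_eq_mul_inv]
          refine mul_le_of_le_one_left (by positivity) ?_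
          have h1 : ‖(r / ‖x‖) • x‖ = r := by
            rw [norm_smul, Real.norm_of_nonneg (by positivity)]
            field_simp
          rw [← h1, ← hw.radial]
          exact hw.le_one hδ _
      _ = (‖x‖ ^ (-((n : ℝ) + s - 1)) - δ ^ (-((n : ℝ) + s - 1))) / ((n : ℝ) + s - 1) := by
          rw [integral_rpow (Or.inr ⟨by linarith, fun h0 =>
            absurd h0.1 (not_le.2 (lt_min hx0 hδ))⟩),
            show -((n : ℝ) + s) + 1 = -((n : ℝ) + s - 1) by ring, div_neg, ← neg_div, neg_sub]
      _ ≤ _ := by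
          gcongr
          have : 0 ≤ δ ^ (-((n : ℝ) + s - 1)) := by positivity
          linarith

/-- Where the cut-off equals `1` the radial integral is explicit, so near the origin `Q` is exactly
a Riesz kernel plus a constant. This makes the difference between the two smooth across the origin.
-/
theorem Q_near_zero (hδ : 0 < δ) (hn : 1 ≤ n) (hs0 : 0 < s) :
    ∃ r > 0, ∃ A : ℝ, ∀ x : E n, x ≠ 0 → ‖x‖ < r → Q s δ w wbar x =
      scaling s δ w / ((n : ℝ) + s - 1) * ‖x‖ ^ (-((n : ℝ) + s - 1)) + A := by
  obtain ⟨μ, h0, h1, h⟩ := hw.normalized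
  have hn' : (1 : ℝ) ≤ n := by exact_mod_cast hn
  have hβ : 0 < (n : ℝ) + s - 1 := by linarith
  have hr : 0 < μ * δ := by positivity
  refine ⟨μ * δ, hr, scaling s δ w * (-(μ * δ) ^ (-((n : ℝ) + s - 1)) / ((n : ℝ) + s - 1) +
    ∫ r in (μ * δ)..δ, wbar r / r ^ ((n : ℝ) + s)), fun x hx hxr => ?_⟩
  have hx0 := norm_pos_iff.2 hx
  rw [Q, ← intervalIntegral.integral_add_adjacent_intervals (b := μ * δ)
    (profile_intervalIntegrable hw hn hx0 hr) (profile_intervalIntegrable hw hn hr hδ)]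
  have : ∫ r in ‖x‖..(μ * δ), wbar r / r ^ ((n : ℝ) + s) =
      ∫ r in ‖x‖..(μ * δ), r ^ (-((n : ℝ) + s)) := by
    refine intervalIntegral.integral_congr_ae ?_
    have hne : ∀ᵐ r : ℝ, r ≠ μ * δ := by simp [ae_iff]
    filter_upwards [hne] with r hr1 hr2
    rw [uIoc_of_le hxr.le] at hr2
    have hr0 : 0 < r := hx0.trans hr2.1
    have h1 : ‖(r / ‖x‖) • x‖ = r := by
      rw [norm_smul, Real.norm_of_nonneg (by positivity)]
      field_simp
    have : wbar r = 1 := by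
      rw [← h1, ← hw.radial]
      exact h _ (by rw [mem_ball_zero_iff, h1]; exact lt_of_le_of_ne hr2.2 hr1)
    rw [this, Real.rpow_neg hr0.le, one_div]
  rw [this, integral_rpow (Or.inr ⟨by linarith, fun h0 =>
            absurd h0.1 (not_le.2 (lt_min hx0 hr))⟩),
            show -((n : ℝ) + s) + 1 = -((n : ℝ) + s - 1) by ring]
  field_simp
  ring

/-- The fundamental theorem of calculus in the lower limit, composed with the norm. The factor
`|x|^{-(n+s)}` splits into the power in `ρ` and one further `|x|^{-1}`. -/
theorem hasFDerivAt_Q (hδ : 0 < δ) (hn : 1 ≤ n) {x : E n} (hx : x ≠ 0) :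
    HasFDerivAt (Q s δ w wbar) (-(kernel s δ w x / ‖x‖ ^ 2) • innerSL ℝ x) x := by
  have : Nonempty (Fin n) := ⟨⟨0, hn⟩⟩
  obtain ⟨e, he⟩ := exists_norm_eq (E n) zero_le_one
  have hx0 := norm_pos_iff.2 hx
  have hc : ContinuousAt (fun r => wbar r / r ^ ((n : ℝ) + s)) ‖x‖ := by
    have h1 : ContinuousAt (fun r => w (r • e) / r ^ ((n : ℝ) + s)) ‖x‖ := by
      refine ContinuousAt.div ?_ ?_ (by positivity)
      · exact (hw.continuous.comp (by fun_prop)).continuousAt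
      · exact Real.continuousAt_rpow_const _ _ (Or.inl hx0.ne')
    refine h1.congr ?_
    filter_upwards [lt_mem_nhds hx0] with r hr
    rw [hw.profile_eq he hr.le]
  have hm : StronglyMeasurableAtFilter (fun r => wbar r / r ^ ((n : ℝ) + s)) (𝓝 ‖x‖) := by
    refine ⟨Ioi 0, lt_mem_nhds hx0, ?_⟩
    refine AEStronglyMeasurable.congr (f := fun r => w (r • e) / r ^ ((n : ℝ) + s)) ?_ ?_
    · refine Measurable.aestronglyMeasurable (Measurable.div ?_ (by fun_prop))
      exact (hw.continuous.comp (by fun_prop)).measurable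
    · filter_upwards [ae_restrict_mem measurableSet_Ioi] with r hr
      rw [hw.profile_eq he (le_of_lt hr)]
  have h1 := intervalIntegral.integral_hasDerivAt_left
    (profile_intervalIntegrable (s := s) hw hn hx0 hδ) hm hc
  have h2 : HasFDerivAt (fun y : E n => ‖y‖) (‖x‖⁻¹ • innerSL ℝ x) x := by
    have := ((hasStrictFDerivAt_norm_sq x).hasFDerivAt.sqrt (by positivity))
    simp only [Real.sqrt_sq (norm_nonneg _)] at this
    refine this.congr_fderiv ?_
    ext y
    simp
    field_simp
  have h3 := (h1.comp_hasFDerivAt x h2).const_mul (scaling s δ w)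
  refine h3.congr_fderiv ?_
  rw [kernel, ← hw.radial, smul_smul, smul_smul]
  congr 1
  rw [show (n : ℝ) + s = ((n : ℝ) + s - 1) + 1 by ring, Real.rpow_add_one hx0.ne']
  field_simp
  ring_nf

theorem measurable_Q (hδ : 0 < δ) (hn : 1 ≤ n) : Measurable (Q s δ w wbar) := by
  refine measurable_of_continuousOn_compl_singleton 0 fun x hx => ?_
  exact (hasFDerivAt_Q hw hδ hn hx).continuousAt.continuousWithinAt

theorem integrable_Q (hδ : 0 < δ) (hn : 1 ≤ n) (hs0 : 0 < s) (hs1 : s < 1) :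
    Integrable (Q s δ w wbar) := by
  have : Nonempty (Fin n) := ⟨⟨0, hn⟩⟩
  have h : IntegrableOn (Q s δ w wbar) (ball 0 δ) := by
    refine integrableOn_ball_of_norm_le_rpow (C := scaling s δ w / ((n : ℝ) + s - 1))
      (α := (n : ℝ) + s - 1) (by simpa using hn) (by simp; linarith) ?_
      (measurable_Q hw hδ hn).aestronglyMeasurable
    refine ae_restrict_of_ae ?_
    filter_upwards [Measure.ae_ne volume (0 : E n)] with x hx
    rw [Real.norm_of_nonneg (Q_nonneg hw hδ hn hs1 x)]
    exact Q_le hw hδ hn hs0 hs1 x hx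
  refine (integrableOn_iff_integrable_of_support_subset fun z hz => ?_).1 h
  rw [mem_ball_zero_iff]
  by_contra hz'
  exact hz (Q_eq_zero hw hδ (not_lt.1 hz'))

end Qfacts

end NonlocalGradient

/-! ### Integration by parts: the nonlocal divergence as a convolution with `Q`. -/

namespace NonlocalGradient

open Set Filter Topology Metric

variable {n : ℕ} {s δ : ℝ} {w : E n → ℝ} {wbar : ℝ → ℝ}

theorem integrable_mul_of_bound_on_ball {F h : E n → ℝ} (hF : Integrable F)
    (hF0 : ∀ z, δ ≤ ‖z‖ → F z = 0) (hm : AEStronglyMeasurable h) {C : ℝ}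
    (hC : ∀ z, ‖z‖ < δ → |h z| ≤ C) : Integrable (fun z => F z * h z) := by
  refine (hF.norm.mul_const C).mono' (hF.aestronglyMeasurable.mul hm)
    (Eventually.of_forall fun z => ?_)
  rw [norm_mul]
  rcases lt_or_ge ‖z‖ δ with hz | hz
  · exact mul_le_mul_of_nonneg_left (hC z hz) (norm_nonneg _)
  · simp [hF0 z hz]

theorem integrable_mul_continuous {F h : E n → ℝ} (hF : Integrable F)
    (hF0 : ∀ z, δ ≤ ‖z‖ → F z = 0) (hh : Continuous h) : Integrable (fun z => F z * h z) := by
  obtain ⟨C, hC⟩ := (isCompact_closedBall (0 : E n) δ).exists_bound_of_continuousOn hh.continuousOn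
  exact integrable_mul_of_bound_on_ball hF hF0 hh.aestronglyMeasurable (C := C)
    fun z hz => hC z (by simpa using hz.le)

theorem exists_lipschitz_bound_on_ball {f : E n → ℝ} (hf : ContDiff ℝ 1 f) (hf0 : f 0 = 0) (δ : ℝ) :
    ∃ L, 0 ≤ L ∧ ∀ z, ‖z‖ < δ → |f z| ≤ L * ‖z‖ := by
  obtain ⟨C, hC⟩ := (isCompact_closedBall (0 : E n) δ).exists_bound_of_continuousOn
    (hf.continuous_fderiv (by simp)).continuousOn
  refine ⟨|C|, abs_nonneg _, fun z hz => ?_⟩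
  have := (convex_closedBall (0 : E n) δ).norm_image_sub_le_of_norm_fderiv_le (𝕜 := ℝ) (f := f)
    (C := |C|) (fun x _ => (hf.differentiable (by simp)) x)
    (fun x hx => (hC x hx).trans (le_abs_self _))
    (x := 0) (y := z) (by simpa using (norm_nonneg z).trans hz.le) (by simpa using hz.le)
  simpa [hf0] using this

theorem kernel_eq_zero (hw : IsCutoff δ w wbar) {z : E n} (hz : δ ≤ ‖z‖) : kernel s δ w z = 0 := by
  simp [kernel, hw.eq_zero hz]

/-- Since `f` vanishes at the origin, `|f(z)| ≤ L |z|` on the ball. This compensates `z / |z|²`, and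
only the integrable `ρ` is left. -/
theorem integrable_mul_inner_kernel (hw : IsCutoff δ w wbar) (hδ : 0 < δ) (hn : 1 ≤ n)
    (hs1 : s < 1) {f : E n → ℝ} (hf : ContDiff ℝ 1 f) (hf0 : f 0 = 0) (e : E n) :
    Integrable (fun z => f z * (inner ℝ z e * (kernel s δ w z / ‖z‖ ^ 2))) := by
  obtain ⟨L, hL0, hL⟩ := exists_lipschitz_bound_on_ball hf hf0 δ
  have h := integrable_mul_of_bound_on_ball (h := fun z => f z * inner ℝ z e / ‖z‖ ^ 2)
    (C := L * ‖e‖) (integrable_kernel hw hδ hn hs1) (fun z hz => kernel_eq_zero hw hz)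
    ((hf.continuous.measurable.mul (by fun_prop)).div (by fun_prop)).aestronglyMeasurable ?_
  · refine h.congr (Eventually.of_forall fun z => ?_)
    simp only
    ring
  · intro z hz
    rw [abs_div, abs_mul, abs_of_nonneg (by positivity : 0 ≤ ‖z‖ ^ 2)]
    refine div_le_of_le_mul₀ (by positivity) (by positivity) ?_
    calc |f z| * |inner ℝ z e| ≤ (L * ‖z‖) * (‖z‖ * ‖e‖) :=
          mul_le_mul (hL z hz) (abs_real_inner_le_norm z e) (abs_nonneg _) (by positivity)
      _ = _ := by ring

/-- Integration by parts against the singular kernel `Q`. -/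
theorem integral_Q_mul_fderiv (hw : IsCutoff δ w wbar) (hδ : 0 < δ) (hn : 1 ≤ n) (hs0 : 0 < s)
    (hs1 : s < 1) {f : E n → ℝ} (hf : ContDiff ℝ 1 f) (hf0 : f 0 = 0) (e : E n) :
    ∫ z, Q s δ w wbar z * fderiv ℝ f z e =
      ∫ z, f z * (inner ℝ z e * (kernel s δ w z / ‖z‖ ^ 2)) := by
  have : Nonempty (Fin n) := ⟨⟨0, hn⟩⟩
  have hQi := integrable_Q hw hδ hn hs0 hs1
  have hQ0 : ∀ z, δ ≤ ‖z‖ → Q s δ w wbar z = 0 := fun z hz => Q_eq_zero hw hδ hz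
  obtain ⟨L, hL0, hL⟩ := exists_lipschitz_bound_on_ball hf hf0 δ
  let b : ContDiffBump (0 : E n) := ⟨1, 2, one_pos, one_lt_two⟩
  have hb : ContDiff ℝ 1 b := b.contDiff
  obtain ⟨B, hB⟩ := (b.hasCompactSupport.fderiv (𝕜 := ℝ)).exists_bound_of_continuous
    (hb.continuous_fderiv (by simp))
  have hB0 : 0 ≤ B := (norm_nonneg _).trans (hB 0)
  have hbd0 : ∀ y, 2 < ‖y‖ → fderiv ℝ b y = 0 := fun y hy => by
    by_contra h
    have := support_fderiv_subset ℝ h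
    rw [b.tsupport_eq, mem_closedBall_zero_iff] at this
    exact absurd hy (not_lt.2 this)
  -- The cut-off `θ k` removes a ball of radius `1 / (k + 1)` around the singularity, so that `θ k *
  -- Q` is differentiable everywhere and the usual integration by parts applies. Then `k → ∞`.
  let θ : ℕ → E n → ℝ := fun k z => 1 - b ((k + 1 : ℝ) • z)
  have hθ1 : ∀ k, ContDiff ℝ 1 (θ k) := fun k =>
    contDiff_const.sub (hb.comp (contDiff_const_smul _))
  have hθd : ∀ k z, fderiv ℝ (θ k) z e = -((k + 1 : ℝ) * fderiv ℝ b ((k + 1 : ℝ) • z) e) := by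
    intro k z
    have h1 : HasFDerivAt (fun z : E n => (k + 1 : ℝ) • z) ((k + 1 : ℝ) • ContinuousLinearMap.id ℝ _) z :=
      (hasFDerivAt_id (𝕜 := ℝ) z).const_smul (k + 1 : ℝ)
    have h2 := ((hb.differentiable (by simp) ((k + 1 : ℝ) • z)).hasFDerivAt.comp z h1).const_sub 1
    have h3 : HasFDerivAt (θ k) _ z := h2
    rw [h3.fderiv]
    simp
  have hθle : ∀ k z, |θ k z| ≤ 1 := fun k z => by
    rw [abs_le]; constructor <;> simp only [θ] <;> linarith [b.nonneg (x := (k + 1 : ℝ) • z), b.le_one (x := (k + 1 : ℝ) • z)]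
  have hθ0 : ∀ k : ℕ, ∀ z ∈ ball (0 : E n) (1 / (k + 1 : ℝ)), θ k z = 0 := by
    intro k z hz
    rw [mem_ball_zero_iff, lt_div_iff₀ (by positivity)] at hz
    simp only [θ]
    rw [b.one_of_mem_closedBall, sub_self]
    rw [mem_closedBall_zero_iff, norm_smul, Real.norm_of_nonneg (by positivity)]
    simp only [b]; linarith
  have hev : ∀ z : E n, z ≠ 0 → ∀ᶠ k : ℕ in atTop, 2 < ‖(k + 1 : ℝ) • z‖ := by
    intro z hz
    have h0 := norm_pos_iff.2 hz
    filter_upwards [(tendsto_natCast_atTop_atTop (R := ℝ)).eventually_gt_atTop (2 / ‖z‖)] with k hk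
    rw [norm_smul, Real.norm_of_nonneg (by positivity)]
    rw [div_lt_iff₀ h0] at hk
    nlinarith
  have hgd : ∀ k z, DifferentiableAt ℝ (fun z => θ k z * Q s δ w wbar z) z := by
    intro k z
    by_cases hz : z = 0
    · subst hz
      refine (differentiableAt_const (0 : ℝ)).congr_of_eventuallyEq ?_
      filter_upwards [ball_mem_nhds (0 : E n) (by positivity : 0 < 1 / (k + 1 : ℝ))] with z hz
      rw [hθ0 k z hz, zero_mul]
    · exact ((hθ1 k).differentiable (by simp) z).mul (hasFDerivAt_Q hw hδ hn hz).differentiableAt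
  have hgf : ∀ k, ∀ z : E n, z ≠ 0 → fderiv ℝ (fun z => θ k z * Q s δ w wbar z) z e * f z =
      -(θ k z * (f z * (inner ℝ z e * (kernel s δ w z / ‖z‖ ^ 2)))) +
      Q s δ w wbar z * (fderiv ℝ (θ k) z e * f z) := by
    intro k z hz
    have h1 := ((hθ1 k).differentiable (by simp) z).hasFDerivAt.mul (hasFDerivAt_Q (s := s) hw hδ hn hz)
    have h1' : HasFDerivAt (fun z => θ k z * Q s δ w wbar z) _ z := h1
    rw [h1'.fderiv]
    simp
    ring
  have hi1 : Integrable (fun z => f z * (inner ℝ z e * (kernel s δ w z / ‖z‖ ^ 2))) :=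
    integrable_mul_inner_kernel hw hδ hn hs1 hf hf0 e
  have hi2 : ∀ k, Integrable (fun z => θ k z * (f z * (inner ℝ z e * (kernel s δ w z / ‖z‖ ^ 2)))) :=
    fun k => hi1.bdd_mul (c := 1) (hθ1 k).continuous.aestronglyMeasurable
      (Eventually.of_forall fun z => hθle k z)
  have hcont : ∀ k, Continuous (fun z => fderiv ℝ (θ k) z e * f z) := fun k =>
    (((hθ1 k).continuous_fderiv (by simp)).clm_apply continuous_const).mul hf.continuous
  have hi3 : ∀ k, Integrable (fun z => Q s δ w wbar z * (fderiv ℝ (θ k) z e * f z)) := fun k =>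
    integrable_mul_continuous hQi hQ0 (hcont k)
  have hfd : Continuous (fun z => fderiv ℝ f z e) :=
    (hf.continuous_fderiv (by simp)).clm_apply continuous_const
  have hi4 : Integrable (fun z => Q s δ w wbar z * fderiv ℝ f z e) :=
    integrable_mul_continuous hQi hQ0 hfd
  have hi5 : ∀ k, Integrable (fun z => (θ k z * Q s δ w wbar z) * fderiv ℝ f z e) := fun k => by
    refine (hi4.bdd_mul (c := 1) (hθ1 k).continuous.aestronglyMeasurable
      (Eventually.of_forall fun z => hθle k z)).congr (Eventually.of_forall fun z => ?_)
    simp only; ring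
  have hne : ∀ᵐ z : E n, z ≠ 0 := Measure.ae_ne volume 0
  have key : ∀ k, ∫ z, (θ k z * Q s δ w wbar z) * fderiv ℝ f z e =
      (∫ z, θ k z * (f z * (inner ℝ z e * (kernel s δ w z / ‖z‖ ^ 2)))) -
      ∫ z, Q s δ w wbar z * (fderiv ℝ (θ k) z e * f z) := by
    intro k
    have hae : (fun z => fderiv ℝ (fun z => θ k z * Q s δ w wbar z) z e * f z) =ᵐ[volume]
        fun z => -(θ k z * (f z * (inner ℝ z e * (kernel s δ w z / ‖z‖ ^ 2)))) +
        Q s δ w wbar z * (fderiv ℝ (θ k) z e * f z) := by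
      filter_upwards [hne] with z hz using hgf k z hz
    rw [integral_mul_fderiv_eq_neg_fderiv_mul_of_integrable, integral_congr_ae hae,
      integral_add (f := fun z => -(θ k z * (f z * (inner ℝ z e * (kernel s δ w z / ‖z‖ ^ 2)))))
      (hi2 k).neg (hi3 k), integral_neg]
    · ring
    · exact ((hi2 k).neg.add (hi3 k)).congr hae.symm
    · exact hi5 k
    · have h := (integrable_mul_continuous (δ := δ) hQi hQ0 hf.continuous).bdd_mul (c := 1)
        (hθ1 k).continuous.aestronglyMeasurable (Eventually.of_forall fun z => hθle k z)
      refine h.congr (Eventually.of_forall fun z => ?_)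
      simp only; ring
    · exact fun z _ => hgd k z
    · exact fun z _ => hf.differentiable (by simp) z
  have hlim1 : Tendsto (fun k => ∫ z, (θ k z * Q s δ w wbar z) * fderiv ℝ f z e) atTop
      (𝓝 (∫ z, Q s δ w wbar z * fderiv ℝ f z e)) := by
    refine tendsto_integral_of_dominated_convergence _ (fun k => (hi5 k).aestronglyMeasurable)
      hi4.norm (fun k => Eventually.of_forall fun z => ?_) ?_
    · rw [mul_assoc, norm_mul]
      exact mul_le_of_le_one_left (norm_nonneg _) (hθle k z)
    · filter_upwards [hne] with z hz
      refine tendsto_const_nhds.congr' ?_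
      filter_upwards [hev z hz] with k hk
      simp only [θ]
      rw [b.zero_of_le_dist (by simpa using hk.le)]
      ring
  have hlim2 : Tendsto (fun k => ∫ z, θ k z * (f z * (inner ℝ z e * (kernel s δ w z / ‖z‖ ^ 2)))) atTop
      (𝓝 (∫ z, f z * (inner ℝ z e * (kernel s δ w z / ‖z‖ ^ 2)))) := by
    refine tendsto_integral_of_dominated_convergence _ (fun k => (hi2 k).aestronglyMeasurable)
      hi1.norm (fun k => Eventually.of_forall fun z => ?_) ?_
    · rw [norm_mul]
      exact mul_le_of_le_one_left (norm_nonneg _) (hθle k z)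
    · filter_upwards [hne] with z hz
      refine tendsto_const_nhds.congr' ?_
      filter_upwards [hev z hz] with k hk
      simp only [θ]
      rw [b.zero_of_le_dist (by simpa using hk.le)]
      ring
  -- The cut-off error: `∇θ_k` is of size `k + 1`, but it lives where `(k + 1) |z| ≤ 2`, and there
  -- `|f(z)| ≤ L |z|`. The product stays bounded uniformly in `k`, and it vanishes eventually at
  -- each `z ≠ 0`.
  have hlim3 : Tendsto (fun k => ∫ z, Q s δ w wbar z * (fderiv ℝ (θ k) z e * f z)) atTop
      (𝓝 (∫ _z : E n, (0 : ℝ))) := by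
    refine tendsto_integral_of_dominated_convergence
      (fun z => ‖Q s δ w wbar z‖ * (2 * B * ‖e‖ * L)) (fun k => (hi3 k).aestronglyMeasurable)
      (hQi.norm.mul_const _) (fun k => Eventually.of_forall fun z => ?_) ?_
    · rw [norm_mul]
      rcases lt_or_ge ‖z‖ δ with hz | hz
      · refine mul_le_mul_of_nonneg_left ?_ (norm_nonneg _)
        rw [norm_mul, hθd, norm_neg, norm_mul, Real.norm_of_nonneg (by positivity : 0 ≤ (k + 1 : ℝ))]
        rcases lt_or_ge 2 ‖(k + 1 : ℝ) • z‖ with h2 | h2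
        · rw [hbd0 _ h2]; simp; positivity
        · rw [norm_smul, Real.norm_of_nonneg (by positivity)] at h2
          have h3 : ‖fderiv ℝ b ((k + 1 : ℝ) • z) e‖ ≤ B * ‖e‖ :=
            (ContinuousLinearMap.le_opNorm _ _).trans (mul_le_mul_of_nonneg_right (hB _) (norm_nonneg _))
          calc (k + 1 : ℝ) * ‖fderiv ℝ b ((k + 1 : ℝ) • z) e‖ * ‖f z‖
              ≤ (k + 1 : ℝ) * (B * ‖e‖) * (L * ‖z‖) := by
                gcongr
                exact hL z hz
            _ = ((k + 1 : ℝ) * ‖z‖) * (B * ‖e‖ * L) := by ring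
            _ ≤ 2 * (B * ‖e‖ * L) := by gcongr
            _ = _ := by ring
      · simp [hQ0 z hz]
    · filter_upwards [hne] with z hz
      refine tendsto_const_nhds.congr' ?_
      filter_upwards [hev z hz] with k hk
      rw [hθd, hbd0 _ hk]
      simp
  have h := tendsto_nhds_unique hlim1 ((hlim2.sub hlim3).congr fun k => (key k).symm)
  simpa using h

/-- The divergence of a vector field. -/
noncomputable def divergence (ψ : E n → E n) (x : E n) : ℝ :=
  ∑ i, fderiv ℝ ψ x (EuclideanSpace.single i 1) i

theorem continuous_divergence {ψ : E n → E n} (hψ : ContDiff ℝ 1 ψ) : Continuous (divergence ψ) := by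
  unfold divergence
  refine continuous_finsetSum _ fun i _ => ?_
  exact (EuclideanSpace.proj (𝕜 := ℝ) i).continuous.comp
    ((hψ.continuous_fderiv (by simp)).clm_apply continuous_const)

/-- After substituting `y = x - z`, the integration by parts is applied to each component of `z ↦
ψ(x) - ψ(x - z)`, which vanishes at `z = 0` as required. -/
theorem nonlocalDiv_eq (hw : IsCutoff δ w wbar) (hδ : 0 < δ) (hn : 1 ≤ n) (hs0 : 0 < s)
    (hs1 : s < 1) {ψ : E n → E n} (hψ : ContDiff ℝ 1 ψ) (x : E n) :
    nonlocalDiv s δ w ψ x = ∫ z, Q s δ w wbar z * divergence ψ (x - z) := by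
  have hQi := integrable_Q hw hδ hn hs0 hs1
  have hQ0 : ∀ z, δ ≤ ‖z‖ → Q s δ w wbar z = 0 := fun z hz => Q_eq_zero hw hδ hz
  let f : Fin n → E n → ℝ := fun i z => (ψ x - ψ (x - z)) i
  have hf : ∀ i, ContDiff ℝ 1 (f i) := fun i =>
    (EuclideanSpace.proj (𝕜 := ℝ) i).contDiff.comp
      (contDiff_const.sub (hψ.comp (contDiff_const.sub contDiff_id)))
  have hf0 : ∀ i, f i 0 = 0 := fun i => by simp [f]
  have hfd : ∀ i z e, fderiv ℝ (f i) z e = fderiv ℝ ψ (x - z) e i := by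
    intro i z e
    have h1 : HasFDerivAt (fun z : E n => x - z) (-ContinuousLinearMap.id ℝ _) z :=
      (hasFDerivAt_id z).const_sub x
    have h2 := ((hψ.differentiable (by simp) (x - z)).hasFDerivAt.comp z h1).const_sub (ψ x)
    have h3 : HasFDerivAt (f i) _ z :=
      (EuclideanSpace.proj (𝕜 := ℝ) i).hasFDerivAt.comp z h2
    rw [h3.fderiv]
    simp
  rw [nonlocalDiv, ← integral_sub_left_eq_self _ _ x]
  have h1 : ∀ z, inner ℝ (‖x - (x - z)‖⁻¹ • (ψ x - ψ (x - z))) (‖x - (x - z)‖⁻¹ • (x - (x - z))) *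
      kernel s δ w (x - (x - z)) =
      ∑ i, f i z * (inner ℝ z (EuclideanSpace.single i 1) * (kernel s δ w z / ‖z‖ ^ 2)) := by
    intro z
    rw [sub_sub_cancel, inner_smul_left, inner_smul_right, PiLp.inner_apply]
    simp only [EuclideanSpace.inner_single_right, f]
    rw [Finset.mul_sum, Finset.mul_sum, Finset.sum_mul]
    refine Finset.sum_congr rfl fun i _ => ?_
    simp
    ring
  simp_rw [h1]
  rw [integral_finsetSum _ fun i _ => integrable_mul_inner_kernel hw hδ hn hs1 (hf i) (hf0 i) _]
  simp_rw [divergence, Finset.mul_sum]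
  rw [integral_finsetSum]
  · refine Finset.sum_congr rfl fun i _ => ?_
    rw [← integral_Q_mul_fderiv hw hδ hn hs0 hs1 (hf i) (hf0 i)]
    simp_rw [hfd]
  · intro i _
    refine integrable_mul_continuous hQi hQ0 ?_
    exact (EuclideanSpace.proj (𝕜 := ℝ) i).continuous.comp
      (((hψ.continuous_fderiv (by simp)).comp (by fun_prop)).clm_apply continuous_const)

end NonlocalGradient

/-! ### Lévy exponents and a lower bound for the Fourier symbol of `Q`. -/

namespace NonlocalGradient

open Set Filter Topology Metric

variable {n : ℕ} {s δ : ℝ} {w : E n → ℝ} {wbar : ℝ → ℝ}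

/-- The Lévy exponent `∫ (1 - cos (2π ξ · z)) κ(z) dz` of a jump kernel `κ`. -/
noncomputable def levyExponent (κ : E n → ℝ) (ξ : E n) : ℝ :=
  ∫ z, (1 - Real.cos (2 * Real.pi * inner ℝ ξ z)) * κ z

/-- The reflection in the hyperplane orthogonal to `ξ - η` sends `ξ` to `η` and preserves both
Lebesgue measure and the radial kernel. -/
theorem levyExponent_congr_norm {κ : E n → ℝ} (hκ : ∀ z z', ‖z‖ = ‖z'‖ → κ z = κ z') {ξ η : E n}
    (h : ‖ξ‖ = ‖η‖) : levyExponent κ ξ = levyExponent κ η := by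
  set L := (Submodule.span ℝ {ξ - η})ᗮ.reflection
  have hL : L ξ = η := Submodule.reflection_sub h
  rw [levyExponent, levyExponent]
  conv_rhs => rw [← L.measurePreserving.integral_comp L.toHomeomorph.measurableEmbedding]
  refine integral_congr_ae (Eventually.of_forall fun z => ?_)
  simp only
  rw [← hL, L.inner_map_map, hκ (L z) z (L.norm_map z)]

theorem levyExponent_pos {κ : E n → ℝ} {ξ : E n} (hξ : ξ ≠ 0) (h0 : ∀ z, 0 ≤ κ z) {r : ℝ}
    (hr : 0 < r) (hpos : ∀ z, z ≠ 0 → ‖z‖ < r → 0 < κ z)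
    (hi : Integrable fun z => (1 - Real.cos (2 * Real.pi * inner ℝ ξ z)) * κ z) :
    0 < levyExponent κ ξ := by
  have hξ0 := norm_pos_iff.2 hξ
  rw [levyExponent, integral_pos_iff_support_of_nonneg (fun z =>
    mul_nonneg (sub_nonneg.2 (Real.cos_le_one _)) (h0 z)) hi]
  have hc : Continuous fun z : E n => inner ℝ ξ z := by fun_prop
  -- On this open set `0 < ξ · z < 1`, so the angle lies strictly between `0` and `2π` and the
  -- cosine is not `1`.
  have hU : IsOpen {z : E n | ‖z‖ < min r (1 / ‖ξ‖) ∧ 0 < inner ℝ ξ z} :=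
    (isOpen_lt continuous_norm continuous_const).inter
      (isOpen_lt continuous_const hc)
  refine (hU.measure_pos volume ?_).trans_le (measure_mono ?_)
  · have hm : 0 < min r (1 / ‖ξ‖) := lt_min hr (by positivity)
    refine ⟨(min r (1 / ‖ξ‖) / 2 / ‖ξ‖) • ξ, ?_, ?_⟩
    · rw [norm_smul, Real.norm_of_nonneg (by positivity), div_mul_cancel₀ _ hξ0.ne']
      exact half_lt_self hm
    · rw [inner_smul_right, real_inner_self_eq_norm_sq]
      positivity
  · rintro z ⟨h1, h2⟩
    have hz : z ≠ 0 := by rintro rfl; simp at h2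
    have h3 : inner ℝ ξ z < 1 := by
      refine (real_inner_le_norm ξ z).trans_lt ?_
      have := h1.trans_le (min_le_right _ _)
      rw [lt_div_iff₀ hξ0] at this
      linarith
    refine (mul_pos (sub_pos.2 (lt_of_le_of_ne (Real.cos_le_one _) fun h => ?_))
      (hpos z hz (h1.trans_le (min_le_left _ _)))).ne'
    have hpi := Real.pi_pos
    rw [Real.cos_eq_one_iff_of_lt_of_lt (by nlinarith) (by nlinarith)] at h
    have : 0 < 2 * Real.pi * inner ℝ ξ z := by positivity
    linarith

theorem abs_one_sub_cos_le (t : ℝ) : |1 - Real.cos t| ≤ t ^ 2 / 2 := by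
  rw [abs_of_nonneg (sub_nonneg.2 (Real.cos_le_one t))]
  linarith [Real.one_sub_sq_div_two_le_cos (x := t)]

section symbol

/-- The jump kernel `ρ(z) / |z|²`. -/
noncomputable def jump (s δ : ℝ) (w : E n → ℝ) (z : E n) : ℝ := kernel s δ w z / ‖z‖ ^ 2

/-- The Fourier symbol of the convolution with `Q`. -/
noncomputable def symbolQ (s δ : ℝ) (w : E n → ℝ) (wbar : ℝ → ℝ) (ξ : E n) : ℝ :=
  ∫ z, Q s δ w wbar z * Real.cos (2 * Real.pi * inner ℝ ξ z)

variable (hw : IsCutoff δ w wbar) (hδ : 0 < δ) (hn : 1 ≤ n) (hs0 : 0 < s) (hs1 : s < 1)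
include hw hδ hn hs1

theorem jump_nonneg (z : E n) : 0 ≤ jump s δ w z :=
  div_nonneg (kernel_nonneg hw hδ hn hs1 z) (by positivity)

omit hδ hn hs1 in
theorem measurable_jump : Measurable (jump s δ w) := by
  unfold jump; exact (measurable_kernel hw).div (by fun_prop)

theorem norm_sq_mul_jump_le (z : E n) : ‖z‖ ^ 2 * jump s δ w z ≤ kernel s δ w z := by
  rcases eq_or_ne z 0 with rfl | hz
  · simpa using kernel_nonneg hw hδ hn hs1 0
  · have := norm_pos_iff.2 hz
    rw [jump]; field_simp; rfl

theorem integrable_one_sub_cos_mul_jump (ξ : E n) :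
    Integrable fun z => (1 - Real.cos (2 * Real.pi * inner ℝ ξ z)) * jump s δ w z := by
  refine ((integrable_kernel hw hδ hn hs1).const_mul ((2 * Real.pi * ‖ξ‖) ^ 2 / 2)).mono'
    ((by fun_prop : Measurable fun z : E n => 1 - Real.cos (2 * Real.pi * inner ℝ ξ z)).mul
      (measurable_jump hw)).aestronglyMeasurable (Eventually.of_forall fun z => ?_)
  rw [norm_mul, Real.norm_of_nonneg (jump_nonneg hw hδ hn hs1 z)]
  calc |1 - Real.cos (2 * Real.pi * inner ℝ ξ z)| * jump s δ w z
      ≤ (2 * Real.pi * inner ℝ ξ z) ^ 2 / 2 * jump s δ w z :=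
        mul_le_mul_of_nonneg_right (abs_one_sub_cos_le _) (jump_nonneg hw hδ hn hs1 z)
    _ ≤ (2 * Real.pi * ‖ξ‖) ^ 2 / 2 * ‖z‖ ^ 2 * jump s δ w z := by
        refine mul_le_mul_of_nonneg_right ?_ (jump_nonneg hw hδ hn hs1 z)
        have : (inner ℝ ξ z) ^ 2 ≤ (‖ξ‖ * ‖z‖) ^ 2 := by
          rw [← sq_abs]
          exact pow_le_pow_left₀ (abs_nonneg _) (abs_real_inner_le_norm ξ z) 2
        have h2 := mul_le_mul_of_nonneg_left this (by positivity : 0 ≤ 2 * Real.pi ^ 2)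
        calc _ = 2 * Real.pi ^ 2 * (inner ℝ ξ z) ^ 2 := by ring
          _ ≤ _ := h2
          _ = _ := by ring
    _ ≤ _ := by
        rw [mul_assoc]
        exact mul_le_mul_of_nonneg_left (norm_sq_mul_jump_le hw hδ hn hs1 z) (by positivity)

include hs0 in
-- Integration by parts against `Q` with `f(z) = sin(2π ξ · z)`, differentiated in the direction
-- `ξ`. The right-hand side is the radial derivative of the Lévy exponent of `jump`, which is how it
-- is used below.
theorem norm_sq_mul_symbolQ (ξ : E n) : 4 * Real.pi ^ 2 * ‖ξ‖ ^ 2 * symbolQ s δ w wbar ξ =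
    ∫ z, 2 * Real.pi * inner ℝ ξ z * Real.sin (2 * Real.pi * inner ℝ ξ z) * jump s δ w z := by
  have hd : ∀ z, HasFDerivAt (fun z => Real.sin (2 * Real.pi * inner ℝ ξ z))
      (Real.cos (2 * Real.pi * inner ℝ ξ z) • ((2 * Real.pi) • innerSL ℝ ξ)) z := fun z =>
    ((innerSL ℝ ξ).hasFDerivAt.const_mul (2 * Real.pi)).sin
  have h := integral_Q_mul_fderiv hw hδ hn hs0 hs1
    (f := fun z => Real.sin (2 * Real.pi * inner ℝ ξ z))
    (Real.contDiff_sin.comp (contDiff_const.mul (contDiff_const.inner ℝ contDiff_id)))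
    (by simp) ξ
  have h1 : ∀ z, fderiv ℝ (fun z => Real.sin (2 * Real.pi * inner ℝ ξ z)) z ξ =
      Real.cos (2 * Real.pi * inner ℝ ξ z) * (2 * Real.pi * ‖ξ‖ ^ 2) := fun z => by
    rw [(hd z).fderiv]; simp
  simp_rw [h1, ← mul_assoc] at h
  rw [integral_mul_const, integral_mul_const, integral_mul_const] at h
  have h2 : ∀ z, 2 * Real.pi * inner ℝ ξ z * Real.sin (2 * Real.pi * inner ℝ ξ z) * jump s δ w z =
      2 * Real.pi * (Real.sin (2 * Real.pi * inner ℝ ξ z) * inner ℝ z ξ *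
        (kernel s δ w z / ‖z‖ ^ 2)) := fun z => by
    rw [jump, real_inner_comm]; ring
  simp_rw [h2]
  rw [integral_const_mul, ← h, symbolQ]
  ring

/-- Rescaling `z` by `l` moves the dilation onto the kernel. Because `w` is radially decreasing,
`w(z / l) ≥ w(z)`, so the truncated kernel grows under this scaling at least as fast as the pure
power of degree `-(n + s + 1)`. -/
theorem rpow_mul_levyExponent_jump_le {l : ℝ} (hl : 1 ≤ l) (ξ : E n) :
    l ^ (1 + s) * levyExponent (jump s δ w) ξ ≤ levyExponent (jump s δ w) (l • ξ) := by
  have hl0 : 0 < l := one_pos.trans_le hl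
  have h1 := Measure.integral_comp_smul_of_nonneg (μ := volume) (hR := hl0.le)
    (fun z : E n => (1 - Real.cos (2 * Real.pi * inner ℝ ξ z)) * jump s δ w (l⁻¹ • z)) l
  have hj : ∀ z, l ^ ((n : ℝ) + s + 1) * jump s δ w z ≤ jump s δ w (l⁻¹ • z) := by
    intro z
    rcases eq_or_ne z 0 with rfl | hz
    · simp [jump]
    have hz0 := norm_pos_iff.2 hz
    have hc := hw.scaling_pos hδ hn hs1
    have hm : w z ≤ w (l⁻¹ • z) := hw.antitone _ _ (by
      rw [norm_smul, Real.norm_of_nonneg (by positivity)]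
      exact mul_le_of_le_one_left hz0.le (inv_le_one_of_one_le₀ hl))
    have e1 : (l⁻¹ * ‖z‖) ^ ((n : ℝ) + s - 1) * l ^ ((n : ℝ) + s - 1) = ‖z‖ ^ ((n : ℝ) + s - 1) := by
      rw [← Real.mul_rpow (by positivity) hl0.le]
      congr 1; field_simp
    have e2 : l ^ ((n : ℝ) + s + 1) = l ^ ((n : ℝ) + s - 1) * l ^ 2 := by
      rw [← Real.rpow_natCast, ← Real.rpow_add hl0]; congr 1; push_cast; ring
    have hA : 0 < (l⁻¹ * ‖z‖) ^ ((n : ℝ) + s - 1) := by positivity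
    have hB : 0 < l ^ ((n : ℝ) + s - 1) := by positivity
    simp only [jump, kernel, norm_smul, Real.norm_of_nonneg (inv_nonneg.2 hl0.le)]
    rw [← e1, e2]
    calc _ = scaling s δ w * (w z / (l⁻¹ * ‖z‖) ^ ((n : ℝ) + s - 1)) / (l⁻¹ * ‖z‖) ^ 2 := by
          field_simp
      _ ≤ _ := by gcongr
  have h2 : levyExponent (jump s δ w) (l • ξ) = (l ^ n)⁻¹ *
      ∫ z, (1 - Real.cos (2 * Real.pi * inner ℝ ξ z)) * jump s δ w (l⁻¹ • z) := by
    rw [finrank_euclideanSpace_fin, smul_eq_mul] at h1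
    rw [← h1, levyExponent]
    refine integral_congr_ae (Eventually.of_forall fun z => ?_)
    simp only [inv_smul_smul₀ hl0.ne', inner_smul_left, inner_smul_right]
    simp
  have hint : Integrable fun z => (1 - Real.cos (2 * Real.pi * inner ℝ ξ z)) *
      jump s δ w (l⁻¹ • z) := by
    have := integrable_one_sub_cos_mul_jump hw hδ hn hs1 (l • ξ)
    have h3 := this.comp_smul (R := l⁻¹) (by positivity)
    refine h3.congr (Eventually.of_forall fun z => ?_)
    simp [inner_smul_left, inner_smul_right, hl0.ne']
  rw [h2, levyExponent, ← integral_const_mul, ← integral_const_mul]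
  refine integral_mono ((integrable_one_sub_cos_mul_jump hw hδ hn hs1 ξ).const_mul _)
    (hint.const_mul _) fun z => ?_
  have e3 : l ^ (1 + s) = (l ^ n)⁻¹ * l ^ ((n : ℝ) + s + 1) := by
    rw [← Real.rpow_natCast, ← Real.rpow_neg hl0.le, ← Real.rpow_add hl0]
    congr 1; ring
  have h0 : 0 ≤ 1 - Real.cos (2 * Real.pi * inner ℝ ξ z) := sub_nonneg.2 (Real.cos_le_one _)
  simp only
  rw [e3]
  calc _ = (l ^ n)⁻¹ * ((1 - Real.cos (2 * Real.pi * inner ℝ ξ z)) *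
        (l ^ ((n : ℝ) + s + 1) * jump s δ w z)) := by ring
    _ ≤ _ := by gcongr; exact hj z

include hs0 in
-- With `A` the Lévy exponent of `jump`, the right-hand side is the derivative of `l ↦ A(l ξ)` at `l
-- = 1`. The bound `A(l ξ) ≥ l^{1+s} A(ξ)` and Bernoulli's inequality bound the difference quotients
-- below by `(1 + s) A(ξ)`.
theorem levyExponent_jump_le_symbolQ (ξ : E n) :
    (1 + s) * levyExponent (jump s δ w) ξ ≤ 4 * Real.pi ^ 2 * ‖ξ‖ ^ 2 * symbolQ s δ w wbar ξ := by
  rw [norm_sq_mul_symbolQ hw hδ hn hs0 hs1]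
  have hder := (hasDerivAt_integral_of_dominated_loc_of_deriv_le (μ := (volume : Measure (E n)))
    (F := fun (l : ℝ) z => (1 - Real.cos (2 * Real.pi * inner ℝ (l • ξ) z)) * jump s δ w z)
    (F' := fun (l : ℝ) z => 2 * Real.pi * inner ℝ ξ z * Real.sin (2 * Real.pi * (l * inner ℝ ξ z)) *
      jump s δ w z) (x₀ := 1) (s := ball 1 1) (ball_mem_nhds _ one_pos)
    (bound := fun z => 8 * Real.pi ^ 2 * ‖ξ‖ ^ 2 * kernel s δ w z)
    (Eventually.of_forall fun l =>
      (integrable_one_sub_cos_mul_jump hw hδ hn hs1 (l • ξ)).aestronglyMeasurable)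
    (integrable_one_sub_cos_mul_jump hw hδ hn hs1 _)
    ((by fun_prop : Measurable fun z : E n => 2 * Real.pi * inner ℝ ξ z *
      Real.sin (2 * Real.pi * (1 * inner ℝ ξ z))).mul
      (measurable_jump hw)).aestronglyMeasurable
    (Eventually.of_forall fun z l hl => ?_) ((integrable_kernel hw hδ hn hs1).const_mul _)
    (Eventually.of_forall fun z l hl => ?_)).2
  -- Quotients from the right suffice, and the scaling bound is available only for `l ≥ 1`.
  · have h2 := hder.tendsto_slope.mono_left (show 𝓝[>] (1 : ℝ) ≤ 𝓝[≠] 1 from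
      nhdsWithin_mono _ fun l (hl : 1 < l) => hl.ne')
    simp only [one_mul] at h2
    refine ge_of_tendsto h2 ?_
    filter_upwards [self_mem_nhdsWithin] with l hl
    have hl' : (1 : ℝ) < l := hl
    rw [slope_def_field, le_div_iff₀ (by linarith)]
    have h3 := rpow_mul_levyExponent_jump_le hw hδ hn hs1 hl'.le ξ
    have h4 := one_add_mul_self_le_rpow_one_add (s := l - 1) (by linarith) (p := 1 + s) (by linarith)
    rw [add_sub_cancel] at h4
    have h5 : 0 ≤ levyExponent (jump s δ w) ξ := integral_nonneg fun z =>
      mul_nonneg (sub_nonneg.2 (Real.cos_le_one _)) (jump_nonneg hw hδ hn hs1 z)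
    simp only [one_smul]
    change _ ≤ levyExponent (jump s δ w) (l • ξ) - levyExponent (jump s δ w) ξ
    nlinarith
  · rw [mem_ball, Real.dist_eq, abs_lt] at hl
    rw [norm_mul, norm_mul, Real.norm_of_nonneg (jump_nonneg hw hδ hn hs1 z)]
    have h1 : ‖Real.sin (2 * Real.pi * (l * inner ℝ ξ z))‖ ≤ 4 * Real.pi * (‖ξ‖ * ‖z‖) := by
      refine Real.abs_sin_le_abs.trans ?_
      rw [abs_mul, abs_of_nonneg (by positivity : 0 ≤ 2 * Real.pi), abs_mul]
      have : |l| ≤ 2 := abs_le.2 ⟨by linarith, by linarith⟩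
      calc 2 * Real.pi * (|l| * |inner ℝ ξ z|) ≤ 2 * Real.pi * (2 * (‖ξ‖ * ‖z‖)) := by
            gcongr; exact abs_real_inner_le_norm ξ z
        _ = _ := by ring
    have h2 : ‖2 * Real.pi * inner ℝ ξ z‖ ≤ 2 * Real.pi * (‖ξ‖ * ‖z‖) := by
      rw [norm_mul, Real.norm_of_nonneg (by positivity : 0 ≤ 2 * Real.pi)]
      gcongr; exact abs_real_inner_le_norm ξ z
    calc _ ≤ 2 * Real.pi * (‖ξ‖ * ‖z‖) * (4 * Real.pi * (‖ξ‖ * ‖z‖)) * jump s δ w z := by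
          gcongr
          exact jump_nonneg hw hδ hn hs1 z
      _ = 8 * Real.pi ^ 2 * ‖ξ‖ ^ 2 * (‖z‖ ^ 2 * jump s δ w z) := by ring
      _ ≤ _ := by gcongr; exact norm_sq_mul_jump_le hw hδ hn hs1 z
  · have h1 : HasDerivAt (fun l : ℝ => 2 * Real.pi * inner ℝ (l • ξ) z)
        (2 * Real.pi * inner ℝ ξ z) l := by
      have : (fun l : ℝ => 2 * Real.pi * inner ℝ (l • ξ) z) =
          fun l => l * (2 * Real.pi * inner ℝ ξ z) := by
        ext l; rw [real_inner_smul_left]; ring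
      rw [this]
      exact hasDerivAt_mul_const _
    have h2 := (h1.cos.const_sub 1).mul_const (jump s δ w z)
    refine h2.congr_deriv ?_
    rw [real_inner_smul_left]; ring

theorem levyExponent_jump_pos {ξ : E n} (hξ : ξ ≠ 0) : 0 < levyExponent (jump s δ w) ξ := by
  obtain ⟨μ, h0, h1, h⟩ := hw.normalized
  refine levyExponent_pos hξ (jump_nonneg hw hδ hn hs1) (r := μ * δ) (by positivity) ?_
    (integrable_one_sub_cos_mul_jump hw hδ hn hs1 ξ)
  intro z hz hzr
  have hz0 := norm_pos_iff.2 hz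
  have hc := hw.scaling_pos hδ hn hs1
  rw [jump, kernel, h z (by simpa using hzr)]
  positivity

include hs0

theorem continuous_symbolQ : Continuous (symbolQ s δ w wbar) := by
  have hQ := integrable_Q hw hδ hn hs0 hs1
  refine continuous_of_dominated (bound := fun z => ‖Q s δ w wbar z‖) (fun ξ => ?_)
    (fun ξ => Eventually.of_forall fun z => ?_) hQ.norm (Eventually.of_forall fun z => by fun_prop)
  · exact hQ.aestronglyMeasurable.mul (by fun_prop)
  · rw [norm_mul]
    exact mul_le_of_le_one_right (norm_nonneg _) (Real.abs_cos_le_one _)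

/-- Away from the origin this follows from positivity of the Lévy exponent. At `ξ = 0` the symbol is
`∫ Q`, which dominates its value at any other frequency since `Q ≥ 0`. -/
theorem symbolQ_pos (ξ : E n) : 0 < symbolQ s δ w wbar ξ := by
  have hQ := integrable_Q hw hδ hn hs0 hs1
  have hpos : ∀ ξ : E n, ξ ≠ 0 → 0 < symbolQ s δ w wbar ξ := by
    intro ξ hξ
    have h1 := levyExponent_jump_le_symbolQ hw hδ hn hs0 hs1 ξ
    have h2 := levyExponent_jump_pos hw hδ hn hs1 hξ
    have h3 := norm_pos_iff.2 hξ
    by_contra h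
    have : 4 * Real.pi ^ 2 * ‖ξ‖ ^ 2 * symbolQ s δ w wbar ξ ≤ 0 :=
      mul_nonpos_of_nonneg_of_nonpos (by positivity) (not_lt.1 h)
    nlinarith
  rcases eq_or_ne ξ 0 with rfl | hξ
  · have : Nonempty (Fin n) := ⟨⟨0, hn⟩⟩
    obtain ⟨e, he⟩ := exists_norm_eq (E n) zero_le_one
    refine (hpos e (by rw [← norm_ne_zero_iff, he]; exact one_ne_zero)).trans_le ?_
    refine integral_mono (hQ.mul_bdd (c := 1) (by fun_prop)
      (Eventually.of_forall fun z => Real.abs_cos_le_one _)) ?_ fun z => ?_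
    · simpa using hQ
    · simp only [inner_zero_left, mul_zero, Real.cos_zero]
      exact mul_le_mul_of_nonneg_left (Real.cos_le_one _) (Q_nonneg hw hδ hn hs1 z)
  · exact hpos ξ hξ

/-- Compactness handles `|ξ| ≤ 1`. For `|ξ| ≥ 1`, scaling from a unit vector yields a lower bound of
order `|ξ|^{s-1}`. It is weakened to `|ξ|^{-1}`, enough for division of Schwartz functions. -/
theorem exists_symbolQ_ge : ∃ c > 0, ∀ ξ : E n, c ≤ (1 + ‖ξ‖) * symbolQ s δ w wbar ξ := by
  have : Nonempty (Fin n) := ⟨⟨0, hn⟩⟩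
  obtain ⟨e, he⟩ := exists_norm_eq (E n) zero_le_one
  have he0 : e ≠ 0 := by rw [← norm_ne_zero_iff, he]; exact one_ne_zero
  obtain ⟨ξ₀, -, hξ₀⟩ := (isCompact_closedBall (0 : E n) 1).exists_isMinOn
    (nonempty_closedBall.2 zero_le_one) (continuous_symbolQ hw hδ hn hs0 hs1).continuousOn
  have hJ := levyExponent_jump_pos hw hδ hn hs1 he0
  refine ⟨min (symbolQ s δ w wbar ξ₀) ((1 + s) * levyExponent (jump s δ w) e / (4 * Real.pi ^ 2)),
    lt_min (symbolQ_pos hw hδ hn hs0 hs1 _) (by positivity), fun ξ => ?_⟩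
  have hq := symbolQ_pos hw hδ hn hs0 hs1 ξ
  rcases le_total ‖ξ‖ 1 with h | h
  · refine (min_le_left _ _).trans ((hξ₀ (by simpa using h)).trans ?_)
    nlinarith [norm_nonneg ξ]
  · refine (min_le_right _ _).trans ?_
    rw [div_le_iff₀ (by positivity)]
    have hξ0 : 0 < ‖ξ‖ := one_pos.trans_le h
    have h1 := levyExponent_jump_le_symbolQ hw hδ hn hs0 hs1 ξ
    have h2 := rpow_mul_levyExponent_jump_le hw hδ hn hs1 h e
    have h3 : levyExponent (jump s δ w) (‖ξ‖ • e) = levyExponent (jump s δ w) ξ :=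
      levyExponent_congr_norm (fun z z' hz => by simp only [jump, kernel, hz, hw.congr_norm hz])
        (by rw [norm_smul, he, norm_norm, mul_one])
    have h4 : ‖ξ‖ ≤ ‖ξ‖ ^ (1 + s) := by
      conv_lhs => rw [← Real.rpow_one ‖ξ‖]
      exact Real.rpow_le_rpow_of_exponent_le h (by linarith)
    rw [h3] at h2
    have h5 : ‖ξ‖ * ((1 + s) * levyExponent (jump s δ w) e) ≤
        ‖ξ‖ * (‖ξ‖ * symbolQ s δ w wbar ξ * (4 * Real.pi ^ 2)) := by
      calc _ = (1 + s) * (‖ξ‖ * levyExponent (jump s δ w) e) := by ring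
        _ ≤ (1 + s) * (‖ξ‖ ^ (1 + s) * levyExponent (jump s δ w) e) := by gcongr
        _ ≤ (1 + s) * levyExponent (jump s δ w) ξ := by gcongr
        _ ≤ _ := h1
        _ = _ := by ring
    have h6 := le_of_mul_le_mul_left h5 hξ0
    nlinarith [Real.pi_pos, mul_pos hq (by positivity : 0 < 4 * Real.pi ^ 2)]

end symbol

end NonlocalGradient

/-! ### Solving `Q * u = f` for test functions by Fourier inversion. -/

namespace NonlocalGradient

open Set Filter Topology Metric
open scoped FourierTransform

variable {n : ℕ} {s δ : ℝ} {w : E n → ℝ} {wbar : ℝ → ℝ}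

section fourier

theorem fourier_comp_neg_of_even {K : E n → ℂ} (hK : ∀ z, K (-z) = K z) (ξ : E n) :
    𝓕 K (-ξ) = 𝓕 K ξ := by
  rw [← Real.fourierInv_eq_fourier_neg, Real.fourierInv_eq_fourier_comp_neg]
  simp_rw [hK]

/-- The transform of an even function is even, so it equals the mean of its values at `ξ` and `-ξ`,
in which the exponentials combine to a cosine. -/
theorem fourier_ofReal_of_even {K : E n → ℝ} (hi : Integrable K) (hK : ∀ z, K (-z) = K z) (ξ : E n) :
    𝓕 (fun z => (K z : ℂ)) ξ = ((∫ z, K z * Real.cos (2 * Real.pi * inner ℝ ξ z) : ℝ) : ℂ) := by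
  have h1 : 𝓕 (fun z => (K z : ℂ)) ξ + 𝓕 (fun z => (K z : ℂ)) (-ξ) =
      2 * ((∫ z, K z * Real.cos (2 * Real.pi * inner ℝ ξ z) : ℝ) : ℂ) := by
    rw [Real.fourier_eq', Real.fourier_eq', ← integral_add, ← integral_complex_ofReal,
      ← integral_const_mul]
    · refine integral_congr_ae (Eventually.of_forall fun z => ?_)
      simp only [smul_eq_mul, inner_neg_right, mul_neg]
      rw [← add_mul]
      push_cast
      rw [Complex.cos, real_inner_comm]
      ring_nf
    · refine (hi.ofReal (𝕜 := ℂ)).bdd_mul (c := 1) (by fun_prop) (Eventually.of_forall fun z => ?_)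
      rw [Complex.norm_exp_ofReal_mul_I]
    · refine (hi.ofReal (𝕜 := ℂ)).bdd_mul (c := 1) (by fun_prop) (Eventually.of_forall fun z => ?_)
      rw [Complex.norm_exp_ofReal_mul_I]
  rw [fourier_comp_neg_of_even (fun z => by rw [hK])] at h1
  linear_combination h1 / 2

/-- A convolution theorem needing only that `K` and `g` are integrable. Translation by `x` becomes a
modulation of `g`, and the Fourier transform is then moved from `g` to `K` by Fubini. -/
theorem integral_mul_fourierInv_sub {K g : E n → ℂ} (hK : Integrable K) (hg : Integrable g) (x : E n) :
    ∫ y, K (x - y) * 𝓕⁻ g y = 𝓕⁻ (fun ξ => 𝓕 K ξ * g ξ) x := by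
  rw [← integral_sub_left_eq_self _ _ x]
  have h1 : ∀ z, 𝓕⁻ g (x - z) = 𝓕 (fun ξ => Real.fourierChar (inner ℝ ξ x) • g ξ) z := by
    intro z
    rw [Real.fourierInv_eq, Real.fourier_eq]
    refine integral_congr_ae (Eventually.of_forall fun ξ => ?_)
    simp only
    rw [smul_smul, ← AddChar.map_add_eq_mul, inner_sub_right, neg_add_eq_sub]
  have hg' : Integrable (fun ξ => Real.fourierChar (inner ℝ ξ x) • g ξ) := by
    refine hg.norm.mono' ?_ (Eventually.of_forall fun ξ => by rw [Circle.norm_smul])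
    exact (Continuous.aestronglyMeasurable (by fun_prop)).smul hg.aestronglyMeasurable
  have h2 := VectorFourier.integral_fourierIntegral_smul_eq_flip (e := Real.fourierChar)
    (μ := volume) (ν := volume) (L := innerₗ (E n)) Real.continuous_fourierChar continuous_inner hK hg'
  rw [flip_innerₗ] at h2
  simp_rw [sub_sub_cancel, h1]
  rw [Real.fourierInv_eq]
  refine Eq.trans h2.symm (integral_congr_ae (Eventually.of_forall fun ξ => ?_))
  simp only [smul_eq_mul]
  rw [mul_smul_comm]
  rfl

end fourier

/-- The convolution equation `Q * u = f` with smooth compactly supported right-hand side has a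
bounded continuous solution on the whole space. -/
theorem exists_integral_Q_mul_eq (hw : IsCutoff δ w wbar) (hδ : 0 < δ) (hn : 1 ≤ n) (hs0 : 0 < s)
    (hs1 : s < 1) {f : E n → ℝ} (hf : ContDiff ℝ (⊤ : ℕ∞) f) (hfc : HasCompactSupport f) :
    ∃ u : E n → ℝ, Continuous u ∧ (∃ C, ∀ x, |u x| ≤ C) ∧
      ∀ x, ∫ y, Q s δ w wbar (x - y) * u y = f x := by
  have hQ := integrable_Q hw hδ hn hs0 hs1
  have hfc' : HasCompactSupport (fun x => (f x : ℂ)) := hfc.comp_left (g := Complex.ofReal) (by simp)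
  let F : SchwartzMap (E n) ℂ := hfc'.toSchwartzMap (Complex.ofRealCLM.contDiff.comp hf)
  have hF : ∀ x, F x = (f x : ℂ) := fun x => rfl
  obtain ⟨c, hc, hcξ⟩ := exists_symbolQ_ge hw hδ hn hs0 hs1
  -- The transform that the solution must have. It is integrable because the inverse symbol grows at
  -- most linearly and `𝓕 F` is Schwartz; its inverse transform is therefore bounded and continuous.
  let g : E n → ℂ := fun ξ => (symbolQ s δ w wbar ξ : ℂ)⁻¹ * (𝓕 F) ξ
  have hq : ∀ ξ : E n, 0 < symbolQ s δ w wbar ξ := symbolQ_pos hw hδ hn hs0 hs1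
  have hgi : Integrable g := by
    have h1 := ((𝓕 F).integrable_pow_mul volume 0).add ((𝓕 F).integrable_pow_mul volume 1)
    refine (h1.const_mul c⁻¹).mono' ?_ (Eventually.of_forall fun ξ => ?_)
    · refine Continuous.aestronglyMeasurable (Continuous.mul ?_ (𝓕 F).continuous)
      refine (Complex.continuous_ofReal.comp (continuous_symbolQ hw hδ hn hs0 hs1)).inv₀ fun ξ => ?_
      exact Complex.ofReal_ne_zero.2 (hq ξ).ne'
    · simp only [g, norm_mul, norm_inv, Complex.norm_real, Real.norm_of_nonneg (hq ξ).le, Pi.add_apply,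
        pow_zero, pow_one]
      rw [← add_mul, ← mul_assoc]
      refine mul_le_mul_of_nonneg_right ?_ (norm_nonneg _)
      rw [inv_le_iff_one_le_mul₀ (hq ξ), mul_assoc, ← div_eq_inv_mul, one_le_div hc]
      exact hcξ ξ
  have hcont : Continuous (𝓕⁻ g) := by
    rw [show 𝓕⁻ g = fun x => 𝓕 g (-x) from funext fun x => Real.fourierInv_eq_fourier_neg g x]
    exact (VectorFourier.fourierIntegral_continuous Real.continuous_fourierChar
      continuous_inner hgi).comp continuous_neg
  have hbd : ∀ x, ‖𝓕⁻ g x‖ ≤ ∫ ξ, ‖g ξ‖ := fun x => by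
    rw [Real.fourierInv_eq]
    refine (norm_integral_le_integral_norm _).trans_eq ?_
    simp_rw [Circle.norm_smul]
  refine ⟨fun x => (𝓕⁻ g x).re, Complex.continuous_re.comp hcont,
    ⟨∫ ξ, ‖g ξ‖, fun x => (Complex.abs_re_le_norm _).trans (hbd x)⟩, fun x => ?_⟩
  have h1 := integral_mul_fourierInv_sub (K := fun z => (Q s δ w wbar z : ℂ)) hQ.ofReal hgi x
  have h2 : ∀ ξ, 𝓕 (fun z => (Q s δ w wbar z : ℂ)) ξ * g ξ = (𝓕 F) ξ := by
    intro ξ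
    rw [fourier_ofReal_of_even hQ Q_neg]
    have : (symbolQ s δ w wbar ξ : ℂ) ≠ 0 := by exact_mod_cast (hq ξ).ne'
    exact mul_inv_cancel_left₀ this _
  simp_rw [h2] at h1
  have h3 : 𝓕⁻ (fun ξ : E n => (𝓕 F : SchwartzMap (E n) ℂ) ξ) x = (f x : ℂ) := by
    have : 𝓕⁻ (𝓕 F) = F := FourierTransform.fourierInv_fourier_eq F
    have h4 := congrArg (fun G : SchwartzMap (E n) ℂ => G x) this
    simp only [SchwartzMap.fourierInv_coe] at h4
    rw [← hF x, ← h4]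
  rw [h3] at h1
  have hint : Integrable (fun y => (Q s δ w wbar (x - y) : ℂ) * 𝓕⁻ g y) :=
    ((hQ.comp_sub_left x).ofReal (𝕜 := ℂ)).mul_bdd (c := ∫ ξ, ‖g ξ‖) hcont.aestronglyMeasurable
      (Eventually.of_forall hbd)
  have h5 := congrArg Complex.re h1
  rw [Complex.ofReal_re] at h5
  rw [← h5]
  have h6 := integral_re (𝕜 := ℂ) hint
  refine Eq.trans (integral_congr_ae (Eventually.of_forall fun y => ?_)) h6
  simp

end NonlocalGradient

/-! ### The fractional Laplacian of a test function and its Fourier transform. -/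

namespace NonlocalGradient

open Set Filter Topology Metric
open scoped FourierTransform

variable {n : ℕ} {s δ : ℝ} {w : E n → ℝ} {wbar : ℝ → ℝ}

section hypersingular

variable {α : ℝ}

/-- The jump kernel `|z|^{-(n+α)}` of the fractional Laplacian of order `α`. -/
noncomputable def stableKernel (α : ℝ) (z : E n) : ℝ := ‖z‖ ^ (-((n : ℝ) + α))

theorem stableKernel_nonneg (z : E n) : 0 ≤ stableKernel α z := by unfold stableKernel; positivity

theorem measurable_stableKernel : Measurable (stableKernel α : E n → ℝ) := by
  unfold stableKernel; fun_prop

theorem integrable_min_one_norm_mul_stableKernel (hn : 1 ≤ n) (h0 : 0 < α) (h1 : α < 1) :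
    Integrable (fun z : E n => min 1 ‖z‖ * stableKernel α z) := by
  have hm : Measurable (fun z : E n => min 1 ‖z‖ * stableKernel α z) :=
    Measurable.mul (by fun_prop) measurable_stableKernel
  rw [← integrableOn_univ, ← union_compl_self (ball (0 : E n) 1)]
  refine IntegrableOn.union ?_ ?_
  · refine Integrable.mono' (integrableOn_ball_norm_rpow hn (β := (n : ℝ) + α - 1) (by linarith) 1)
      hm.aestronglyMeasurable (Eventually.of_forall fun z => ?_)
    rw [norm_mul, Real.norm_of_nonneg (stableKernel_nonneg z), Real.norm_of_nonneg (by positivity)]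
    rcases eq_or_ne z 0 with rfl | hz
    · simp; positivity
    · have hz0 := norm_pos_iff.2 hz
      rw [stableKernel, show -((n : ℝ) + α - 1) = 1 + -((n : ℝ) + α) by ring, Real.rpow_add hz0,
        Real.rpow_one]
      gcongr
      exact min_le_right _ _
  · refine Integrable.mono' (integrableOn_compl_ball_norm_rpow (β := (n : ℝ) + α) (by linarith)
      one_pos) hm.aestronglyMeasurable (Eventually.of_forall fun z => ?_)
    rw [norm_mul, Real.norm_of_nonneg (stableKernel_nonneg z), Real.norm_of_nonneg (by positivity)]
    exact mul_le_of_le_one_left (stableKernel_nonneg z) (min_le_left _ _)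

/-- The Lipschitz bound serves for small `z`, the sup bound for large `z`. The indicators record
that the difference vanishes unless `x` or `x - z` meets the support; they provide the integrability
in `x`. -/
theorem exists_difference_bound {Φ : E n → ℝ} (hΦ : ContDiff ℝ 1 Φ) (hc : HasCompactSupport Φ) :
    ∃ C R : ℝ, 0 ≤ C ∧ ∀ x z, |Φ x - Φ (x - z)| ≤ C * min 1 ‖z‖ *
      ((closedBall (0 : E n) R).indicator 1 x + (closedBall (0 : E n) R).indicator 1 (x - z)) := by
  obtain ⟨K, hK⟩ := hΦ.lipschitzWith_of_hasCompactSupport hc (by simp)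
  obtain ⟨C₀, hC₀⟩ := hc.exists_bound_of_continuous hΦ.continuous
  obtain ⟨R, hR⟩ := hc.isBounded.subset_closedBall 0
  have hC₀' : 0 ≤ C₀ := (norm_nonneg _).trans (hC₀ 0)
  have hz : ∀ x, x ∉ closedBall (0 : E n) R → Φ x = 0 := fun x hx =>
    image_eq_zero_of_notMem_tsupport fun h => hx (hR h)
  refine ⟨2 * C₀ + K, R, by positivity, fun x z => ?_⟩
  have hb : |Φ x - Φ (x - z)| ≤ (2 * C₀ + K) * min 1 ‖z‖ := by
    rcases le_total 1 ‖z‖ with h | h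
    · rw [min_eq_left h, mul_one]
      have h1 := hC₀ x
      have h2 := hC₀ (x - z)
      have h3 : |Φ x - Φ (x - z)| ≤ ‖Φ x‖ + ‖Φ (x - z)‖ := by
        rw [← Real.norm_eq_abs]; exact norm_sub_le _ _
      linarith [show (0:ℝ) ≤ K from K.2]
    · rw [min_eq_right h]
      have h1 := hK.dist_le_mul x (x - z)
      rw [Real.dist_eq, dist_eq_norm, sub_sub_cancel] at h1
      nlinarith [norm_nonneg z]
  have hm : 0 ≤ (2 * C₀ + K) * min 1 ‖z‖ := (abs_nonneg _).trans hb
  by_cases h1 : x ∈ closedBall (0 : E n) R <;> by_cases h2 : x - z ∈ closedBall (0 : E n) R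
  · simp only [h1, h2, indicator_of_mem, Pi.one_apply]; linarith
  · simp only [h1, h2, indicator_of_mem, indicator_of_notMem, not_false_eq_true, Pi.one_apply]
    linarith
  · simp only [h1, h2, indicator_of_mem, indicator_of_notMem, not_false_eq_true, Pi.one_apply]
    linarith
  · simp [h1, h2, hz _ h1, hz _ h2]

/-- The (unnormalized) fractional Laplacian of order `α`. -/
noncomputable def fracLap (α : ℝ) (Φ : E n → ℝ) (x : E n) : ℝ :=
  ∫ z, (Φ x - Φ (x - z)) * stableKernel α z

section

variable {Φ : E n → ℝ} (hΦ : ContDiff ℝ 1 Φ) (hc : HasCompactSupport Φ) (hn : 1 ≤ n) (h0 : 0 < α)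
  (h1 : α < 1)
include hΦ hc hn h0 h1

theorem integrable_prod_difference_mul_stableKernel :
    Integrable (fun p : E n × E n => (Φ p.1 - Φ (p.1 - p.2)) * stableKernel α p.2) := by
  obtain ⟨C, R, hC, hb⟩ := exists_difference_bound hΦ hc
  have hm := integrable_min_one_norm_mul_stableKernel hn h0 h1
  have hχ : Integrable ((closedBall (0 : E n) R).indicator (1 : E n → ℝ)) :=
    (integrable_indicator_iff measurableSet_closedBall).2
      (integrableOn_const (measure_closedBall_lt_top).ne)
  have e1 := hχ.mul_prod hm
  have e2 := hm.convolution_integrand (ContinuousLinearMap.mul ℝ ℝ) hχ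
  refine ((e1.add e2).const_mul C).mono' ?_ (Eventually.of_forall fun p => ?_)
  · refine (Measurable.mul ?_ (measurable_stableKernel.comp measurable_snd)).aestronglyMeasurable
    exact Continuous.measurable (by have := hΦ.continuous; fun_prop)
  · rw [norm_mul, Real.norm_of_nonneg (stableKernel_nonneg _)]
    refine (mul_le_mul_of_nonneg_right (hb p.1 p.2) (stableKernel_nonneg _)).trans_eq ?_
    simp only [Pi.add_apply, ContinuousLinearMap.mul_apply']
    ring

theorem integrable_fracLap : Integrable (fracLap α Φ) :=
  (integrable_prod_difference_mul_stableKernel hΦ hc hn h0 h1).integral_prod_left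

omit hn in
theorem exists_difference_mul_stableKernel_bound : ∃ C, ∀ x z,
    ‖(Φ x - Φ (x - z)) * stableKernel α z‖ ≤ C * (min 1 ‖z‖ * stableKernel α z) := by
  obtain ⟨C, R, hC, hb⟩ := exists_difference_bound hΦ hc
  refine ⟨C * 2, fun x z => ?_⟩
  rw [norm_mul, Real.norm_of_nonneg (stableKernel_nonneg _), ← mul_assoc]
  refine mul_le_mul_of_nonneg_right ((hb x z).trans ?_) (stableKernel_nonneg _)
  have : ∀ y, (closedBall (0 : E n) R).indicator (1 : E n → ℝ) y ≤ 1 :=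
    fun y => indicator_le_self' (fun _ _ => zero_le_one) y
  have h2 : 0 ≤ C * min 1 ‖z‖ := by positivity
  nlinarith [this x, this (x - z)]

theorem continuous_fracLap : Continuous (fracLap α Φ) := by
  obtain ⟨C, hb⟩ := exists_difference_mul_stableKernel_bound hΦ hc h0 h1
  refine continuous_of_dominated (bound := fun z => C * (min 1 ‖z‖ * stableKernel α z))
    (fun x => ?_) (fun x => Eventually.of_forall fun z => hb x z)
    ((integrable_min_one_norm_mul_stableKernel hn h0 h1).const_mul _)
    (Eventually.of_forall fun z => by have := hΦ.continuous; fun_prop)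
  refine (Measurable.mul ?_ measurable_stableKernel).aestronglyMeasurable
  exact Continuous.measurable (by have := hΦ.continuous; fun_prop)

theorem exists_fracLap_bound : ∃ C, ∀ x, |fracLap α Φ x| ≤ C := by
  obtain ⟨C, hb⟩ := exists_difference_mul_stableKernel_bound hΦ hc h0 h1
  exact ⟨∫ z, C * (min 1 ‖z‖ * stableKernel α z), fun x => norm_integral_le_of_norm_le
    ((integrable_min_one_norm_mul_stableKernel hn h0 h1).const_mul _)
    (Eventually.of_forall fun z => hb x z)⟩

omit hΦ hc in
theorem integrable_stableKernel_mul_one_sub_exp (ξ : E n) :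
    Integrable (fun z : E n => (stableKernel α z : ℂ) *
      (1 - Complex.exp (↑(-2 * Real.pi * inner ℝ z ξ) * Complex.I))) := by
  refine ((integrable_min_one_norm_mul_stableKernel hn h0 h1).const_mul
    (2 + 2 * Real.pi * ‖ξ‖)).mono' ?_ (Eventually.of_forall fun z => ?_)
  · refine (Measurable.mul (Complex.measurable_ofReal.comp measurable_stableKernel) ?_).aestronglyMeasurable
    exact Continuous.measurable (by fun_prop)
  · rw [norm_mul, Complex.norm_real, Real.norm_of_nonneg (stableKernel_nonneg z), mul_comm, ← mul_assoc]
    refine mul_le_mul_of_nonneg_right ?_ (stableKernel_nonneg z)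
    rcases le_total 1 ‖z‖ with h | h
    · rw [min_eq_left h, mul_one]
      refine (norm_sub_le _ _).trans ?_
      rw [Complex.norm_exp_ofReal_mul_I, norm_one]
      have : 0 ≤ 2 * Real.pi * ‖ξ‖ := by positivity
      linarith
    · rw [min_eq_right h, norm_sub_rev, mul_comm _ Complex.I]
      refine (Real.norm_exp_I_mul_ofReal_sub_one_le).trans ?_
      rw [norm_mul, Real.norm_eq_abs, Real.norm_eq_abs, abs_mul, abs_neg, abs_two, abs_of_pos Real.pi_pos]
      calc 2 * Real.pi * |inner ℝ z ξ| ≤ 2 * Real.pi * (‖z‖ * ‖ξ‖) := by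
            gcongr; exact abs_real_inner_le_norm z ξ
        _ = 2 * Real.pi * ‖ξ‖ * ‖z‖ := by ring
        _ ≤ _ := by gcongr; linarith

omit hΦ hc in
-- The kernel is even, so averaging the integrand over `z` and `-z` leaves only the cosine.
theorem integral_stableKernel_mul_one_sub_exp (ξ : E n) :
    ∫ z : E n, (stableKernel α z : ℂ) *
      (1 - Complex.exp (↑(-2 * Real.pi * inner ℝ z ξ) * Complex.I)) =
      (levyExponent (stableKernel α) ξ : ℂ) := by
  have hi := integrable_stableKernel_mul_one_sub_exp hn h0 h1 ξ
  have h2 : (∫ z : E n, (stableKernel α z : ℂ) *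
      (1 - Complex.exp (↑(-2 * Real.pi * inner ℝ z ξ) * Complex.I))) +
      (∫ z : E n, (stableKernel α z : ℂ) *
      (1 - Complex.exp (↑(-2 * Real.pi * inner ℝ z ξ) * Complex.I))) =
      2 * (levyExponent (stableKernel α) ξ : ℂ) := by
    nth_rewrite 2 [← integral_neg_eq_self]
    rw [← integral_add hi hi.comp_neg, levyExponent, ← integral_complex_ofReal, ← integral_const_mul]
    refine integral_congr_ae (Eventually.of_forall fun z => ?_)
    simp only [stableKernel, norm_neg, inner_neg_left, mul_neg]
    push_cast
    rw [Complex.cos, real_inner_comm]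
    ring_nf
  linear_combination h2 / 2

/-- By Fubini the transform is taken in `x` for fixed `z`, where the difference `Φ(x) - Φ(x - z)`
contributes the factor `1 - exp(-2πi z · ξ)`. -/
theorem fourier_fracLap (ξ : E n) : 𝓕 (fun x => (fracLap α Φ x : ℂ)) ξ =
    (levyExponent (stableKernel α) ξ : ℂ) * 𝓕 (fun x => (Φ x : ℂ)) ξ := by
  have hH := (integrable_prod_difference_mul_stableKernel hΦ hc hn h0 h1).ofReal (𝕜 := ℂ)
  have hΦi : Integrable (fun x => (Φ x : ℂ)) := (hΦ.continuous.integrable_of_hasCompactSupport hc).ofReal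
  let e : E n → ℂ := fun x => Complex.exp (↑(-2 * Real.pi * inner ℝ x ξ) * Complex.I)
  have hen : ∀ x, ‖e x‖ ≤ 1 := fun x => by simp only [e]; rw [Complex.norm_exp_ofReal_mul_I]
  have hec : Continuous e := by fun_prop
  have hadd : ∀ x z, e (x + z) = e x * e z := fun x z => by
    simp only [e]; rw [← Complex.exp_add, inner_add_left]; push_cast; ring_nf
  have hHe : Integrable (fun p : E n × E n =>
      e p.1 * (((Φ p.1 - Φ (p.1 - p.2)) * stableKernel α p.2 : ℝ) : ℂ)) :=
    hH.bdd_mul (c := 1) (hec.comp continuous_fst).aestronglyMeasurable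
      (Eventually.of_forall fun p => hen _)
  rw [Real.fourier_eq', Real.fourier_eq']
  have hL : ∀ x, Complex.exp (↑(-2 * Real.pi * inner ℝ x ξ) * Complex.I) • (fracLap α Φ x : ℂ) =
      ∫ z, e x * (((Φ x - Φ (x - z)) * stableKernel α z : ℝ) : ℂ) := by
    intro x
    rw [integral_const_mul, integral_complex_ofReal]
    rfl
  simp_rw [hL]
  rw [integral_integral_swap hHe, ← integral_stableKernel_mul_one_sub_exp hn h0 h1,
    ← integral_mul_const]
  refine integral_congr_ae (Eventually.of_forall fun z => ?_)
  simp only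
  have hi1 : Integrable (fun x => e x * (Φ x : ℂ)) :=
    hΦi.bdd_mul (c := 1) hec.aestronglyMeasurable (Eventually.of_forall hen)
  have hi2 : Integrable (fun x => e x * (Φ (x - z) : ℂ)) :=
    (hΦi.comp_sub_right z).bdd_mul (c := 1) hec.aestronglyMeasurable (Eventually.of_forall hen)
  have h3 : ∫ x, e x * (Φ (x - z) : ℂ) = e z * ∫ x, e x * (Φ x : ℂ) := by
    rw [← integral_add_right_eq_self _ z, ← integral_const_mul]
    refine integral_congr_ae (Eventually.of_forall fun x => ?_)
    simp only [add_sub_cancel_right, hadd]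
    ring
  calc ∫ x, e x * (((Φ x - Φ (x - z)) * stableKernel α z : ℝ) : ℂ)
      = ∫ x, (stableKernel α z : ℂ) * (e x * (Φ x : ℂ) - e x * (Φ (x - z) : ℂ)) := by
        refine integral_congr_ae (Eventually.of_forall fun x => ?_)
        simp only
        push_cast
        ring
    _ = (stableKernel α z : ℂ) * ((∫ x, e x * (Φ x : ℂ)) - ∫ x, e x * (Φ (x - z) : ℂ)) := by
        rw [integral_const_mul, integral_sub hi1 hi2]
    _ = _ := by
        rw [h3]
        simp only [e, smul_eq_mul]
        ring

end

theorem levyExponent_stableKernel_smul {l : ℝ} (hl : 0 < l) (ξ : E n) :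
    levyExponent (stableKernel α) (l • ξ) = l ^ α * levyExponent (stableKernel α) ξ := by
  have h1 := Measure.integral_comp_smul_of_nonneg (μ := volume) (hR := hl.le)
    (fun z : E n => (1 - Real.cos (2 * Real.pi * inner ℝ ξ z)) * stableKernel α z) l
  rw [finrank_euclideanSpace_fin, smul_eq_mul] at h1
  have h2 : ∀ z : E n, stableKernel α z = l ^ ((n : ℝ) + α) * stableKernel α (l • z) := by
    intro z
    rw [stableKernel, stableKernel, norm_smul, Real.norm_of_nonneg hl.le,
      Real.mul_rpow hl.le (norm_nonneg _), ← mul_assoc, ← Real.rpow_add hl]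
    simp
  calc levyExponent (stableKernel α) (l • ξ)
      = ∫ z, l ^ ((n : ℝ) + α) *
        ((1 - Real.cos (2 * Real.pi * inner ℝ ξ (l • z))) * stableKernel α (l • z)) := by
        refine integral_congr_ae (Eventually.of_forall fun z => ?_)
        simp only
        rw [h2 z, inner_smul_left, inner_smul_right]
        simp
        ring
    _ = _ := by
        rw [integral_const_mul, h1, levyExponent, ← mul_assoc, Real.rpow_add hl, Real.rpow_natCast]
        field_simp

theorem levyExponent_stableKernel_eq (hα : α ≠ 0) {e : E n} (he : ‖e‖ = 1) (ξ : E n) :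
    levyExponent (stableKernel α) ξ = ‖ξ‖ ^ α * levyExponent (stableKernel α) e := by
  rcases eq_or_ne ξ 0 with rfl | hξ
  · rw [norm_zero, Real.zero_rpow hα, zero_mul]
    simp [levyExponent]
  · rw [← levyExponent_stableKernel_smul (norm_pos_iff.2 hξ)]
    exact levyExponent_congr_norm (fun z z' h => by rw [stableKernel, stableKernel, h])
      (by rw [norm_smul, he, norm_norm, mul_one])

theorem levyExponent_stableKernel_pos (hn : 1 ≤ n) (h0 : 0 < α) (h1 : α < 1) {e : E n} (he : e ≠ 0) :
    0 < levyExponent (stableKernel α) e := by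
  refine levyExponent_pos he stableKernel_nonneg one_pos (fun z hz _ => ?_) ?_
  · have := norm_pos_iff.2 hz
    unfold stableKernel; positivity
  · refine (integrable_stableKernel_mul_one_sub_exp hn h0 h1 e).re.congr
      (Eventually.of_forall fun z => ?_)
    simp only [RCLike.re_eq_complex_re, Complex.re_ofReal_mul, Complex.sub_re, Complex.one_re,
      Complex.exp_ofReal_mul_I_re]
    rw [real_inner_comm, show -2 * Real.pi * inner ℝ e z = -(2 * Real.pi * inner ℝ e z) by ring,
      Real.cos_neg, mul_comm]

end hypersingular

end NonlocalGradient

/-! ### The Riesz potential inverts the fractional Laplacian on test functions. -/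

namespace NonlocalGradient

open Set Filter Topology Metric
open scoped FourierTransform

variable {n : ℕ}

section riesz

variable {α : ℝ}

/-- The (unnormalized) Riesz kernel `|x|^{-(n-α)}`. -/
noncomputable def rieszKernel (α : ℝ) (x : E n) : ℝ := ‖x‖ ^ (-((n : ℝ) - α))

theorem rieszKernel_nonneg (z : E n) : 0 ≤ rieszKernel α z := by unfold rieszKernel; positivity

theorem measurable_rieszKernel : Measurable (rieszKernel α : E n → ℝ) := by
  unfold rieszKernel; fun_prop

theorem rieszKernel_le_one (hn : 1 ≤ n) (h1 : α < 1) {z : E n} (hz : 1 ≤ ‖z‖) :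
    rieszKernel α z ≤ 1 := by
  have : (1 : ℝ) ≤ n := by exact_mod_cast hn
  exact Real.rpow_le_one_of_one_le_of_nonpos hz (by linarith)

theorem integrableOn_rieszKernel_ball (hn : 1 ≤ n) (h0 : 0 < α) (R : ℝ) :
    IntegrableOn (rieszKernel α : E n → ℝ) (ball 0 R) :=
  integrableOn_ball_norm_rpow hn (by linarith) R

/-- The Riesz potential of a bounded integrable function converges absolutely. -/
theorem integrable_rieszKernel_mul (hn : 1 ≤ n) (h0 : 0 < α) (h1 : α < 1) {γ : E n → ℝ}
    (hγ : Integrable γ) {C : ℝ} (hC : ∀ x, |γ x| ≤ C) (x : E n) :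
    Integrable (fun y => rieszKernel α (x - y) * γ y) := by
  have hb : Integrable ((ball (0 : E n) 1).indicator (rieszKernel α : E n → ℝ)) :=
    (integrable_indicator_iff measurableSet_ball).2 (integrableOn_rieszKernel_ball hn h0 1)
  refine (((hb.comp_sub_left x).mul_const C).add hγ.norm).mono'
    ((measurable_rieszKernel.comp (by fun_prop)).aestronglyMeasurable.mul hγ.aestronglyMeasurable)
    (Eventually.of_forall fun y => ?_)
  rw [norm_mul, Real.norm_of_nonneg (rieszKernel_nonneg _), Pi.add_apply]
  by_cases h : x - y ∈ ball (0 : E n) 1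
  · rw [indicator_of_mem h]
    have := mul_le_mul_of_nonneg_left (hC y) (rieszKernel_nonneg (α := α) (x - y))
    rw [Real.norm_eq_abs]
    linarith [abs_nonneg (γ y)]
  · rw [indicator_of_notMem h, zero_mul, zero_add]
    exact mul_le_of_le_one_left (norm_nonneg _) (rieszKernel_le_one hn h1 (by simpa using h))

/-- If this failed, the integral would be `0` by convention, against its known positive value in
terms of the Gamma function. -/
theorem integrableOn_rpow_mul_exp {b r : ℝ} (hb : 0 < b) (hr : 0 < r) :
    IntegrableOn (fun t : ℝ => t ^ (b - 1) * Real.exp (-(r * t))) (Ioi 0) := by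
  by_contra h
  have h1 := Real.integral_rpow_mul_exp_neg_mul_Ioi hb hr
  rw [integral_undef h] at h1
  have := Real.Gamma_pos_of_pos hb
  have : 0 < (1 / r) ^ b * Real.Gamma b := by positivity
  linarith

theorem rpow_inv_exp_eq {b r t : ℝ} (ht : 0 < t) :
    (|(-1 : ℝ)| * t ^ ((-1 : ℝ) - 1)) • ((t ^ (-1 : ℝ)) ^ (b - 1) * Real.exp (-(r * t ^ (-1 : ℝ)))) =
      t ^ (-b - 1) * Real.exp (-(r / t)) := by
  rw [abs_neg, abs_one, one_mul, smul_eq_mul, ← mul_assoc, ← Real.rpow_mul ht.le, ← Real.rpow_add ht,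
    Real.rpow_neg_one, div_eq_mul_inv]
  congr 2
  ring

theorem integrableOn_rpow_mul_exp_inv {b r : ℝ} (hb : 0 < b) (hr : 0 < r) :
    IntegrableOn (fun t : ℝ => t ^ (-b - 1) * Real.exp (-(r / t))) (Ioi 0) := by
  have h := (integrableOn_Ioi_comp_rpow_iff _ (by norm_num : (-1 : ℝ) ≠ 0)).2
    (integrableOn_rpow_mul_exp hb hr)
  exact h.congr_fun (fun t ht => rpow_inv_exp_eq ht) measurableSet_Ioi

theorem integral_rpow_mul_exp_inv {b r : ℝ} (hb : 0 < b) (hr : 0 < r) :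
    ∫ t in Ioi (0 : ℝ), t ^ (-b - 1) * Real.exp (-(r / t)) = (1 / r) ^ b * Real.Gamma b := by
  have h := integral_comp_rpow_Ioi (fun t : ℝ => t ^ (b - 1) * Real.exp (-(r * t)))
    (by norm_num : (-1 : ℝ) ≠ 0)
  rw [Real.integral_rpow_mul_exp_neg_mul_Ioi hb hr] at h
  rw [← h]
  exact setIntegral_congr_fun measurableSet_Ioi fun t ht => (rpow_inv_exp_eq ht).symm

theorem integral_gaussian_mul_eq {γ : E n → ℝ} (hγ : Integrable γ) (hγc : Continuous γ)
    (hγf : Integrable (𝓕 (fun x => (γ x : ℂ)))) {l : ℝ} (hl : 0 < l) (x : E n) :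
    ∫ y, ((Real.exp (-(‖x - y‖ ^ 2 * l)) * γ y : ℝ) : ℂ) =
      ∫ ξ, (((Real.pi / l) ^ ((n : ℝ) / 2) * Real.exp (-(Real.pi ^ 2 * ‖ξ‖ ^ 2 / l)) : ℝ) : ℂ) *
        (Complex.exp (↑(2 * Real.pi * inner ℝ ξ x) * Complex.I) * 𝓕 (fun x => (γ x : ℂ)) ξ) := by
  have hK : ∀ z : E n, ((Real.exp (-(‖z‖ ^ 2 * l)) : ℝ) : ℂ) = Complex.exp (-(l : ℂ) * ‖z‖ ^ 2) := by
    intro z; push_cast; ring_nf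
  have hKi : Integrable (fun z : E n => ((Real.exp (-(‖z‖ ^ 2 * l)) : ℝ) : ℂ)) := by
    simp_rw [hK]
    simpa using GaussianFourier.integrable_cexp_neg_mul_sq_norm_add (V := E n) (b := l)
      (by simpa using hl) 0 0
  have h1 := integral_mul_fourierInv_sub hKi hγf x
  have h2 : 𝓕⁻ (𝓕 (fun x => (γ x : ℂ))) = fun x => (γ x : ℂ) :=
    (Complex.continuous_ofReal.comp hγc).fourierInv_fourier_eq hγ.ofReal hγf
  rw [h2] at h1
  simp_rw [Complex.ofReal_mul (Real.exp _)]
  rw [h1, Real.fourierInv_eq']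
  refine integral_congr_ae (Eventually.of_forall fun ξ => ?_)
  simp only [smul_eq_mul]
  have h3 : 𝓕 (fun z : E n => ((Real.exp (-(‖z‖ ^ 2 * l)) : ℝ) : ℂ)) ξ =
      (((Real.pi / l) ^ ((n : ℝ) / 2) * Real.exp (-(Real.pi ^ 2 * ‖ξ‖ ^ 2 / l)) : ℝ) : ℂ) := by
    simp_rw [hK]
    rw [fourier_gaussian_innerProductSpace (by simpa using hl), finrank_euclideanSpace_fin]
    push_cast
    rw [Complex.ofReal_cpow (by positivity)]
    push_cast
    congr 2
    ring
  rw [h3]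
  ring

/-- The Riesz kernel is not integrable, so the convolution theorem does not apply to it directly. It
is a superposition of Gaussians `exp(-l |x|²)`, for which `integral_gaussian_mul_eq` does apply.
Integrating their transforms over `l` gives a multiple of `|ξ|^{-α}`, which cancels the symbol `k
|ξ|^α` of the fractional Laplacian, and Fourier inversion returns `Φ`. -/
theorem integral_rieszKernel_mul_fracLap {Φ : E n → ℝ} (hΦ : ContDiff ℝ (⊤ : ℕ∞) Φ)
    (hc : HasCompactSupport Φ) (hn : 1 ≤ n) (h0 : 0 < α) (h1 : α < 1) :
    ∃ κ : ℝ, 0 < κ ∧ ∀ x, ∫ y, rieszKernel α (x - y) * fracLap α Φ y = κ * Φ x := by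
  have : Nonempty (Fin n) := ⟨⟨0, hn⟩⟩
  have hn' : (1 : ℝ) ≤ n := by exact_mod_cast hn
  obtain ⟨e, he⟩ := exists_norm_eq (E n) zero_le_one
  have he0 : e ≠ 0 := by rw [← norm_ne_zero_iff, he]; exact one_ne_zero
  have hΦ1 : ContDiff ℝ 1 Φ := hΦ.of_le (by exact_mod_cast le_top)
  set γ := fracLap α Φ with hγdef
  have hγ : Integrable γ := integrable_fracLap hΦ1 hc hn h0 h1
  have hγc : Continuous γ := continuous_fracLap hΦ1 hc hn h0 h1
  obtain ⟨C, hC⟩ := exists_fracLap_bound hΦ1 hc hn h0 h1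
  set k := levyExponent (stableKernel α) e with hk
  have hk0 : 0 < k := levyExponent_stableKernel_pos hn h0 h1 he0
  have hc' : HasCompactSupport (fun x => (Φ x : ℂ)) := hc.comp_left (g := Complex.ofReal) (by simp)
  let F : SchwartzMap (E n) ℂ := hc'.toSchwartzMap (Complex.ofRealCLM.contDiff.comp hΦ)
  have hFf : ∀ ξ, 𝓕 (fun x => (Φ x : ℂ)) ξ = (𝓕 F : SchwartzMap (E n) ℂ) ξ := fun ξ => rfl
  have hγf : ∀ ξ, 𝓕 (fun x => (γ x : ℂ)) ξ =
      ((‖ξ‖ ^ α * k : ℝ) : ℂ) * (𝓕 F : SchwartzMap (E n) ℂ) ξ := fun ξ => by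
    rw [fourier_fracLap hΦ1 hc hn h0 h1, levyExponent_stableKernel_eq h0.ne' he, hFf]
  have hγfi : Integrable (𝓕 (fun x => (γ x : ℂ))) := by
    have h2 := ((𝓕 F).integrable_pow_mul volume 0).add ((𝓕 F).integrable_pow_mul volume 1)
    rw [show 𝓕 (fun x => (γ x : ℂ)) = _ from funext hγf]
    refine (h2.const_mul k).mono' ?_ (Eventually.of_forall fun ξ => ?_)
    · refine ((Complex.measurable_ofReal.comp (by fun_prop)).aestronglyMeasurable).mul
        (𝓕 F).continuous.aestronglyMeasurable
    · rw [norm_mul, Complex.norm_real, Real.norm_of_nonneg (by positivity)]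
      simp only [Pi.add_apply, pow_zero, pow_one]
      rw [← add_mul, ← mul_assoc, mul_comm k]
      refine mul_le_mul_of_nonneg_right (mul_le_mul_of_nonneg_right ?_ hk0.le) (norm_nonneg _)
      rcases le_total ‖ξ‖ 1 with h | h
      · exact (Real.rpow_le_one (norm_nonneg _) h h0.le).trans (by linarith [norm_nonneg ξ])
      · refine (Real.rpow_le_rpow_of_exponent_le h h1.le).trans ?_
        rw [Real.rpow_one]; linarith
  -- Chosen so that `Γ(b) |x|^{-(n-α)} = ∫ l^{b-1} exp(-l |x|²) dl` over the positive half-line.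
  set b := ((n : ℝ) - α) / 2 with hb
  have hb0 : 0 < b := by rw [hb]; linarith
  have hΓb := Real.Gamma_pos_of_pos hb0
  have hα2 : 0 < α / 2 := by linarith
  have hΓα := Real.Gamma_pos_of_pos hα2
  set M := Real.pi ^ ((n : ℝ) / 2) * ((1 / Real.pi ^ 2) ^ (α / 2) * Real.Gamma (α / 2)) with hM
  have hpi := Real.pi_pos
  have hM0 : 0 < M := by positivity
  refine ⟨M * k / Real.Gamma b, by positivity, fun x => ?_⟩
  have hnex : ∀ᵐ y : E n, y ≠ x := Measure.ae_ne volume x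
  have hne0 : ∀ᵐ y : E n, y ≠ 0 := Measure.ae_ne volume 0
  have hpow : ∀ {r β : ℝ}, 0 < r → (1 / r ^ 2) ^ (β / 2) = r ^ (-β) := fun {r β} hr => by
    rw [one_div, ← Real.rpow_natCast, ← Real.rpow_neg hr.le, ← Real.rpow_mul hr.le]
    congr 1; push_cast; ring
  have hIG : ∀ y, y ≠ x → ∫ l in Ioi (0 : ℝ), l ^ (b - 1) * Real.exp (-(‖x - y‖ ^ 2 * l)) =
      Real.Gamma b * rieszKernel α (x - y) := by
    intro y hy
    have hr : 0 < ‖x - y‖ := norm_pos_iff.2 (sub_ne_zero.2 hy.symm)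
    rw [Real.integral_rpow_mul_exp_neg_mul_Ioi hb0 (by positivity), hb, hpow hr, rieszKernel, mul_comm]
  -- first application of Fubini's theorem
  have hF1 : Integrable (fun p : E n × ℝ => p.2 ^ (b - 1) * Real.exp (-(‖x - p.1‖ ^ 2 * p.2)) * γ p.1)
      (volume.prod (volume.restrict (Ioi 0))) := by
    have hmeas : Measurable (fun p : E n × ℝ => p.2 ^ (b - 1) * Real.exp (-(‖x - p.1‖ ^ 2 * p.2)) * γ p.1) := by
      have := hγc.measurable
      fun_prop
    rw [integrable_prod_iff hmeas.aestronglyMeasurable]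
    constructor
    · filter_upwards [hnex] with y hy
      have hr : 0 < ‖x - y‖ := norm_pos_iff.2 (sub_ne_zero.2 hy.symm)
      exact (integrableOn_rpow_mul_exp hb0 (by positivity)).mul_const _
    · refine ((integrable_rieszKernel_mul hn h0 h1 hγ hC x).norm.const_mul (Real.Gamma b)).congr ?_
      filter_upwards [hnex] with y hy
      have : ∀ l ∈ Ioi (0 : ℝ), ‖l ^ (b - 1) * Real.exp (-(‖x - y‖ ^ 2 * l)) * γ y‖ =
          l ^ (b - 1) * Real.exp (-(‖x - y‖ ^ 2 * l)) * ‖γ y‖ := fun l hl => by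
        have hl' : (0 : ℝ) < l := hl
        rw [norm_mul, Real.norm_of_nonneg (by positivity)]
      rw [setIntegral_congr_fun measurableSet_Ioi this, integral_mul_const, hIG y hy, norm_mul,
        Real.norm_of_nonneg (rieszKernel_nonneg _)]
      ring
  have hS1 : Real.Gamma b * ∫ y, rieszKernel α (x - y) * γ y =
      ∫ l in Ioi (0 : ℝ), ∫ y, l ^ (b - 1) * Real.exp (-(‖x - y‖ ^ 2 * l)) * γ y := by
    rw [← integral_integral_swap hF1, ← integral_const_mul]
    refine integral_congr_ae ?_
    filter_upwards [hnex] with y hy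
    rw [integral_mul_const, hIG y hy]
    ring
  -- second application of Fubini's theorem
  let g : E n → ℂ := fun ξ => Complex.exp (↑(2 * Real.pi * inner ℝ ξ x) * Complex.I) *
    𝓕 (fun x => (γ x : ℂ)) ξ
  have hec : Continuous fun ξ : E n => Complex.exp (↑(2 * Real.pi * inner ℝ ξ x) * Complex.I) := by
    fun_prop
  have hgi : Integrable g := hγfi.bdd_mul (c := 1) hec.aestronglyMeasurable
    (Eventually.of_forall fun ξ => by rw [Complex.norm_exp_ofReal_mul_I])
  -- The transform of the Gaussian multiplied by its weight `l^{b-1}`; the powers of `l` combine as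
  -- `(b - 1) - n/2 = -α/2 - 1`.
  let m : ℝ → E n → ℝ := fun l ξ => Real.pi ^ ((n : ℝ) / 2) *
    (l ^ (-(α / 2) - 1) * Real.exp (-((Real.pi ^ 2 * ‖ξ‖ ^ 2) / l)))
  have hmi : ∀ ξ, ξ ≠ 0 → ∫ l in Ioi (0 : ℝ), m l ξ = M * ‖ξ‖ ^ (-α) := by
    intro ξ hξ
    have hr := norm_pos_iff.2 hξ
    simp only [m]
    rw [integral_const_mul, integral_rpow_mul_exp_inv hα2 (by positivity), ← one_div_mul_one_div,
      Real.mul_rpow (by positivity) (by positivity), hpow hr, hM]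
    ring
  have hm0 : ∀ l ∈ Ioi (0 : ℝ), ∀ ξ, 0 ≤ m l ξ := fun l hl ξ => by
    have hl' : (0 : ℝ) < l := hl
    simp only [m]; positivity
  have hnorm : ∀ ξ : E n, ξ ≠ 0 → ‖ξ‖ ^ (-α) * ‖ξ‖ ^ α = 1 := fun ξ hξ => by
    rw [← Real.rpow_add (norm_pos_iff.2 hξ)]; simp
  have hF2 : Integrable (fun p : E n × ℝ => (m p.2 p.1 : ℂ) * g p.1)
      (volume.prod (volume.restrict (Ioi 0))) := by
    have hmeas : AEStronglyMeasurable (fun p : E n × ℝ => (m p.2 p.1 : ℂ) * g p.1)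
        (volume.prod (volume.restrict (Ioi 0))) := by
      refine AEStronglyMeasurable.mul ?_ hgi.aestronglyMeasurable.comp_fst
      exact (Complex.measurable_ofReal.comp (by fun_prop)).aestronglyMeasurable
    rw [integrable_prod_iff hmeas]
    constructor
    · filter_upwards [hne0] with ξ hξ
      have hr := norm_pos_iff.2 hξ
      exact (((integrableOn_rpow_mul_exp_inv hα2 (by positivity)).const_mul _).ofReal).mul_const _
    · refine (((𝓕 F).integrable (μ := volume)).norm.const_mul (M * k)).congr ?_
      filter_upwards [hne0] with ξ hξ
      have : ∀ l ∈ Ioi (0 : ℝ), ‖(m l ξ : ℂ) * g ξ‖ = m l ξ * ‖g ξ‖ := fun l hl => by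
        rw [norm_mul, Complex.norm_real, Real.norm_of_nonneg (hm0 l hl ξ)]
      rw [setIntegral_congr_fun measurableSet_Ioi this, integral_mul_const, hmi ξ hξ]
      simp only [g]
      rw [norm_mul, Complex.norm_exp_ofReal_mul_I, hγf, norm_mul, Complex.norm_real,
        Real.norm_of_nonneg (by positivity)]
      linear_combination -M * k * ‖(𝓕 F : SchwartzMap (E n) ℂ) ξ‖ * hnorm ξ hξ
  have hS2 : ∀ l ∈ Ioi (0 : ℝ),
      ((∫ y, l ^ (b - 1) * Real.exp (-(‖x - y‖ ^ 2 * l)) * γ y : ℝ) : ℂ) = ∫ ξ, (m l ξ : ℂ) * g ξ := by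
    intro l hl
    have hl' : (0 : ℝ) < l := hl
    simp_rw [mul_assoc]
    rw [integral_const_mul, Complex.ofReal_mul, ← integral_complex_ofReal,
      integral_gaussian_mul_eq hγ hγc hγfi hl', ← integral_const_mul]
    refine integral_congr_ae (Eventually.of_forall fun ξ => ?_)
    simp only [m, g]
    rw [← mul_assoc, ← Complex.ofReal_mul]
    congr 2
    rw [Real.div_rpow hpi.le hl'.le, show -(α / 2) - 1 = (b - 1) + -((n : ℝ) / 2) by rw [hb]; ring,
      Real.rpow_add hl', Real.rpow_neg hl'.le]
    ring
  have hS3 : ((Real.Gamma b * ∫ y, rieszKernel α (x - y) * γ y : ℝ) : ℂ) =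
      ((M * k * Φ x : ℝ) : ℂ) := by
    rw [hS1, ← integral_complex_ofReal, setIntegral_congr_fun measurableSet_Ioi hS2,
      ← integral_integral_swap hF2]
    have h5 : ∀ᵐ ξ : E n, ∫ l in Ioi (0 : ℝ), (m l ξ : ℂ) * g ξ = ((M * k : ℝ) : ℂ) *
        (Complex.exp (↑(2 * Real.pi * inner ℝ ξ x) * Complex.I) • (𝓕 F : SchwartzMap (E n) ℂ) ξ) := by
      filter_upwards [hne0] with ξ hξ
      rw [integral_mul_const, integral_complex_ofReal, hmi ξ hξ]
      simp only [g]
      rw [hγf, smul_eq_mul]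
      have := congrArg Complex.ofReal (hnorm ξ hξ)
      push_cast at this ⊢
      linear_combination M * k * (Complex.exp (2 * Real.pi * (inner ℝ ξ x : ℝ) * Complex.I) *
        (𝓕 F : SchwartzMap (E n) ℂ) ξ) * this
    rw [integral_congr_ae h5, integral_const_mul, ← Real.fourierInv_eq']
    have h6 : 𝓕⁻ (𝓕 F) = F := FourierTransform.fourierInv_fourier_eq F
    have h7 := congrArg (fun G : SchwartzMap (E n) ℂ => G x) h6
    simp only [SchwartzMap.fourierInv_coe] at h7
    have h8 : F x = (Φ x : ℂ) := rfl
    rw [h8] at h7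
    rw [h7, ← Complex.ofReal_mul]
  have hS4 := Complex.ofReal_injective hS3
  field_simp
  linear_combination hS4

end riesz

end NonlocalGradient

/-! ### Tame kernels, and the decomposition of `Q` into a Riesz kernel and a tame one. -/

namespace NonlocalGradient

open Set Filter Topology Metric

variable {n : ℕ} {s δ : ℝ} {w : E n → ℝ} {wbar : ℝ → ℝ}

section tame

variable {F : Type} [NormedAddCommGroup F] [NormedSpace ℝ F]

/-- Smooth functions which, outside of a ball, are positively homogeneous of degree `≤ 0`. -/
structure IsTame (f : E n → F) : Prop where
  contDiff : ContDiff ℝ (⊤ : ℕ∞) f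
  homogeneous : ∃ R > 0, ∃ d ≤ (0 : ℝ), ∀ t : ℝ, 1 ≤ t → ∀ x, R ≤ ‖x‖ → f (t • x) = t ^ d • f x

theorem IsTame.exists_bound {f : E n → F} (hf : IsTame f) : ∃ C, ∀ x, ‖f x‖ ≤ C := by
  obtain ⟨R, hR, d, hd, h⟩ := hf.homogeneous
  obtain ⟨C, hC⟩ := (isCompact_closedBall (0 : E n) R).exists_bound_of_continuousOn
    hf.contDiff.continuous.continuousOn
  refine ⟨C, fun x => ?_⟩
  rcases le_total ‖x‖ R with hx | hx
  · exact hC x (by simpa using hx)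
  · have hx0 : 0 < ‖x‖ := hR.trans_le hx
    have h1 : ‖(R / ‖x‖) • x‖ = R := by
      rw [norm_smul, Real.norm_of_nonneg (by positivity)]; field_simp
    have h2 := h (‖x‖ / R) ((one_le_div hR).2 hx) ((R / ‖x‖) • x) h1.ge
    rw [smul_smul, show ‖x‖ / R * (R / ‖x‖) = 1 by field_simp, one_smul] at h2
    rw [h2, norm_smul, Real.norm_of_nonneg (by positivity)]
    refine (mul_le_of_le_one_left (norm_nonneg _) ?_).trans (hC _ (by simp [h1]))
    exact Real.rpow_le_one_of_one_le_of_nonpos ((one_le_div hR).2 hx) hd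

/-- Differentiating the homogeneity relation lowers the degree by one. The radius grows to `R + 1`
so that the relation holds in a neighbourhood of each point considered. -/
theorem IsTame.fderiv {f : E n → F} (hf : IsTame f) : IsTame (fderiv ℝ f) := by
  obtain ⟨R, hR, d, hd, h⟩ := hf.homogeneous
  refine ⟨(contDiff_infty_iff_fderiv.1 hf.contDiff).2, R + 1, by positivity, d - 1, by linarith,
    fun t ht x hx => ?_⟩
  have ht0 : 0 < t := one_pos.trans_le ht
  have hdiff := hf.contDiff.differentiable (by simp)
  have h1 : HasFDerivAt (fun y => f (t • y)) (t • _root_.fderiv ℝ f (t • x)) x := by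
    have := (hdiff (t • x)).hasFDerivAt.comp x ((hasFDerivAt_id (𝕜 := ℝ) x).const_smul t)
    refine this.congr_fderiv ?_
    ext v; simp
  have h2 : HasFDerivAt (fun y => f (t • y)) (t ^ d • _root_.fderiv ℝ f x) x := by
    refine ((hdiff x).hasFDerivAt.const_smul (t ^ d)).congr_of_eventuallyEq ?_
    have : {y : E n | R < ‖y‖} ∈ 𝓝 x := (isOpen_lt continuous_const continuous_norm).mem_nhds
      (show R < ‖x‖ by linarith)
    filter_upwards [this] with y hy using h t ht y (le_of_lt hy)
  have h3 := h1.unique h2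
  rw [Real.rpow_sub_one ht0.ne', div_eq_inv_mul, mul_smul, ← h3, inv_smul_smul₀ ht0.ne']

/-- Tame functions and their derivatives are bounded, so one may differentiate under the integral
against an integrable `U`. The target space is quantified inside the induction because the
derivative takes values in a different space. -/
theorem contDiff_nat_integral_smul_sub {U : E n → ℝ} (hU : Integrable U) (k : ℕ) :
    ∀ {F : Type} [NormedAddCommGroup F] [NormedSpace ℝ F] {f : E n → F}, IsTame f →
      ContDiff ℝ k (fun x => ∫ y, U y • f (x - y)) := by
  induction k with
  | zero =>
    intro F _ _ f hf
    obtain ⟨C, hC⟩ := hf.exists_bound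
    refine contDiff_zero.2 (continuous_of_dominated (bound := fun y => ‖U y‖ * C) (fun x => ?_)
      (fun x => Eventually.of_forall fun y => ?_) (hU.norm.mul_const C)
      (Eventually.of_forall fun y => ?_))
    · exact hU.aestronglyMeasurable.smul (hf.contDiff.continuous.comp (by fun_prop)).aestronglyMeasurable
    · rw [norm_smul]
      exact mul_le_mul_of_nonneg_left (hC _) (norm_nonneg _)
    · exact (hf.contDiff.continuous.comp (by fun_prop)).const_smul _
  | succ k ih =>
    intro F _ _ f hf
    obtain ⟨C, hC⟩ := hf.exists_bound
    obtain ⟨C', hC'⟩ := hf.fderiv.exists_bound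
    have hm : ∀ x, AEStronglyMeasurable (fun y => U y • f (x - y)) := fun x =>
      hU.aestronglyMeasurable.smul (hf.contDiff.continuous.comp (by fun_prop)).aestronglyMeasurable
    push_cast
    refine (contDiff_succ_iff_hasFDerivAt (𝕜 := ℝ)).2 ⟨fun x => ∫ y, U y • fderiv ℝ f (x - y), ih hf.fderiv,
      fun x => ?_⟩
    refine hasFDerivAt_integral_of_dominated_of_fderiv_le (𝕜 := ℝ) (s := univ)
      (F' := fun x y => U y • fderiv ℝ f (x - y)) univ_mem
      (bound := fun y => ‖U y‖ * C') (Eventually.of_forall hm) ?_ ?_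
      (Eventually.of_forall fun y x _ => ?_) (hU.norm.mul_const C')
      (Eventually.of_forall fun y x _ => ?_)
    · refine (hU.norm.mul_const C).mono' (hm x) (Eventually.of_forall fun y => ?_)
      rw [norm_smul]
      exact mul_le_mul_of_nonneg_left (hC _) (norm_nonneg _)
    · exact hU.aestronglyMeasurable.smul
        (hf.fderiv.contDiff.continuous.comp (by fun_prop)).aestronglyMeasurable
    · rw [norm_smul]
      exact mul_le_mul_of_nonneg_left (hC' _) (norm_nonneg _)
    · have h1 := (hf.contDiff.differentiable (by simp) (x - y)).hasFDerivAt.comp x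
        ((hasFDerivAt_id (𝕜 := ℝ) x).sub_const y)
      exact (h1.const_smul (U y)).congr_fderiv (by ext v; simp)

theorem contDiff_integral_smul_sub {U : E n → ℝ} (hU : Integrable U) {f : E n → F} (hf : IsTame f) :
    ContDiff ℝ (⊤ : ℕ∞) (fun x => ∫ y, U y • f (x - y)) :=
  contDiff_infty.2 fun k => contDiff_nat_integral_smul_sub hU k hf

end tame

section singularPart

theorem contDiffOn_rieszKernel (α : ℝ) : ContDiffOn ℝ (⊤ : ℕ∞) (rieszKernel α : E n → ℝ) {0}ᶜ :=
  fun _ hx => ((contDiffAt_norm ℝ hx).rpow_const_of_ne (norm_ne_zero_iff.2 hx)).contDiffWithinAt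

theorem contDiffOn_Q (hw : IsCutoff δ w wbar) (hδ : 0 < δ) (hn : 1 ≤ n) :
    ContDiffOn ℝ (⊤ : ℕ∞) (Q s δ w wbar) {0}ᶜ := by
  rw [contDiffOn_infty_iff_fderiv_of_isOpen isOpen_compl_singleton]
  refine ⟨fun x hx => (hasFDerivAt_Q hw hδ hn hx).differentiableAt.differentiableWithinAt, ?_⟩
  refine ContDiffOn.congr (f := fun x => -(kernel s δ w x / ‖x‖ ^ 2) • innerSL ℝ x) ?_
    fun x hx => (hasFDerivAt_Q hw hδ hn hx).fderiv
  refine ContDiffOn.smul (ContDiffOn.neg (ContDiffOn.div ?_ ?_ ?_)) (innerSL ℝ (E := E n)).contDiff.contDiffOn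
  · refine contDiffOn_const.mul (ContDiffOn.div hw.smooth.contDiffOn (fun x hx => ?_) fun x hx => ?_)
    · exact ((contDiffAt_norm ℝ hx).rpow_const_of_ne (norm_ne_zero_iff.2 hx)).contDiffWithinAt
    · exact (Real.rpow_pos_of_pos (norm_pos_iff.2 hx) _).ne'
  · exact (contDiff_norm_sq ℝ).contDiffOn
  · exact fun x hx => pow_ne_zero _ (norm_ne_zero_iff.2 hx)

/-- Off the origin, `Q` is a multiple of the Riesz kernel up to a smooth function. -/
theorem exists_tame_Q_sub_rieszKernel (hw : IsCutoff δ w wbar) (hδ : 0 < δ) (hn : 1 ≤ n)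
    (hs0 : 0 < s) (hs1 : s < 1) : ∃ c > 0, ∃ S : E n → ℝ, IsTame S ∧
      ∀ x, x ≠ 0 → Q s δ w wbar x = c * rieszKernel (1 - s) x + S x := by
  obtain ⟨r, hr, A, hA⟩ := Q_near_zero (s := s) hw hδ hn hs0
  have hc := hw.scaling_pos hδ hn hs1
  have hn' : (1 : ℝ) ≤ n := by exact_mod_cast hn
  have hβ : 0 < (n : ℝ) + s - 1 := by linarith
  have hexp : -((n : ℝ) - (1 - s)) = -((n : ℝ) + s - 1) := by ring
  classical
  let c := scaling s δ w / ((n : ℝ) + s - 1)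
  -- Near the origin the difference is the constant `A`, so assigning this value at `0` makes it
  -- smooth.
  let S : E n → ℝ := fun x => if x = 0 then A else Q s δ w wbar x - c * rieszKernel (1 - s) x
  have hS : ∀ x, x ≠ 0 → S x = Q s δ w wbar x - c * rieszKernel (1 - s) x := fun x hx => if_neg hx
  refine ⟨c, by positivity, S, ⟨?_, δ, hδ, -((n : ℝ) - (1 - s)), by linarith, ?_⟩, fun x hx => ?_⟩
  · refine contDiff_iff_contDiffAt.2 fun x => ?_
    by_cases hx : x = 0
    · subst hx
      refine (contDiffAt_const (c := A)).congr_of_eventuallyEq ?_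
      filter_upwards [ball_mem_nhds (0 : E n) hr] with y hy
      by_cases hy0 : y = 0
      · exact if_pos hy0
      · rw [hS y hy0, hA y hy0 (by simpa using hy), rieszKernel, hexp]
        simp only [c]; ring
    · have h1 : {y : E n | y ≠ 0} ∈ 𝓝 x := isOpen_compl_singleton.mem_nhds hx
      refine ContDiffAt.congr_of_eventuallyEq (f := fun y => Q s δ w wbar y - c * rieszKernel (1 - s) y)
        ?_ (by filter_upwards [h1] with y hy using hS y hy)
      exact ((contDiffOn_Q hw hδ hn).contDiffAt h1).sub
        (contDiffAt_const.mul ((contDiffOn_rieszKernel _).contDiffAt h1))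
  -- Beyond radius `δ` the kernel `Q` vanishes, and what remains is minus a multiple of the Riesz
  -- kernel, homogeneous of negative degree.
  · intro t ht x hx
    have ht0 : 0 < t := one_pos.trans_le ht
    have hx0 : x ≠ 0 := norm_pos_iff.1 (hδ.trans_le hx)
    have h1 : δ ≤ ‖t • x‖ := by
      rw [norm_smul, Real.norm_of_nonneg ht0.le]; nlinarith [norm_nonneg x]
    rw [hS x hx0, hS _ (smul_ne_zero ht0.ne' hx0), Q_eq_zero hw hδ hx, Q_eq_zero hw hδ h1, rieszKernel,
      rieszKernel, norm_smul, Real.norm_of_nonneg ht0.le, Real.mul_rpow ht0.le (norm_nonneg _),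
      smul_eq_mul]
    ring
  · rw [hS x hx]; ring

end singularPart

/-! ### Mixtures of dilations and their Riesz potentials. -/

section mixture

/-- The mixture `∫_0^1 t^{-β} g_t dt` of the rescaled functions `g_t = t^{-n} g(· / t)`. -/
noncomputable def dilationMix (β : ℝ) (g : E n → ℝ) (x : E n) : ℝ :=
  ∫ t in Ioo (0 : ℝ) 1, t ^ (-β) * ((t ^ n)⁻¹ * g (t⁻¹ • x))

variable {β : ℝ} {g : E n → ℝ}

/-- The dilations `t^{-n} g(· / t)` all have the same `L¹` norm, and `t^{-β}` is integrable on `(0,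
1)` because `β < 1`. -/
theorem integrable_prod_dilation (hβ : β < 1) (hg : Integrable g) (hgc : Continuous g) :
    Integrable (fun p : E n × ℝ => p.2 ^ (-β) * ((p.2 ^ n)⁻¹ * g (p.2⁻¹ • p.1)))
      (volume.prod (volume.restrict (Ioo 0 1))) := by
  have hmeas : Measurable (fun p : E n × ℝ => p.2 ^ (-β) * ((p.2 ^ n)⁻¹ * g (p.2⁻¹ • p.1))) := by
    have := hgc.measurable
    fun_prop
  rw [integrable_prod_iff' hmeas.aestronglyMeasurable]
  constructor
  · filter_upwards [ae_restrict_mem measurableSet_Ioo] with t ht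
    exact ((hg.comp_smul (inv_ne_zero ht.1.ne')).const_mul _).const_mul _
  · have h1 : IntegrableOn (fun t : ℝ => t ^ (-β) * ∫ x, ‖g x‖) (Ioo 0 1) :=
      ((intervalIntegral.integrableOn_Ioo_rpow_iff one_pos).2 (by linarith)).mul_const _
    refine h1.congr ?_
    filter_upwards [ae_restrict_mem measurableSet_Ioo] with t ht
    have ht0 := ht.1
    have h2 : ∀ x : E n, ‖t ^ (-β) * ((t ^ n)⁻¹ * g (t⁻¹ • x))‖ = t ^ (-β) * ((t ^ n)⁻¹ * ‖g (t⁻¹ • x)‖) :=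
      fun x => by
        rw [norm_mul, norm_mul, Real.norm_of_nonneg (by positivity),
          Real.norm_of_nonneg (by positivity)]
    simp_rw [h2]
    rw [integral_const_mul, integral_const_mul,
      Measure.integral_comp_inv_smul_of_nonneg volume (fun x => ‖g x‖) ht0.le,
      finrank_euclideanSpace_fin, smul_eq_mul]
    field_simp

theorem integrable_dilationMix (hβ : β < 1) (hg : Integrable g) (hgc : Continuous g) :
    Integrable (dilationMix β g) :=
  (integrable_prod_dilation hβ hg hgc).integral_prod_left

theorem integral_dilationMix_mul (hβ : β < 1) (hg : Integrable g) (hgc : Continuous g)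
    {φ : E n → ℝ} (hφ : Continuous φ) {C : ℝ} (hC : ∀ x, |φ x| ≤ C) :
    ∫ x, dilationMix β g x * φ x = ∫ t in Ioo (0 : ℝ) 1, t ^ (-β) * ∫ z, g z * φ (t • z) := by
  have h1 := (integrable_prod_dilation hβ hg hgc).mul_bdd (c := C)
    (hφ.comp continuous_fst).aestronglyMeasurable (Eventually.of_forall fun p => hC p.1)
  simp_rw [dilationMix, ← integral_mul_const]
  rw [integral_integral_swap h1]
  refine setIntegral_congr_fun measurableSet_Ioo fun t ht => ?_
  have ht0 : 0 < t := ht.1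
  have h2 := Measure.integral_comp_inv_smul_of_nonneg volume (fun z : E n => g z * φ (t • z)) ht0.le
  simp only [smul_inv_smul₀ ht0.ne', finrank_euclideanSpace_fin, smul_eq_mul] at h2
  simp_rw [mul_assoc]
  rw [integral_const_mul, integral_const_mul, h2]
  field_simp

/-- By homogeneity of degree `α - n`, the Riesz potential of `g_t` is `t^α Φ_t`, and the weight
`t^{-α}` cancels the gain. Convergence is obtained almost everywhere by splitting the kernel into
its integrable part on the unit ball and a part bounded by `1`. -/
theorem ae_integral_rieszKernel_mul_dilationMix {α : ℝ} (hn : 1 ≤ n) (h0 : 0 < α) (h1 : α < 1)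
    (hg : Integrable g) (hgc : Continuous g) {Φ : E n → ℝ}
    (h : ∀ x, ∫ y, rieszKernel α (x - y) * g y = Φ x) :
    ∀ᵐ x, Integrable (fun y => rieszKernel α (x - y) * dilationMix α g y) ∧
      ∫ y, rieszKernel α (x - y) * dilationMix α g y = dilationMix 0 Φ x := by
  have hp := integrable_prod_dilation h1 hg hgc
  let N : E n → ℝ := fun y => ∫ t in Ioo (0 : ℝ) 1, ‖t ^ (-α) * ((t ^ n)⁻¹ * g (t⁻¹ • y))‖
  have hN : Integrable N := hp.norm.integral_prod_left
  have hb : Integrable ((ball (0 : E n) 1).indicator (rieszKernel α : E n → ℝ)) :=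
    (integrable_indicator_iff measurableSet_ball).2 (integrableOn_rieszKernel_ball hn h0 1)
  filter_upwards [Integrable.ae_convolution_exists (ContinuousLinearMap.mul ℝ ℝ) hN hb] with x hx
  have hx' : Integrable (fun y => N y * (ball (0 : E n) 1).indicator (rieszKernel α) (x - y)) := hx
  have hN0 : ∀ y, 0 ≤ N y := fun y => integral_nonneg fun t => norm_nonneg _
  have hIN : Integrable (fun y => rieszKernel α (x - y) * N y) := by
    refine (hx'.add hN).mono' ((measurable_rieszKernel.comp (by fun_prop)).aestronglyMeasurable.mul
      hN.aestronglyMeasurable) (Eventually.of_forall fun y => ?_)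
    rw [norm_mul, Real.norm_of_nonneg (rieszKernel_nonneg _), Real.norm_of_nonneg (hN0 y), Pi.add_apply]
    by_cases hy : x - y ∈ ball (0 : E n) 1
    · rw [indicator_of_mem hy]; linarith [hN0 y]
    · rw [indicator_of_notMem hy, mul_zero, zero_add]
      exact mul_le_of_le_one_left (hN0 y) (rieszKernel_le_one hn h1 (by simpa using hy))
  have hprod : Integrable (fun p : E n × ℝ => rieszKernel α (x - p.1) *
      (p.2 ^ (-α) * ((p.2 ^ n)⁻¹ * g (p.2⁻¹ • p.1)))) (volume.prod (volume.restrict (Ioo 0 1))) := by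
    have hmeas : AEStronglyMeasurable (fun p : E n × ℝ => rieszKernel α (x - p.1) *
      (p.2 ^ (-α) * ((p.2 ^ n)⁻¹ * g (p.2⁻¹ • p.1)))) (volume.prod (volume.restrict (Ioo 0 1))) :=
      (measurable_rieszKernel.comp (by fun_prop)).aestronglyMeasurable.mul hp.aestronglyMeasurable
    rw [integrable_prod_iff hmeas]
    constructor
    · filter_upwards [hp.prod_right_ae] with y hy using hy.const_mul _
    · refine hIN.congr (Eventually.of_forall fun y => ?_)
      simp only [norm_mul (rieszKernel α (x - y)), Real.norm_of_nonneg (rieszKernel_nonneg (α := α) (x - y))]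
      rw [integral_const_mul]
  have hI := hprod.integral_prod_left
  simp_rw [integral_const_mul] at hI
  refine ⟨hI, ?_⟩
  simp_rw [dilationMix, ← integral_const_mul]
  rw [integral_integral_swap hprod]
  refine setIntegral_congr_fun measurableSet_Ioo fun t ht => ?_
  have ht0 : 0 < t := ht.1
  have h2 := Measure.integral_comp_inv_smul_of_nonneg volume
    (fun z : E n => rieszKernel α (x - t • z) * g z) ht0.le
  simp only [smul_inv_smul₀ ht0.ne', finrank_euclideanSpace_fin, smul_eq_mul] at h2
  have h3 : ∀ z : E n, rieszKernel α (x - t • z) = t ^ (-((n : ℝ) - α)) * rieszKernel α (t⁻¹ • x - z) := by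
    intro z
    have : x - t • z = t • (t⁻¹ • x - z) := by rw [smul_sub, smul_inv_smul₀ ht0.ne']
    rw [this, rieszKernel, norm_smul, Real.norm_of_nonneg ht0.le, Real.mul_rpow ht0.le (norm_nonneg _)]
    rfl
  have h4 : ∀ y : E n, rieszKernel α (x - y) * (t ^ (-α) * ((t ^ n)⁻¹ * g (t⁻¹ • y))) =
      (t ^ (-α) * (t ^ n)⁻¹) * (rieszKernel α (x - y) * g (t⁻¹ • y)) := fun y => by ring
  simp_rw [h4]
  rw [integral_const_mul, h2]
  simp_rw [h3, mul_assoc]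
  rw [integral_const_mul, h, neg_zero, Real.rpow_zero, one_mul]
  rw [show -((n : ℝ) - α) = α + -(n : ℝ) by ring, Real.rpow_add ht0, Real.rpow_neg ht0.le,
    Real.rpow_neg ht0.le, Real.rpow_natCast]
  field_simp

end mixture

end NonlocalGradient

/-! ### Convolutions, Young's inequality, and factorization through `Q`. -/

namespace NonlocalGradient

open Set Filter Topology Metric

variable {n : ℕ} {s δ : ℝ} {w : E n → ℝ} {wbar : ℝ → ℝ}

section convolution

/-- The convolution of two scalar functions on `ℝⁿ`. -/
noncomputable def conv (f g : E n → ℝ) (x : E n) : ℝ := ∫ y, f (x - y) * g y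

theorem conv_eq_convolution (f g : E n → ℝ) :
    conv f g = convolution f g (ContinuousLinearMap.mul ℝ ℝ) volume := by
  ext x
  rw [convolution_eq_swap]
  rfl

theorem ae_integrable_conv_integrand {f g : E n → ℝ} (hf : Integrable f) (hg : Integrable g) :
    ∀ᵐ x, Integrable (fun y => f (x - y) * g y) := by
  filter_upwards [hf.ae_convolution_exists (ContinuousLinearMap.mul ℝ ℝ) hg] with x hx
  exact hx.integrable_swap

theorem integrable_conv {f g : E n → ℝ} (hf : Integrable f) (hg : Integrable g) :
    Integrable (conv f g) := by
  rw [conv_eq_convolution]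
  exact hf.integrable_convolution _ hg

theorem conv_congr_left {f f' : E n → ℝ} (h : f =ᵐ[volume] f') (g : E n → ℝ) :
    conv f g = conv f' g := by
  rw [conv_eq_convolution, conv_eq_convolution]
  exact convolution_congr _ h EventuallyEq.rfl

theorem ae_conv_add_left {f f' g : E n → ℝ} (hf : Integrable f) (hf' : Integrable f')
    (hg : Integrable g) : ∀ᵐ x, conv (f + f') g x = conv f g x + conv f' g x := by
  filter_upwards [ae_integrable_conv_integrand hf hg, ae_integrable_conv_integrand hf' hg] with x h h'
  simp only [conv, Pi.add_apply, add_mul]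
  exact integral_add h h'

theorem ae_conv_assoc {f g h : E n → ℝ} (hf : Integrable f) (hg : Integrable g) (hh : Integrable h) :
    ∀ᵐ x, conv (conv f g) h x = conv f (conv g h) x := by
  have h1 := hg.norm.integrable_convolution (ContinuousLinearMap.mul ℝ ℝ) hh.norm
  filter_upwards [hf.norm.ae_convolution_exists (ContinuousLinearMap.mul ℝ ℝ) h1] with x hx
  simp only [conv_eq_convolution]
  exact convolution_assoc _ _ _ _ (fun x y z => mul_assoc x y z) hf.aestronglyMeasurable
    hg.aestronglyMeasurable hh.aestronglyMeasurable (hf.ae_convolution_exists _ hg)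
    (hg.norm.ae_convolution_exists _ hh.norm) hx

theorem conv_assoc_of_bounded {f g h : E n → ℝ} (hf : Continuous f) {C : ℝ} (hC : ∀ x, ‖f x‖ ≤ C)
    (hg : Integrable g) (hh : Integrable h) (x : E n) :
    conv (conv f g) h x = conv f (conv g h) x := by
  have h1 := hg.norm.integrable_convolution (ContinuousLinearMap.mul ℝ ℝ) hh.norm
  simp only [conv_eq_convolution]
  refine convolution_assoc _ _ _ _ (fun x y z => mul_assoc x y z) hf.aestronglyMeasurable
    hg.aestronglyMeasurable hh.aestronglyMeasurable (Eventually.of_forall fun y => ?_)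
    (hg.norm.ae_convolution_exists _ hh.norm) ?_
  · exact (hg.comp_sub_left y).bdd_mul (c := C) hf.aestronglyMeasurable (Eventually.of_forall hC)
  · exact (h1.comp_sub_left x).bdd_mul (c := C) hf.norm.aestronglyMeasurable
      (Eventually.of_forall fun y => by rw [norm_norm]; exact hC y)

/-- **Young's inequality** `L¹ * Lᵖ ⊆ Lᵖ`. -/
theorem memLp_conv {p : ℝ≥0∞} (hp : 1 ≤ p) {K X : E n → ℝ} (hK : Integrable K) (hX : MemLp X p) :
    MemLp (conv K X) p := by
  have hm2 : AEStronglyMeasurable (fun q : E n × E n => K (q.1 - q.2)) (volume.prod volume) :=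
    hK.aestronglyMeasurable.comp_quasiMeasurePreserving
      (quasiMeasurePreserving_sub_of_right_invariant volume volume)
  have hmeas : AEStronglyMeasurable (conv K X) volume :=
    (hm2.mul hX.aestronglyMeasurable.comp_snd).integral_prod_right'
  have hKx : ∀ x, Integrable (fun y => K (x - y)) := fun x => hK.comp_sub_left x
  set A : ℝ≥0∞ := ∫⁻ y, ‖K y‖ₑ with hA
  have hAtop : A ≠ ∞ := hK.2.ne
  have hAx : ∀ x, ∫⁻ y, ‖K (x - y)‖ₑ = A := fun x => lintegral_sub_left_eq_self (fun y => ‖K y‖ₑ) x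
  -- This measure has total mass `A = ‖K‖₁` for every `x`. Comparing the `L¹` and `L^p` norms of `X`
  -- with respect to it bounds the convolution pointwise; for finite `p`, Tonelli then concludes.
  let ν : E n → Measure (E n) := fun x => volume.withDensity fun y => ‖K (x - y)‖ₑ
  have hνu : ∀ x, ν x univ = A := fun x => by
    simp only [ν]; rw [withDensity_apply _ MeasurableSet.univ, Measure.restrict_univ, hAx]
  have hνac : ∀ x, ν x ≪ volume := fun x => withDensity_absolutelyContinuous _ _
  have hb : ∀ x, ‖conv K X x‖ₑ ≤ eLpNorm X p (ν x) * A ^ (1 - 1 / p.toReal) := by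
    intro x
    have h1 : ‖conv K X x‖ₑ ≤ eLpNorm X 1 (ν x) := by
      refine (enorm_integral_le_lintegral_enorm _).trans_eq ?_
      rw [eLpNorm_one_eq_lintegral_enorm]
      simp only [ν]
      rw [lintegral_withDensity_eq_lintegral_mul₀ (hKx x).aestronglyMeasurable.enorm
        hX.aestronglyMeasurable.enorm]
      simp only [enorm_mul, Pi.mul_apply]
    refine h1.trans ?_
    have h2 := eLpNorm_le_eLpNorm_mul_rpow_measure_univ hp
      (hX.aestronglyMeasurable.mono_ac (hνac x))
    rw [hνu] at h2
    simpa using h2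
  rcases eq_or_ne p ∞ with rfl | hptop
  · have h3 : ∀ x, ‖conv K X x‖ₑ ≤ eLpNorm X ∞ volume * A := fun x => by
      have h4 := hb x
      rw [ENNReal.toReal_top, div_zero, sub_zero, ENNReal.rpow_one] at h4
      refine h4.trans (mul_le_mul_left ?_ A)
      rw [eLpNorm_exponent_top, eLpNorm_exponent_top]
      exact essSup_mono_measure (hνac x)
    have h5 : eLpNorm X ∞ volume * A < ∞ := ENNReal.mul_lt_top hX.eLpNorm_lt_top hAtop.lt_top
    refine ⟨hmeas, ?_⟩
    rw [eLpNorm_exponent_top]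
    exact (essSup_le_of_ae_le _ (Eventually.of_forall h3)).trans_lt h5
  · have hp0 : p ≠ 0 := (one_pos.trans_le hp).ne'
    have hr : 0 < p.toReal := ENNReal.toReal_pos hp0 hptop
    refine ⟨hmeas, ?_⟩
    rw [eLpNorm_lt_top_iff_lintegral_rpow_enorm_lt_top hp0 hptop]
    have hXfin := (eLpNorm_lt_top_iff_lintegral_rpow_enorm_lt_top hp0 hptop).1 hX.2
    have hb2 : ∀ x, ‖conv K X x‖ₑ ^ p.toReal ≤
        (∫⁻ y, ‖K (x - y)‖ₑ * ‖X y‖ₑ ^ p.toReal) * (A ^ (1 - 1 / p.toReal)) ^ p.toReal := by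
      intro x
      refine (ENNReal.rpow_le_rpow (hb x) hr.le).trans_eq ?_
      rw [ENNReal.mul_rpow_of_nonneg _ _ hr.le, eLpNorm_eq_lintegral_rpow_enorm_toReal hp0 hptop,
        ← ENNReal.rpow_mul, one_div_mul_cancel hr.ne', ENNReal.rpow_one]
      simp only [ν]
      rw [lintegral_withDensity_eq_lintegral_mul₀ (hKx x).aestronglyMeasurable.enorm
        (hX.aestronglyMeasurable.enorm.pow_const _)]
      rfl
    have hAf : (A ^ (1 - 1 / p.toReal)) ^ p.toReal ≠ ∞ := by
      have h1 : 1 ≤ p.toReal := by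
        simpa using (ENNReal.toReal_le_toReal ENNReal.one_ne_top hptop).2 hp
      refine ENNReal.rpow_ne_top_of_nonneg hr.le (ENNReal.rpow_ne_top_of_nonneg ?_ hAtop)
      rw [sub_nonneg, div_le_one hr]; exact h1
    refine (lintegral_mono hb2).trans_lt ?_
    rw [lintegral_mul_const' _ _ hAf]
    refine ENNReal.mul_lt_top ?_ hAf.lt_top
    rw [lintegral_lintegral_swap]
    · have h3 : ∀ᵐ y, ∫⁻ x, ‖K (x - y)‖ₑ * ‖X y‖ₑ ^ p.toReal = A * ‖X y‖ₑ ^ p.toReal := by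
        refine Eventually.of_forall fun y => ?_
        rw [lintegral_mul_const' _ _ (ENNReal.rpow_ne_top_of_nonneg hr.le (by simp)),
          lintegral_sub_right_eq_self (fun y => ‖K y‖ₑ) y]
      rw [lintegral_congr_ae h3, lintegral_const_mul' _ _ hAtop]
      exact ENNReal.mul_lt_top hAtop.lt_top hXfin
    · exact hm2.enorm.mul (hX.aestronglyMeasurable.comp_snd.enorm.pow_const _)

end convolution

/-- Convolution with the mixture of rescalings of a test function factors through `Q`, up to a
smooth error. -/
theorem exists_conv_dilationMix_eq (hw : IsCutoff δ w wbar) (hδ : 0 < δ) (hn : 1 ≤ n) (hs0 : 0 < s)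
    (hs1 : s < 1) {Φ : E n → ℝ} (hΦ : ContDiff ℝ (⊤ : ℕ∞) Φ) (hc : HasCompactSupport Φ) :
    ∃ G : E n → ℝ, Integrable G ∧ ∀ X : E n → ℝ, Integrable X → ∃ f : E n → ℝ,
      ContDiff ℝ (⊤ : ℕ∞) f ∧
      ∀ᵐ x, conv (dilationMix 0 Φ) X x = conv (Q s δ w wbar) (conv G X) x + f x := by
  have h0 : 0 < 1 - s := by linarith
  have h1 : 1 - s < 1 := by linarith
  have : Nonempty (Fin n) := ⟨⟨0, hn⟩⟩
  obtain ⟨c, hc0, S, hS, hQS⟩ := exists_tame_Q_sub_rieszKernel hw hδ hn hs0 hs1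
  obtain ⟨κ, hκ, hI⟩ := integral_rieszKernel_mul_fracLap hΦ hc hn h0 h1
  obtain ⟨C, hC⟩ := hS.exists_bound
  have hΦ1 : ContDiff ℝ 1 Φ := hΦ.of_le (by exact_mod_cast le_top)
  let g : E n → ℝ := fun x => κ⁻¹ * fracLap (1 - s) Φ x
  have hg : Integrable g := (integrable_fracLap hΦ1 hc hn h0 h1).const_mul _
  have hgc : Continuous g := (continuous_fracLap hΦ1 hc hn h0 h1).const_mul _
  have hgI : ∀ x, ∫ y, rieszKernel (1 - s) (x - y) * g y = Φ x := fun x => by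
    simp only [g, mul_left_comm _ κ⁻¹]
    rw [integral_const_mul, hI, inv_mul_cancel_left₀ hκ.ne']
  have hΦi : Integrable Φ := hΦ.continuous.integrable_of_hasCompactSupport hc
  -- With `Q = c · Riesz + S`, this choice gives `Q * G = dilationMix 0 Φ + S * G` almost
  -- everywhere.
  let G : E n → ℝ := fun x => c⁻¹ * dilationMix (1 - s) g x
  have hG : Integrable G := (integrable_dilationMix h1 hg hgc).const_mul _
  have hQ := integrable_Q hw hδ hn hs0 hs1
  have hk : Integrable (dilationMix 0 Φ) := integrable_dilationMix one_pos hΦi hΦ.continuous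
  have hSG : ∀ x, Integrable (fun y => S (x - y) * G y) := fun x =>
    hG.bdd_mul (c := C) (hS.contDiff.continuous.comp (by fun_prop)).aestronglyMeasurable
      (Eventually.of_forall fun y => hC _)
  have hsplit : conv (Q s δ w wbar) G =ᵐ[volume] dilationMix 0 Φ + conv S G := by
    filter_upwards [ae_integral_rieszKernel_mul_dilationMix hn h0 h1 hg hgc hgI] with x hx
    have hne : ∀ᵐ y : E n, y ≠ x := Measure.ae_ne volume x
    have h3 : (fun y => Q s δ w wbar (x - y) * G y) =ᵐ[volume] fun y =>
        rieszKernel (1 - s) (x - y) * dilationMix (1 - s) g y + S (x - y) * G y := by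
      filter_upwards [hne] with y hy
      rw [hQS _ (sub_ne_zero.2 hy.symm)]
      simp only [G]
      field_simp
    rw [conv, integral_congr_ae h3, integral_add hx.1 (hSG x), hx.2]
    rfl
  have hSGi : Integrable (conv S G) := by
    refine ((integrable_conv hQ hG).sub hk).congr ?_
    filter_upwards [hsplit] with x hx
    simp [hx]
  -- By associativity the error `(S * G) * X` equals `S * (G * X)`, a tame kernel convolved with an
  -- integrable function, hence smooth.
  refine ⟨G, hG, fun X hX => ⟨fun x => -conv S (conv G X) x, ?_, ?_⟩⟩
  · refine ContDiff.neg ?_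
    have := contDiff_integral_smul_sub (integrable_conv hG hX) hS
    simp only [smul_eq_mul, mul_comm (conv G X _)] at this
    exact this
  · have h4 : conv (conv (Q s δ w wbar) G) X = conv (dilationMix 0 Φ + conv S G) X :=
      conv_congr_left hsplit X
    filter_upwards [ae_conv_add_left hk hSGi hX, ae_conv_assoc hQ hG hX] with x hx hx'
    rw [← h4, hx', conv_assoc_of_bounded hS.contDiff.continuous hC hG hX] at hx
    rw [hx]; ring

end NonlocalGradient

/-! ### Interior cones, correlations with test functions, and weak gradients. -/

namespace NonlocalGradient

open Set Filter Topology Metric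

variable {n : ℕ} {s δ : ℝ} {w : E n → ℝ} {wbar : ℝ → ℝ}

section cone

/-- The uniform interior cone property of a bounded Lipschitz domain. -/
theorem IsBoundedLipschitzDomain.exists_cone {Ω : Opens (E n)} (hΩ : IsBoundedLipschitzDomain Ω)
    {x₀ : E n} (hx₀ : x₀ ∈ closure (Ω : Set (E n))) :
    ∃ r > 0, ∃ w₀ : E n, ∃ ε > 0, (∀ z ∈ ball w₀ ε, ‖z‖ < r) ∧
      ∀ y ∈ Ω, y ∈ ball x₀ (2 * r) → ∀ z ∈ ball w₀ ε, ∀ t ∈ Icc (0 : ℝ) 1, y - t • z ∈ Ω := by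
  by_cases hx : x₀ ∈ Ω
  · obtain ⟨ρ, hρ, hb⟩ := Metric.isOpen_iff.1 Ω.isOpen x₀ hx
    refine ⟨ρ / 3, by positivity, 0, ρ / 3, by positivity, fun z hz => by simpa using hz, ?_⟩
    intro y _ hy z hz t ht
    apply hb
    rw [mem_ball, dist_eq_norm] at hy ⊢
    rw [mem_ball_zero_iff] at hz
    have h1 : ‖t • z‖ ≤ ‖z‖ := by
      rw [norm_smul, Real.norm_of_nonneg ht.1]
      exact mul_le_of_le_one_left (norm_nonneg _) ht.2
    calc ‖y - t • z - x₀‖ = ‖(y - x₀) - t • z‖ := by congr 1; abel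
      _ ≤ ‖y - x₀‖ + ‖t • z‖ := norm_sub_le _ _
      _ < ρ := by linarith
  · obtain ⟨r₀, hr₀, e, he, K, γ, hγ, hgr⟩ := hΩ.lipschitz_boundary x₀
      ⟨hx₀, by rwa [Ω.isOpen.interior_eq]⟩
    have hK : (0 : ℝ) ≤ K := K.2
    set η := r₀ / 6 with hη
    have hη0 : 0 < η := by positivity
    set ε := η / (2 * K + 1) with hε
    -- The cone axis is `-η e`, so subtracting `t z` raises the height by about `t η`. A
    -- perturbation of `z` of size `ε` lowers the height by at most `t ε` and raises the graph by at
    -- most `2 K t ε`. The choice `ε (2K + 1) = η` balances these exactly, with strictness inherited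
    -- from `y` lying above the graph.
    have hε0 : 0 < ε := by positivity
    have hεη : ε * (2 * K + 1) = η := by rw [hε]; field_simp
    have hεle : ε ≤ η := by nlinarith
    have hnorm : ∀ z ∈ ball (-(η • e)) ε, ‖z‖ < r₀ / 3 := fun z hz => by
      rw [mem_ball, dist_eq_norm] at hz
      calc ‖z‖ = ‖(z - -(η • e)) + -(η • e)‖ := by congr 1; abel
        _ ≤ ‖z - -(η • e)‖ + ‖-(η • e)‖ := norm_add_le _ _
        _ < ε + η := by
          rw [norm_neg, norm_smul, he, mul_one, Real.norm_of_nonneg hη0.le]; linarith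
        _ ≤ r₀ / 3 := by linarith
    refine ⟨r₀ / 3, by positivity, -(η • e), ε, hε0, hnorm, fun y hyΩ hy z hz t ht => ?_⟩
    have htz : ‖t • z‖ ≤ ‖z‖ := by
      rw [norm_smul, Real.norm_of_nonneg ht.1]
      exact mul_le_of_le_one_left (norm_nonneg _) ht.2
    have hzn := hnorm z hz
    rw [mem_ball, dist_eq_norm] at hy
    have hb1 : y ∈ ball x₀ r₀ := by rw [mem_ball, dist_eq_norm]; linarith
    have hb2 : y - t • z ∈ ball x₀ r₀ := by
      rw [mem_ball, dist_eq_norm]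
      calc ‖y - t • z - x₀‖ = ‖(y - x₀) - t • z‖ := by congr 1; abel
        _ ≤ ‖y - x₀‖ + ‖t • z‖ := norm_sub_le _ _
        _ < r₀ := by linarith
    have hy1 := (hgr y hb1).1 hyΩ
    rw [hgr _ hb2]
    obtain ⟨h, rfl⟩ : ∃ h, z = h - η • e := ⟨z + η • e, by abel⟩
    have hh : ‖h‖ < ε := by
      rw [mem_ball, dist_eq_norm] at hz
      simpa using hz
    have hee : inner ℝ e e = (1 : ℝ) := by rw [real_inner_self_eq_norm_sq, he]; norm_num
    have hin : inner ℝ e (y - t • (h - η • e)) = inner ℝ e y - t * inner ℝ e h + t * η := by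
      rw [inner_sub_right, inner_smul_right, inner_sub_right, inner_smul_right, hee]; ring
    have hproj : y - t • (h - η • e) - inner ℝ e (y - t • (h - η • e)) • e =
        (y - inner ℝ e y • e) - t • (h - inner ℝ e h • e) := by
      rw [hin]; module
    have hie : |inner ℝ e h| ≤ ‖h‖ := by
      simpa [he] using abs_real_inner_le_norm e h
    have hPh : ‖h - inner ℝ e h • e‖ ≤ 2 * ε := by
      refine (norm_sub_le _ _).trans ?_
      rw [norm_smul, he, mul_one, Real.norm_eq_abs]; linarith
    have hl := hγ.dist_le_mul ((y - inner ℝ e y • e) - t • (h - inner ℝ e h • e)) (y - inner ℝ e y • e)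
    rw [Real.dist_eq, dist_eq_norm, sub_sub_cancel_left, norm_neg, norm_smul,
      Real.norm_of_nonneg ht.1] at hl
    have hl2 := (le_abs_self _).trans hl
    rw [hproj, hin]
    have h5 : (K : ℝ) * (t * ‖h - inner ℝ e h • e‖) ≤ K * (t * (2 * ε)) := by
      have := ht.1
      gcongr
    have h6 : t * inner ℝ e h ≤ t * ε :=
      mul_le_mul_of_nonneg_left ((le_abs_self _).trans (hie.trans hh.le)) ht.1
    have h7 : t * η = t * ε * (2 * K + 1) := by rw [← hεη]; ring
    linarith

end cone

section correlation

/-- The correlation of an integrable function with a test function. -/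
noncomputable def corr (X φ : E n → ℝ) (z : E n) : ℝ := ∫ y, X y * φ (y + z)

variable {X φ : E n → ℝ}

theorem continuous_corr (hX : Integrable X) (hφ : Continuous φ) {C : ℝ} (hC : ∀ x, |φ x| ≤ C) :
    Continuous (corr X φ) := by
  refine continuous_of_dominated (bound := fun y => ‖X y‖ * C)
    (fun z => hX.aestronglyMeasurable.mul (by fun_prop))
    (fun z => Eventually.of_forall fun y => ?_) (hX.norm.mul_const C)
    (Eventually.of_forall fun y => by fun_prop)
  rw [norm_mul]
  exact mul_le_mul_of_nonneg_left (hC _) (norm_nonneg _)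

theorem abs_corr_le (hX : Integrable X) {C : ℝ} (hC : ∀ x, |φ x| ≤ C) (z : E n) :
    |corr X φ z| ≤ (∫ y, ‖X y‖) * C := by
  rw [← Real.norm_eq_abs, ← integral_mul_const]
  refine norm_integral_le_of_norm_le (hX.norm.mul_const C) (Eventually.of_forall fun y => ?_)
  rw [norm_mul]
  exact mul_le_mul_of_nonneg_left (hC _) (norm_nonneg _)

/-- This moves the convolution onto the kernel variable, so that identities for `K * X` can be
checked by tests that see only `z ↦ corr X φ z`, a function which is differentiable along lines even
when `X` is rough. -/
theorem integral_mul_conv {K : E n → ℝ} (hK : Integrable K) (hX : Integrable X) (hφ : Continuous φ)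
    {C : ℝ} (hC : ∀ x, |φ x| ≤ C) : ∫ x, φ x * conv K X x = ∫ z, K z * corr X φ z := by
  have h1 : ∀ x, conv K X x = ∫ z, K z * X (x - z) := fun x => by
    rw [conv, ← integral_sub_left_eq_self _ volume x]
    simp
  have h2 : Integrable (fun p : E n × E n => φ p.1 * (K p.2 * X (p.1 - p.2)))
      (volume.prod volume) :=
    (hK.convolution_integrand (ContinuousLinearMap.mul ℝ ℝ) hX).bdd_mul (c := C)
      (hφ.comp continuous_fst).aestronglyMeasurable (Eventually.of_forall fun p => hC _)
  simp_rw [h1, ← integral_const_mul]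
  rw [integral_integral_swap h2]
  refine integral_congr_ae (Eventually.of_forall fun z => ?_)
  simp only [corr]
  rw [← integral_const_mul, ← integral_sub_right_eq_self (fun y => K z * (X y * φ (y + z))) z]
  refine integral_congr_ae (Eventually.of_forall fun y => ?_)
  simp only [sub_add_cancel]
  ring

theorem hasDerivAt_corr (hX : Integrable X) (hφ : ContDiff ℝ 1 φ) (hφc : HasCompactSupport φ)
    (z : E n) (t : ℝ) :
    HasDerivAt (fun t : ℝ => corr X φ (t • z)) (∫ y, X y * fderiv ℝ φ (y + t • z) z) t := by
  obtain ⟨C, hC⟩ := (hφ.continuous_fderiv one_ne_zero).bounded_above_of_compact_support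
    (hφc.fderiv (𝕜 := ℝ))
  obtain ⟨C', hC'⟩ := hφ.continuous.bounded_above_of_compact_support hφc
  have hcf := hφ.continuous_fderiv one_ne_zero
  have hcont := hφ.continuous
  refine (hasDerivAt_integral_of_dominated_loc_of_deriv_le (s := univ)
    (F := fun (t : ℝ) y => X y * φ (y + t • z)) (F' := fun t y => X y * fderiv ℝ φ (y + t • z) z)
    (bound := fun y => ‖X y‖ * (C * ‖z‖)) univ_mem
    (Eventually.of_forall fun t => hX.aestronglyMeasurable.mul (by fun_prop)) ?_
    (hX.aestronglyMeasurable.mul (by fun_prop)) (Eventually.of_forall fun y t _ => ?_)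
    (hX.norm.mul_const _) (Eventually.of_forall fun y t _ => ?_)).2
  · exact hX.mul_bdd (c := C') (by fun_prop) (Eventually.of_forall fun y => hC' _)
  · rw [norm_mul]
    exact mul_le_mul_of_nonneg_left ((ContinuousLinearMap.le_opNorm _ _).trans
      (mul_le_mul_of_nonneg_right (hC _) (norm_nonneg _))) (norm_nonneg _)
  · have h1 : HasDerivAt (fun t : ℝ => y + t • z) z t := by
      simpa using ((hasDerivAt_id t).smul_const z).const_add y
    exact ((hφ.differentiable one_ne_zero _).hasFDerivAt.comp_hasDerivAt t h1).const_mul _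

end correlation

section weakGradient

variable {Ω : Opens (E n)} {v : E n → ℝ} {g : E n → E n}

theorem HasWeakGrad.integral_mul_fderiv (h : HasWeakGrad Ω v g)
    (hv : IntegrableOn v (Ω : Set (E n))) (hg : IntegrableOn g (Ω : Set (E n))) (θ : 𝓓(Ω, ℝ))
    (z : E n) : ∫ x in (Ω : Set (E n)), v x * fderiv ℝ θ x z =
      -∫ x in (Ω : Set (E n)), θ x * inner ℝ z (g x) := by
  have hc : Continuous (gradient θ) :=
    (InnerProductSpace.toDual ℝ (E n)).symm.continuous.comp
      (θ.contDiff.continuous_fderiv (by simp))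
  have hs : HasCompactSupport (gradient θ) :=
    (θ.hasCompactSupport.fderiv (𝕜 := ℝ)).comp_left (map_zero _)
  obtain ⟨C, hC⟩ := hc.bounded_above_of_compact_support hs
  obtain ⟨C', hC'⟩ := θ.continuous.bounded_above_of_compact_support θ.hasCompactSupport
  have h1 : IntegrableOn (fun x => v x • gradient θ x) (Ω : Set (E n)) :=
    Integrable.smul_bdd hv C hc.aestronglyMeasurable (Eventually.of_forall hC)
  have h2 : IntegrableOn (fun x => θ x • g x) (Ω : Set (E n)) :=
    Integrable.bdd_smul hg C' θ.continuous.aestronglyMeasurable (Eventually.of_forall hC')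
  have h3 := congrArg (inner ℝ z) (h θ)
  rw [inner_neg_right, ← integral_inner h1, ← integral_inner h2] at h3
  have h4 : ∀ x, inner ℝ z (v x • gradient θ x) = v x * fderiv ℝ θ x z := fun x => by
    rw [inner_smul_right, real_inner_comm, gradient, InnerProductSpace.toDual_symm_apply]
  simpa only [h4, inner_smul_right] using h3

/-- The components of the gradient of the product of `χ` and a function `v` on `Ω` with weak
gradient `g`, extended by zero. -/
noncomputable def productGrad (Ω : Opens (E n)) (χ v : E n → ℝ) (g : E n → E n) (j : Fin n) :
    E n → ℝ :=
  (Ω : Set (E n)).indicator fun x => χ x * g x j + v x * fderiv ℝ χ x (EuclideanSpace.single j 1)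

theorem memLp_productGrad {χ : E n → ℝ} (hχ : ContDiff ℝ 1 χ) (hχc : HasCompactSupport χ)
    {p : ℝ≥0∞} (hv : MemLp v p (volume.restrict (Ω : Set (E n))))
    (hg : MemLp g p (volume.restrict (Ω : Set (E n)))) (j : Fin n) :
    MemLp (productGrad Ω χ v g j) p := by
  have hcf := hχ.continuous_fderiv one_ne_zero
  obtain ⟨C, hC⟩ := hcf.bounded_above_of_compact_support (hχc.fderiv (𝕜 := ℝ))
  obtain ⟨C', hC'⟩ := hχ.continuous.bounded_above_of_compact_support hχc
  refine (memLp_indicator_iff_restrict Ω.isOpen.measurableSet).2 (MemLp.add ?_ ?_)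
  · have hgj : MemLp (fun x => g x j) p (volume.restrict (Ω : Set (E n))) :=
      (EuclideanSpace.proj (𝕜 := ℝ) j).comp_memLp' hg
    refine (hgj.const_mul C').mono (hχ.continuous.aestronglyMeasurable.mul hgj.1)
      (Eventually.of_forall fun x => ?_)
    rw [norm_mul, norm_mul]
    exact mul_le_mul_of_nonneg_right ((hC' x).trans (le_abs_self _)) (norm_nonneg _)
  · refine (hv.const_mul C).mono (hv.1.mul (by fun_prop)) (Eventually.of_forall fun x => ?_)
    rw [norm_mul, norm_mul, mul_comm]
    refine mul_le_mul_of_nonneg_right ?_ (norm_nonneg _)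
    refine (ContinuousLinearMap.le_opNorm _ _).trans ?_
    rw [PiLp.norm_single, norm_one, mul_one]
    exact (hC x).trans (le_abs_self _)

end weakGradient

end NonlocalGradient

/-! ### The Sobolev integral representation along an interior cone. -/

namespace NonlocalGradient

open Set Filter Topology Metric

variable {n : ℕ} {s δ : ℝ} {w : E n → ℝ} {wbar : ℝ → ℝ}

section representation

variable {Ω : Opens (E n)} {v χ : E n → ℝ} {g : E n → E n}

theorem inner_eq_sum (z x : E n) : inner ℝ z x = ∑ j, z j * x j := by
  simp [PiLp.inner_apply, mul_comm]

theorem clm_apply_eq_sum (L : E n →L[ℝ] ℝ) (z : E n) :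
    L z = ∑ j, z j * L (EuclideanSpace.single j 1) := by
  conv_lhs => rw [← (EuclideanSpace.basisFun (Fin n) ℝ).sum_repr z]
  simp [map_sum]

/-- Integration by parts along directions pointing out of the interior cone. -/
theorem HasWeakGrad.integral_productGrad (h : HasWeakGrad Ω v g)
    (hv : IntegrableOn v (Ω : Set (E n))) (hg : IntegrableOn g (Ω : Set (E n)))
    (hχ : ContDiff ℝ (⊤ : ℕ∞) χ) (hχc : HasCompactSupport χ)
    {φ : E n → ℝ} (hφ : ContDiff ℝ (⊤ : ℕ∞) φ) (hφc : HasCompactSupport φ) {a : E n}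
    (z : E n) (hsupp : ∀ y ∈ tsupport χ, y + a ∈ tsupport φ → y ∈ Ω) :
    ∫ y, (Ω : Set (E n)).indicator (fun y => χ y * v y) y * fderiv ℝ φ (y + a) z =
      -∑ j, z j * corr (productGrad Ω χ v g j) φ a := by
  have hχ1 : ContDiff ℝ 1 χ := hχ.of_le (by exact_mod_cast le_top)
  have hφ1 : ContDiff ℝ 1 φ := hφ.of_le (by exact_mod_cast le_top)
  have hφa : ContDiff ℝ (⊤ : ℕ∞) fun y => φ (y + a) := hφ.comp (contDiff_id.add contDiff_const)
  have hts : tsupport (fun y => χ y * φ (y + a)) ⊆ (Ω : Set (E n)) := fun y hy => by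
    refine hsupp y (tsupport_mul_subset_left hy) ?_
    have h1 := tsupport_mul_subset_right hy
    exact tsupport_comp_subset_preimage φ (f := fun y => y + a) (by fun_prop) h1
  -- The translate of `φ` may leave `Ω`; the support condition ensures that its product with `χ` is
  -- still a test function on `Ω`. This is how zero extension across the boundary causes no boundary
  -- term.
  let θ : 𝓓(Ω, ℝ) := ⟨fun y => χ y * φ (y + a), hχ.mul hφa, hχc.mul_right, hts⟩
  have hθ : ∀ y, fderiv ℝ θ y z = χ y * fderiv ℝ φ (y + a) z + φ (y + a) * fderiv ℝ χ y z := by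
    intro y
    change fderiv ℝ (fun y => χ y * φ (y + a)) y z = _
    rw [fderiv_fun_mul (hχ1.differentiable one_ne_zero y)
      ((hφa.differentiable (by simp)) y), fderiv_comp_add_right]
    simp
  have hkey := h.integral_mul_fderiv hv hg θ z
  have hcφ := hφ.continuous
  have hcfφ := hφ1.continuous_fderiv one_ne_zero
  have hcχ := hχ.continuous
  have hcfχ := hχ1.continuous_fderiv one_ne_zero
  obtain ⟨C, hC⟩ := hcφ.bounded_above_of_compact_support hφc
  obtain ⟨C₁, hC₁⟩ := hcfφ.bounded_above_of_compact_support (hφc.fderiv (𝕜 := ℝ))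
  obtain ⟨D, hD⟩ := hcχ.bounded_above_of_compact_support hχc
  obtain ⟨D₁, hD₁⟩ := hcfχ.bounded_above_of_compact_support (hχc.fderiv (𝕜 := ℝ))
  have hD₁z : ∀ y, ‖fderiv ℝ χ y z‖ ≤ D₁ * ‖z‖ := fun y =>
    (ContinuousLinearMap.le_opNorm _ _).trans (mul_le_mul_of_nonneg_right (hD₁ y) (norm_nonneg _))
  have hC₁z : ∀ y, ‖fderiv ℝ φ (y + a) z‖ ≤ C₁ * ‖z‖ := fun y =>
    (ContinuousLinearMap.le_opNorm _ _).trans (mul_le_mul_of_nonneg_right (hC₁ _) (norm_nonneg _))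
  have i1 : IntegrableOn (fun y => v y * (χ y * fderiv ℝ φ (y + a) z)) (Ω : Set (E n)) := by
    refine hv.mul_bdd (c := D * (C₁ * ‖z‖)) (by fun_prop) (Eventually.of_forall fun y => ?_)
    rw [norm_mul]
    exact mul_le_mul (hD y) (hC₁z y) (norm_nonneg _) ((norm_nonneg _).trans (hD y))
  have i2 : IntegrableOn (fun y => v y * (φ (y + a) * fderiv ℝ χ y z)) (Ω : Set (E n)) := by
    refine hv.mul_bdd (c := C * (D₁ * ‖z‖)) (by fun_prop) (Eventually.of_forall fun y => ?_)
    rw [norm_mul]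
    exact mul_le_mul (hC _) (hD₁z y) (norm_nonneg _) ((norm_nonneg _).trans (hC y))
  have i3 : IntegrableOn (fun y => θ y * inner ℝ z (g y)) (Ω : Set (E n)) := by
    refine (hg.const_inner z).bdd_mul (c := D * C) (by fun_prop) (Eventually.of_forall fun y => ?_)
    change ‖χ y * φ (y + a)‖ ≤ _
    rw [norm_mul]
    exact mul_le_mul (hD y) (hC _) (norm_nonneg _) ((norm_nonneg _).trans (hD y))
  have hpi : ∀ j, Integrable (productGrad Ω χ v g j) := fun j =>
    memLp_one_iff_integrable.1 (memLp_productGrad hχ1 hχc (memLp_one_iff_integrable.2 hv)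
      (memLp_one_iff_integrable.2 hg) j)
  have hsum : ∑ j, z j * corr (productGrad Ω χ v g j) φ a =
      ∫ y in (Ω : Set (E n)), (θ y * inner ℝ z (g y) + v y * (φ (y + a) * fderiv ℝ χ y z)) := by
    simp_rw [corr, ← integral_const_mul]
    rw [← integral_finsetSum _ fun j _ =>
      ((hpi j).mul_bdd (c := C) (by fun_prop) (Eventually.of_forall fun y => hC _)).const_mul _,
      ← integral_indicator Ω.isOpen.measurableSet]
    refine integral_congr_ae (Eventually.of_forall fun y => ?_)
    by_cases hy : y ∈ (Ω : Set (E n))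
    · simp only [productGrad, indicator_of_mem hy]
      rw [inner_eq_sum, clm_apply_eq_sum, show θ y = χ y * φ (y + a) from rfl]
      simp only [Finset.mul_sum]
      rw [← Finset.sum_add_distrib]
      exact Finset.sum_congr rfl fun j _ => by ring
    · simp only [productGrad, indicator_of_notMem hy, zero_mul, mul_zero, Finset.sum_const_zero]
  have hlhs : ∫ y, (Ω : Set (E n)).indicator (fun y => χ y * v y) y * fderiv ℝ φ (y + a) z =
      ∫ y in (Ω : Set (E n)), v y * (χ y * fderiv ℝ φ (y + a) z) := by
    rw [← integral_indicator Ω.isOpen.measurableSet]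
    refine integral_congr_ae (Eventually.of_forall fun y => ?_)
    by_cases hy : y ∈ (Ω : Set (E n))
    · simp only [indicator_of_mem hy]; ring
    · simp only [indicator_of_notMem hy, zero_mul]
  rw [hlhs, hsum, integral_add i3 i2]
  simp_rw [hθ, mul_add] at hkey
  rw [integral_add i1 i2] at hkey
  linarith

/-- The Sobolev type integral representation of a function in terms of its weak gradient, near a
point of the closure of a domain with the interior cone property. -/
theorem HasWeakGrad.ae_mul_eq (h : HasWeakGrad Ω v g)
    (hv : IntegrableOn v (Ω : Set (E n))) (hg : IntegrableOn g (Ω : Set (E n)))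
    (hχ : ContDiff ℝ (⊤ : ℕ∞) χ) (hχc : HasCompactSupport χ) {x₀ w₀ : E n} {r ε : ℝ}
    (hχs : tsupport χ ⊆ ball x₀ r) (hr : ∀ z ∈ ball w₀ ε, ‖z‖ < r)
    (hcone : ∀ y ∈ Ω, y ∈ ball x₀ (2 * r) → ∀ z ∈ ball w₀ ε, ∀ t ∈ Icc (0 : ℝ) 1, y - t • z ∈ Ω)
    {M : E n → ℝ} (hM : Continuous M) (hMc : HasCompactSupport M)
    (hMs : Function.support M ⊆ ball w₀ ε) (hM1 : ∫ z, M z = 1) :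
    ∀ᵐ x ∂volume.restrict (Ω : Set (E n)), χ x * v x =
      conv M ((Ω : Set (E n)).indicator fun y => χ y * v y) x +
      ∑ j, conv (dilationMix 0 fun z => z j * M z) (productGrad Ω χ v g j) x := by
  have hχ1 : ContDiff ℝ 1 χ := hχ.of_le (by exact_mod_cast le_top)
  set V : E n → ℝ := (Ω : Set (E n)).indicator fun y => χ y * v y with hVdef
  obtain ⟨D, hD⟩ := hχ.continuous.bounded_above_of_compact_support hχc
  have hV : Integrable V := (integrable_indicator_iff Ω.isOpen.measurableSet).2
    (hv.bdd_mul (c := D) hχ.continuous.aestronglyMeasurable (Eventually.of_forall hD))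
  have hX : ∀ j, Integrable (productGrad Ω χ v g j) := fun j =>
    memLp_one_iff_integrable.1 (memLp_productGrad hχ1 hχc (memLp_one_iff_integrable.2 hv)
      (memLp_one_iff_integrable.2 hg) j)
  have hMi : Integrable M := hM.integrable_of_hasCompactSupport hMc
  have hΦc : ∀ j, Continuous fun z : E n => z j * M z := fun j => by fun_prop
  have hΦi : ∀ j, Integrable fun z : E n => z j * M z := fun j =>
    (hΦc j).integrable_of_hasCompactSupport hMc.mul_left
  have hki : ∀ j, Integrable (dilationMix 0 fun z : E n => z j * M z) := fun j =>
    integrable_dilationMix one_pos (hΦi j) (hΦc j)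
  set R : E n → ℝ := fun x => conv M V x +
    ∑ j, conv (dilationMix 0 fun z => z j * M z) (productGrad Ω χ v g j) x with hR
  have hRi : Integrable R := (integrable_conv hMi hV).add
    (integrable_finsetSum _ fun j _ => integrable_conv (hki j) (hX j))
  -- The identity is proved weakly. Every term is transferred to correlations with `φ`, so that `v`
  -- is never differentiated pointwise.
  have hmain : ∀ φ : E n → ℝ, ContDiff ℝ (⊤ : ℕ∞) φ → HasCompactSupport φ →
      tsupport φ ⊆ (Ω : Set (E n)) → ∫ x, φ x * R x = ∫ x, φ x * V x := by
    intro φ hφ hφc hφs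
    have hφ1 : ContDiff ℝ 1 φ := hφ.of_le (by exact_mod_cast le_top)
    obtain ⟨C, hC⟩ := hφ.continuous.bounded_above_of_compact_support hφc
    simp only [Real.norm_eq_abs] at hC
    have hcc : ∀ j, Continuous (corr (productGrad Ω χ v g j) φ) := fun j =>
      continuous_corr (hX j) hφ.continuous hC
    -- The fundamental theorem of calculus along the segment from `0` to `z`. The cone condition
    -- keeps the supports admissible for every `t` in `[0, 1]`.
    have hftc : ∀ z ∈ ball w₀ ε, corr V φ z - corr V φ 0 =
        -∑ j, z j * ∫ t in Ioo (0 : ℝ) 1, corr (productGrad Ω χ v g j) φ (t • z) := by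
      intro z hz
      have hd : ∀ t ∈ uIcc (0 : ℝ) 1, HasDerivAt (fun t : ℝ => corr V φ (t • z))
          (-∑ j, z j * corr (productGrad Ω χ v g j) φ (t • z)) t := by
        intro t ht
        rw [uIcc_of_le zero_le_one] at ht
        rw [← h.integral_productGrad hv hg hχ hχc hφ hφc z]
        · exact hasDerivAt_corr hV hφ1 hφc z t
        · intro y hy hy'
          have h1 := hcone _ (hφs hy') ?_ z hz t ht
          · simpa using h1
          · have h2 := hχs hy
            rw [mem_ball, dist_eq_norm] at h2 ⊢
            have h3 : ‖t • z‖ ≤ ‖z‖ := by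
              rw [norm_smul, Real.norm_of_nonneg ht.1]
              exact mul_le_of_le_one_left (norm_nonneg _) ht.2
            calc ‖y + t • z - x₀‖ = ‖(y - x₀) + t • z‖ := by congr 1; abel
              _ ≤ ‖y - x₀‖ + ‖t • z‖ := norm_add_le _ _
              _ < 2 * r := by linarith [hr z hz]
      have hcd : Continuous fun t : ℝ => -∑ j, z j * corr (productGrad Ω χ v g j) φ (t • z) := by
        fun_prop
      have h4 := intervalIntegral.integral_eq_sub_of_hasDerivAt hd (hcd.intervalIntegrable _ _)
      rw [one_smul, zero_smul] at h4
      rw [← h4, intervalIntegral.integral_neg, intervalIntegral.integral_finsetSum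
        fun j _ => (Continuous.intervalIntegrable (by fun_prop) _ _)]
      congr 1
      refine Finset.sum_congr rfl fun j _ => ?_
      rw [intervalIntegral.integral_const_mul, intervalIntegral.integral_of_le zero_le_one,
        integral_Ioc_eq_integral_Ioo]
    have hbd : ∀ j z, |corr (productGrad Ω χ v g j) φ z| ≤
        (∫ y, ‖productGrad Ω χ v g j y‖) * C := fun j z => abs_corr_le (hX j) hC z
    have hk : ∀ j, ∫ x, φ x * conv (dilationMix 0 fun z => z j * M z) (productGrad Ω χ v g j) x =
        ∫ z, M z * (z j * ∫ t in Ioo (0 : ℝ) 1, corr (productGrad Ω χ v g j) φ (t • z)) := by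
      intro j
      rw [integral_mul_conv (hki j) (hX j) hφ.continuous hC,
        integral_dilationMix_mul one_pos (hΦi j) (hΦc j) (hcc j) (hbd j)]
      simp only [neg_zero, Real.rpow_zero, one_mul]
      rw [integral_integral_swap]
      · refine integral_congr_ae (Eventually.of_forall fun z => ?_)
        simp only
        rw [integral_const_mul]; ring
      · refine Integrable.mul_bdd (c := (∫ y, ‖productGrad Ω χ v g j y‖) * C)
          (f := fun p : ℝ × E n => p.2 j * M p.2)
          (g := fun p : ℝ × E n => corr (productGrad Ω χ v g j) φ (p.1 • p.2)) ?_
          (Continuous.aestronglyMeasurable (by fun_prop)) (Eventually.of_forall fun p => hbd j _)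
        exact (hΦi j).comp_snd (volume.restrict (Ioo (0 : ℝ) 1))
    have hI : ∀ j, Integrable fun z : E n =>
        M z * (z j * ∫ t in Ioo (0 : ℝ) 1, corr (productGrad Ω χ v g j) φ (t • z)) := by
      intro j
      have h1 : Continuous fun z : E n =>
          ∫ t in Ioo (0 : ℝ) 1, corr (productGrad Ω χ v g j) φ (t • z) := by
        refine continuous_of_dominated (bound := fun _ => (∫ y, ‖productGrad Ω χ v g j y‖) * C)
          (fun z => Continuous.aestronglyMeasurable (by fun_prop))
          (fun z => Eventually.of_forall fun t => hbd j _) (integrable_const _)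
          (Eventually.of_forall fun t => by fun_prop)
      exact Continuous.integrable_of_hasCompactSupport (by fun_prop) hMc.mul_right
    have hVc : Continuous (corr V φ) := continuous_corr hV hφ.continuous hC
    have hMV : Integrable fun z => M z * corr V φ z :=
      Continuous.integrable_of_hasCompactSupport (by fun_prop) hMc.mul_right
    -- Weighting the segment formula by `M`, which is supported in the cone directions; integrating
    -- afterwards uses `∫ M = 1`.
    have h5 : ∀ z, M z * corr V φ z + ∑ j, M z * (z j *
        ∫ t in Ioo (0 : ℝ) 1, corr (productGrad Ω χ v g j) φ (t • z)) = M z * corr V φ 0 := by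
      intro z
      by_cases hz : M z = 0
      · simp [hz]
      · have := hftc z (hMs hz)
        rw [← Finset.mul_sum, ← mul_add]
        congr 1
        linarith
    have i1 : Integrable fun x => φ x * conv M V x :=
      (integrable_conv hMi hV).bdd_mul (c := C) hφ.continuous.aestronglyMeasurable
        (Eventually.of_forall hC)
    have i2 : ∀ j, Integrable fun x =>
        φ x * conv (dilationMix 0 fun z => z j * M z) (productGrad Ω χ v g j) x := fun j =>
      (integrable_conv (hki j) (hX j)).bdd_mul (c := C) hφ.continuous.aestronglyMeasurable
        (Eventually.of_forall hC)
    simp only [hR, mul_add, Finset.mul_sum]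
    rw [integral_add i1 (integrable_finsetSum _ fun j _ => i2 j),
      integral_finsetSum _ fun j _ => i2 j, integral_mul_conv hMi hV hφ.continuous hC]
    simp_rw [hk]
    rw [← integral_finsetSum _ fun j _ => hI j,
      ← integral_add hMV (integrable_finsetSum _ fun j _ => hI j)]
    simp_rw [h5]
    rw [integral_mul_const, hM1, one_mul, corr]
    simp only [add_zero, mul_comm]
  have h0 := Ω.isOpen.ae_eq_zero_of_integral_contDiff_smul_eq_zero (μ := volume)
    (f := fun x => R x - V x) ((hRi.sub hV).locallyIntegrable.locallyIntegrableOn _) (by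
      intro φ hφ hφc hφs
      obtain ⟨C, hC⟩ := hφ.continuous.bounded_above_of_compact_support hφc
      have i1 : Integrable fun x => φ x * R x := hRi.bdd_mul (c := C)
        hφ.continuous.aestronglyMeasurable (Eventually.of_forall hC)
      have i2 : Integrable fun x => φ x * V x := hV.bdd_mul (c := C)
        hφ.continuous.aestronglyMeasurable (Eventually.of_forall hC)
      simp only [smul_eq_mul, mul_sub]
      rw [integral_sub i1 i2, hmain φ hφ hφc hφs, sub_self])
  rw [ae_restrict_iff' Ω.isOpen.measurableSet]
  filter_upwards [h0] with x hx hxΩ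
  have h1 := hx hxΩ
  rw [sub_eq_zero, hVdef, indicator_of_mem hxΩ] at h1
  exact h1.symm

end representation

end NonlocalGradient

/-! ### Surjectivity: local factorization and patching. -/

namespace NonlocalGradient

open Set Filter Topology Metric

variable {n : ℕ} {s δ : ℝ} {w : E n → ℝ} {wbar : ℝ → ℝ}

section surjectivity

variable {Ω : Opens (E n)} {v χ : E n → ℝ} {g : E n → E n} {p : ℝ≥0∞}

theorem isTame_of_hasCompactSupport {f : E n → ℝ} (hf : ContDiff ℝ (⊤ : ℕ∞) f)
    (hc : HasCompactSupport f) : IsTame f := by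
  obtain ⟨R, hR⟩ := hc.isCompact.isBounded.subset_closedBall 0
  have h0 : ∀ x, |R| + 1 ≤ ‖x‖ → f x = 0 := fun x hx => by
    by_contra h
    have := hR (subset_tsupport f h)
    rw [mem_closedBall_zero_iff] at this
    linarith [le_abs_self R]
  refine ⟨hf, |R| + 1, by positivity, 0, le_rfl, fun t ht x hx => ?_⟩
  rw [h0 x hx, smul_zero, h0]
  rw [norm_smul, Real.norm_of_nonneg (by linarith)]
  nlinarith [norm_nonneg x]

theorem memLp_of_bounded {U : Set (E n)} (hU : Bornology.IsBounded U) {f : E n → ℝ}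
    (hf : Continuous f) {C : ℝ} (hC : ∀ x, |f x| ≤ C) : MemLp f p (volume.restrict U) := by
  have : Fact (volume U < ∞) := ⟨hU.measure_lt_top⟩
  exact MemLp.of_bound hf.aestronglyMeasurable C (Eventually.of_forall hC)

/-- In the integral representation the mollified term is smooth, and each kernel is a dilation
mixture of `z_j M(z)`, hence factors through `Q` up to a smooth error. Young's inequality keeps the
resulting densities in `L^p`; their integrability is recorded as well, since `p` may exceed `1`. -/
theorem HasWeakGrad.exists_local (hw : IsCutoff δ w wbar) (hδ : 0 < δ) (hn : 1 ≤ n)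
    (hs0 : 0 < s) (hs1 : s < 1) (hp : 1 ≤ p) (hΩ : Bornology.IsBounded (Ω : Set (E n)))
    (h : HasWeakGrad Ω v g) (hv : MemLp v p (volume.restrict (Ω : Set (E n))))
    (hg : MemLp g p (volume.restrict (Ω : Set (E n))))
    (hχ : ContDiff ℝ (⊤ : ℕ∞) χ) (hχc : HasCompactSupport χ) {x₀ w₀ : E n} {r ε : ℝ}
    (hχs : tsupport χ ⊆ ball x₀ r) (hε : 0 < ε) (hr : ∀ z ∈ ball w₀ ε, ‖z‖ < r)
    (hcone : ∀ y ∈ Ω, y ∈ ball x₀ (2 * r) → ∀ z ∈ ball w₀ ε, ∀ t ∈ Icc (0 : ℝ) 1,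
      y - t • z ∈ Ω) :
    ∃ F U : E n → ℝ, ContDiff ℝ (⊤ : ℕ∞) F ∧ Integrable U ∧ MemLp U p ∧
      ∀ᵐ x ∂volume.restrict (Ω : Set (E n)), χ x * v x = F x + conv (Q s δ w wbar) U x := by
  have : Fact (volume (Ω : Set (E n)) < ∞) := ⟨hΩ.measure_lt_top⟩
  have hv1 : IntegrableOn v (Ω : Set (E n)) := hv.integrable hp
  have hg1 : IntegrableOn g (Ω : Set (E n)) := hg.integrable hp
  have hχ1 : ContDiff ℝ 1 χ := hχ.of_le (by exact_mod_cast le_top)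
  have hXp : ∀ j, MemLp (productGrad Ω χ v g j) p := fun j => memLp_productGrad hχ1 hχc hv hg j
  have hX : ∀ j, Integrable (productGrad Ω χ v g j) := fun j =>
    memLp_one_iff_integrable.1 (memLp_productGrad hχ1 hχc (memLp_one_iff_integrable.2 hv1)
      (memLp_one_iff_integrable.2 hg1) j)
  let b : ContDiffBump w₀ := ⟨ε / 2, ε, by positivity, by linarith⟩
  let M : E n → ℝ := b.normed volume
  have hM : ContDiff ℝ (⊤ : ℕ∞) M := b.contDiff_normed
  have hMc : HasCompactSupport M := b.hasCompactSupport_normed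
  have hrep := h.ae_mul_eq hv1 hg1 hχ hχc hχs hr hcone hM.continuous hMc
    (b.support_normed_eq (μ := volume)).subset (b.integral_normed (μ := volume))
  have hΦ : ∀ j, ContDiff ℝ (⊤ : ℕ∞) fun z : E n => z j * M z := fun j => by fun_prop
  choose G hG hGf using fun j : Fin n => exists_conv_dilationMix_eq hw hδ hn hs0 hs1 (hΦ j)
    (hMc.mul_left (f := fun z : E n => z j))
  choose f hf hfe using fun j => hGf j _ (hX j)
  obtain ⟨D, hD⟩ := hχ.continuous.bounded_above_of_compact_support hχc
  have hV : Integrable ((Ω : Set (E n)).indicator fun y => χ y * v y) :=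
    (integrable_indicator_iff Ω.isOpen.measurableSet).2
      (hv1.bdd_mul (c := D) hχ.continuous.aestronglyMeasurable (Eventually.of_forall hD))
  have hsm := contDiff_integral_smul_sub hV (isTame_of_hasCompactSupport hM hMc)
  have hGX : ∀ j, Integrable (conv (G j) (productGrad Ω χ v g j)) := fun j =>
    integrable_conv (hG j) (hX j)
  refine ⟨fun x => conv M ((Ω : Set (E n)).indicator fun y => χ y * v y) x + ∑ j, f j x,
    fun x => ∑ j, conv (G j) (productGrad Ω χ v g j) x, ?_,
    integrable_finsetSum _ fun j _ => hGX j,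
    memLp_finsetSum _ fun j _ => memLp_conv hp (hG j) (hXp j), ?_⟩
  · refine ContDiff.add ?_ (ContDiff.sum fun j _ => hf j)
    simp only [smul_eq_mul, mul_comm _ (M _)] at hsm
    exact hsm
  · have hQ := integrable_Q hw hδ hn hs0 hs1
    have hall : ∀ᵐ x, ∀ j, conv (dilationMix 0 fun z => z j * M z) (productGrad Ω χ v g j) x =
        conv (Q s δ w wbar) (conv (G j) (productGrad Ω χ v g j)) x + f j x := ae_all_iff.2 hfe
    have hint : ∀ᵐ x, ∀ j, Integrable fun y =>
        Q s δ w wbar (x - y) * conv (G j) (productGrad Ω χ v g j) y :=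
      ae_all_iff.2 fun j => ae_integrable_conv_integrand hQ (hGX j)
    filter_upwards [hrep, ae_restrict_of_ae hall, ae_restrict_of_ae hint] with x h1 h2 h3
    have h4 : conv (Q s δ w wbar) (fun x => ∑ j, conv (G j) (productGrad Ω χ v g j) x) x =
        ∑ j, conv (Q s δ w wbar) (conv (G j) (productGrad Ω χ v g j)) x := by
      rw [conv]
      simp_rw [Finset.mul_sum]
      exact integral_finsetSum _ fun j _ => h3 j
    rw [h1, h4, Finset.sum_congr rfl fun j _ => h2 j, Finset.sum_add_distrib]
    ring

/-- A partition of unity adapted to the interior cones of a bounded Lipschitz domain. -/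
theorem IsBoundedLipschitzDomain.exists_partition (hΩ : IsBoundedLipschitzDomain Ω) :
    ∃ (ι : Type) (_ : Fintype ι) (χ : ι → E n → ℝ),
      (∀ x ∈ Ω, ∑ i, χ i x = 1) ∧ ∀ i, ContDiff ℝ (⊤ : ℕ∞) (χ i) ∧ HasCompactSupport (χ i) ∧
        ∃ (x₀ w₀ : E n) (r ε : ℝ), tsupport (χ i) ⊆ ball x₀ r ∧ 0 < ε ∧
          (∀ z ∈ ball w₀ ε, ‖z‖ < r) ∧
          ∀ y ∈ Ω, y ∈ ball x₀ (2 * r) → ∀ z ∈ ball w₀ ε, ∀ t ∈ Icc (0 : ℝ) 1, y - t • z ∈ Ω := by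
  choose! r hr w₀ ε hε hzr hcone using fun x₀ (hx₀ : x₀ ∈ closure (Ω : Set (E n))) =>
    hΩ.exists_cone hx₀
  have hcpt : IsCompact (closure (Ω : Set (E n))) := hΩ.bounded.isCompact_closure
  obtain ⟨T, hTc⟩ := hcpt.elim_nhds_subcover' (fun x _ => ball x (r x))
    (fun x hx => ball_mem_nhds x (hr x hx))
  obtain ⟨f, hf⟩ := SmoothPartitionOfUnity.exists_isSubordinate (modelWithCornersSelf ℝ (E n))
    isClosed_closure (fun i : T => ball (i : closure (Ω : Set (E n))).1 (r i.1.1))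
    (fun _ => isOpen_ball) (fun x hx => by simpa using hTc hx)
  refine ⟨T, inferInstance, fun i x => f i x, fun x hx => ?_, fun i => ⟨(f i).contMDiff.contDiff, ?_,
    i.1.1, w₀ i.1.1, r i.1.1, ε i.1.1, hf i, hε _ i.1.2, hzr _ i.1.2, hcone _ i.1.2⟩⟩
  · rw [← finsum_eq_sum_of_fintype]
    exact f.sum_eq_one (subset_closure hx)
  · exact HasCompactSupport.of_support_subset_isCompact (isCompact_closedBall i.1.1 (r i.1.1))
      ((subset_tsupport _).trans ((hf i).trans ball_subset_closedBall))

/-- `Q` vanishes outside the ball of radius `δ`, so at points of `Ω` only the values on `Ω_δ`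
matter. -/
theorem conv_Q_eq_convQ (hw : IsCutoff δ w wbar) (hδ : 0 < δ) (u : E n → ℝ) {x : E n} (hx : x ∈ Ω) :
    conv (Q s δ w wbar) u x = convQ s δ w wbar Ω u x := by
  rw [conv, convQ, setIntegral_eq_integral_of_forall_compl_eq_zero]
  intro y hy
  rw [Q_eq_zero hw hδ, zero_mul]
  by_contra! h
  exact hy (mem_thickening_iff.2 ⟨x, hx, by rwa [dist_comm, dist_eq_norm]⟩)

/-- Every function with weak gradient in `Lᵖ` is of the form `Q * u` with `u ∈ Lᵖ`. -/
theorem HasWeakGrad.exists_convQ_ae_eq (hw : IsCutoff δ w wbar) (hδ : 0 < δ) (hn : 1 ≤ n)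
    (hs0 : 0 < s) (hs1 : s < 1) (hp : 1 ≤ p) (hΩ : IsBoundedLipschitzDomain Ω)
    (h : HasWeakGrad Ω v g) (hv : MemLp v p (volume.restrict (Ω : Set (E n))))
    (hg : MemLp g p (volume.restrict (Ω : Set (E n)))) :
    ∃ u : E n → ℝ, MemLp u p (volume.restrict (enlarge δ Ω)) ∧
      v =ᵐ[volume.restrict (Ω : Set (E n))] convQ s δ w wbar Ω u := by
  obtain ⟨ι, _, χ, hχ1, hχ⟩ := hΩ.exists_partition
  choose hχs hχc x₀ w₀ r ε hsub hε hr hcone using hχ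
  choose F U hF hU hUp hFU using fun i => h.exists_local hw hδ hn hs0 hs1 hp hΩ.bounded hv hg
    (hχs i) (hχc i) (hsub i) (hε i) (hr i) (hcone i)
  obtain ⟨R, hR⟩ := hΩ.bounded.subset_closedBall (0 : E n)
  -- The smooth remainders need not have compact support. Multiplying by a bump equal to `1` on `Ω`
  -- makes the Fourier solution available without changing anything on `Ω`.
  let η : ContDiffBump (0 : E n) := ⟨|R| + 1, |R| + 2, by positivity, by linarith⟩
  have hη : ∀ x ∈ Ω, η x = 1 := fun x hx => η.one_of_mem_closedBall
    (closedBall_subset_closedBall (by simp only [η]; linarith [le_abs_self R]) (hR hx))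
  obtain ⟨u₀, hu₀, ⟨C, hC⟩, hQu₀⟩ := exists_integral_Q_mul_eq (s := s) hw hδ hn hs0 hs1
    (f := fun x => η x * ∑ i, F i x) (η.contDiff.mul (ContDiff.sum fun i _ => hF i))
    η.hasCompactSupport.mul_right
  have hQ := integrable_Q hw hδ hn hs0 hs1
  have hUi : Integrable fun x => ∑ i, U i x := integrable_finsetSum _ fun i _ => hU i
  refine ⟨fun x => u₀ x + ∑ i, U i x, (memLp_of_bounded ?_ hu₀ hC).add
    (memLp_finsetSum _ fun i _ => (hUp i).restrict _), ?_⟩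
  · exact hΩ.bounded.thickening
  · have hint : ∀ᵐ x, ∀ i, Integrable fun y => Q s δ w wbar (x - y) * U i y :=
      ae_all_iff.2 fun i => ae_integrable_conv_integrand hQ (hU i)
    filter_upwards [ae_all_iff.2 hFU, ae_restrict_of_ae hint, ae_restrict_mem Ω.isOpen.measurableSet]
      with x h1 h2 hx
    rw [← conv_Q_eq_convQ hw hδ _ hx, conv]
    have h3 : Integrable fun y => Q s δ w wbar (x - y) * u₀ y :=
      (hQ.comp_sub_left x).mul_bdd (c := C) hu₀.aestronglyMeasurable (Eventually.of_forall hC)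
    simp_rw [mul_add, Finset.mul_sum]
    rw [integral_add h3 (integrable_finsetSum _ fun i _ => h2 i), hQu₀, hη x hx, one_mul,
      integral_finsetSum _ fun i _ => h2 i, ← Finset.sum_add_distrib]
    have h4 : v x = ∑ i, χ i x * v x := by rw [← Finset.sum_mul, hχ1 x hx, one_mul]
    rw [h4]
    exact Finset.sum_congr rfl fun i _ => h1 i

end surjectivity

end NonlocalGradient

/-! ### Functions with vanishing weak gradient. -/

namespace NonlocalGradient

open Set Filter Topology Metric

variable {n : ℕ} {s δ : ℝ} {w : E n → ℝ} {wbar : ℝ → ℝ}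

section constancy

variable {Ω : Opens (E n)} {v : E n → ℝ}

/-- The derivative of `t ↦ corr V φ (t z)` pairs `v` with the derivative of a translated test
function. It vanishes as long as the translate remains supported in `Ω`. -/
theorem HasWeakGrad.corr_eq (h : HasWeakGrad Ω v 0) (hv : IntegrableOn v (Ω : Set (E n)))
    {φ : E n → ℝ} (hφ : ContDiff ℝ (⊤ : ℕ∞) φ) (hφc : HasCompactSupport φ) {z : E n}
    (hsupp : ∀ t ∈ Icc (0 : ℝ) 1, ∀ y, y + t • z ∈ tsupport φ → y ∈ Ω) :
    corr ((Ω : Set (E n)).indicator v) φ z = corr ((Ω : Set (E n)).indicator v) φ 0 := by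
  have hV : Integrable ((Ω : Set (E n)).indicator v) :=
    (integrable_indicator_iff Ω.isOpen.measurableSet).2 hv
  have hd : ∀ t ∈ uIcc (0 : ℝ) 1,
      HasDerivAt (fun t : ℝ => corr ((Ω : Set (E n)).indicator v) φ (t • z)) 0 t := by
    intro t ht
    rw [uIcc_of_le zero_le_one] at ht
    have h1 := hasDerivAt_corr hV (hφ.of_le (by exact_mod_cast le_top)) hφc z t
    have hts : tsupport (fun y => φ (y + t • z)) ⊆ (Ω : Set (E n)) := fun y hy =>
      hsupp t ht y (tsupport_comp_subset_preimage φ (f := fun y => y + t • z) (by fun_prop) hy)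
    let θ : 𝓓(Ω, ℝ) := ⟨fun y => φ (y + t • z), hφ.comp (contDiff_id.add contDiff_const),
      hφc.comp_homeomorph (Homeomorph.addRight (t • z)), hts⟩
    have h2 := h.integral_mul_fderiv hv integrableOn_zero θ z
    have h3 : ∀ y, fderiv ℝ θ y = fderiv ℝ φ (y + t • z) := fun y => fderiv_comp_add_right _
    simp only [h3, Pi.zero_apply, inner_zero_right, mul_zero, integral_zero, neg_zero] at h2
    rw [← integral_indicator Ω.isOpen.measurableSet] at h2
    convert h1 using 1
    rw [← h2]
    refine integral_congr_ae (Eventually.of_forall fun y => ?_)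
    by_cases hy : y ∈ (Ω : Set (E n))
    · simp only [indicator_of_mem hy]
    · simp only [indicator_of_notMem hy, zero_mul]
  have h4 := intervalIntegral.integral_eq_sub_of_hasDerivAt hd (by simp)
  rw [intervalIntegral.integral_zero, one_smul, zero_smul] at h4
  linarith

/-- A single mollification suffices. By translation invariance of the correlations, `M * V` is
constant on the small ball, and it also agrees there with `V` when tested; no limit in the mollifier
is needed. -/
theorem HasWeakGrad.exists_ball_ae_eq_const (h : HasWeakGrad Ω v 0)
    (hv : IntegrableOn v (Ω : Set (E n))) {x₀ : E n} (hx₀ : x₀ ∈ Ω) :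
    ∃ ρ > 0, ball x₀ ρ ⊆ Ω ∧ ∃ c : ℝ, ∀ᵐ x, x ∈ ball x₀ ρ → v x = c := by
  obtain ⟨R, hR, hb⟩ := Metric.isOpen_iff.1 Ω.isOpen x₀ hx₀
  set ρ := R / 3 with hρ
  have hρ0 : 0 < ρ := by positivity
  have hρR : ball x₀ ρ ⊆ Ω := (ball_subset_ball (by linarith)).trans hb
  set V := (Ω : Set (E n)).indicator v with hVdef
  have hV : Integrable V := (integrable_indicator_iff Ω.isOpen.measurableSet).2 hv
  let b : ContDiffBump (0 : E n) := ⟨ρ / 3, ρ / 2, by positivity, by linarith⟩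
  let M : E n → ℝ := b.normed volume
  have hM : ContDiff ℝ (⊤ : ℕ∞) M := b.contDiff_normed
  have hMc : HasCompactSupport M := b.hasCompactSupport_normed
  have hMs : tsupport M ⊆ closedBall 0 (ρ / 2) := (b.tsupport_normed_eq (μ := volume)).subset
  have hMi : Integrable M := hM.continuous.integrable_of_hasCompactSupport hMc
  have htn : ∀ t ∈ Icc (0 : ℝ) 1, ∀ z : E n, ‖t • z‖ ≤ ‖z‖ := fun t ht z => by
    rw [norm_smul, Real.norm_of_nonneg ht.1]
    exact mul_le_of_le_one_left (norm_nonneg _) ht.2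
  have hconst : ∀ x ∈ ball x₀ ρ, conv M V x = conv M V x₀ := by
    intro x hx
    have h1 := h.corr_eq hv (φ := fun y => M (x - y)) (z := x - x₀)
      (hM.comp (contDiff_const.sub contDiff_id)) (hMc.comp_homeomorph (Homeomorph.subLeft x)) (by
        intro t ht y hy
        have hy1 := hMs (tsupport_comp_subset_preimage M (f := fun y => x - y) (by fun_prop) hy)
        rw [mem_closedBall_zero_iff] at hy1
        rw [mem_ball, dist_eq_norm] at hx
        apply hb
        rw [mem_ball, dist_eq_norm]
        have h2 := htn (1 - t) ⟨by linarith [ht.2], by linarith [ht.1]⟩ (x - x₀)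
        calc ‖y - x₀‖ = ‖(1 - t) • (x - x₀) - (x - (y + t • (x - x₀)))‖ := by congr 1; module
          _ ≤ ‖(1 - t) • (x - x₀)‖ + ‖x - (y + t • (x - x₀))‖ := norm_sub_le _ _
          _ < R := by linarith)
    simp only [corr, add_zero] at h1
    simp only [conv, mul_comm (M _)]
    rw [← h1]
    refine integral_congr_ae (Eventually.of_forall fun y => ?_)
    simp only
    congr 2
    abel
  have hrep : ∀ φ : E n → ℝ, ContDiff ℝ (⊤ : ℕ∞) φ → HasCompactSupport φ →
      tsupport φ ⊆ ball x₀ ρ → ∫ x, φ x * conv M V x = ∫ x, φ x * V x := by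
    intro φ hφ hφc hφs
    obtain ⟨C, hC⟩ := hφ.continuous.bounded_above_of_compact_support hφc
    rw [integral_mul_conv hMi hV hφ.continuous hC]
    have h1 : ∀ z, M z * corr V φ z = M z * corr V φ 0 := by
      intro z
      by_cases hz : M z = 0
      · simp [hz]
      · have hz1 := hMs (subset_tsupport _ hz)
        rw [mem_closedBall_zero_iff] at hz1
        rw [hVdef, h.corr_eq hv hφ hφc (z := z)]
        intro t ht y hy
        have hy1 := hφs hy
        rw [mem_ball, dist_eq_norm] at hy1
        apply hb
        rw [mem_ball, dist_eq_norm]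
        have h2 := htn t ht z
        calc ‖y - x₀‖ = ‖(y + t • z - x₀) - t • z‖ := by congr 1; abel
          _ ≤ ‖y + t • z - x₀‖ + ‖t • z‖ := norm_sub_le _ _
          _ < R := by linarith
    simp_rw [h1]
    rw [integral_mul_const, b.integral_normed, one_mul, corr]
    simp only [add_zero, mul_comm]
  have hCi := integrable_conv hMi hV
  have h0 := isOpen_ball.ae_eq_zero_of_integral_contDiff_smul_eq_zero (μ := volume)
    (U := ball x₀ ρ) (f := fun x => conv M V x - V x)
    ((hCi.sub hV).locallyIntegrable.locallyIntegrableOn _) (by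
      intro φ hφ hφc hφs
      obtain ⟨C, hC⟩ := hφ.continuous.bounded_above_of_compact_support hφc
      have i1 : Integrable fun x => φ x * conv M V x := hCi.bdd_mul (c := C)
        hφ.continuous.aestronglyMeasurable (Eventually.of_forall hC)
      have i2 : Integrable fun x => φ x * V x := hV.bdd_mul (c := C)
        hφ.continuous.aestronglyMeasurable (Eventually.of_forall hC)
      simp only [smul_eq_mul, mul_sub]
      rw [integral_sub i1 i2, hrep φ hφ hφc hφs, sub_self])
  refine ⟨ρ, hρ0, hρR, conv M V x₀, ?_⟩
  filter_upwards [h0] with x hx hxb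
  have h1 := hx hxb
  rw [sub_eq_zero, hVdef, indicator_of_mem (hρR hxb), ← hVdef] at h1
  rw [← h1, hconst x hxb]

/-- A function with vanishing weak gradient on a connected open set is constant. -/
theorem HasWeakGrad.ae_eq_const (h : HasWeakGrad Ω v 0) (hv : IntegrableOn v (Ω : Set (E n)))
    (hΩ : IsConnected (Ω : Set (E n))) :
    ∃ c : ℝ, v =ᵐ[volume.restrict (Ω : Set (E n))] fun _ => c := by
  choose ρ hρ hsub c hc using fun x : (Ω : Set (E n)) => h.exists_ball_ae_eq_const hv x.2
  -- The local constants agree for nearby centres because the balls overlap in a nonempty open set,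
  -- which has positive measure.
  have hlc : IsLocallyConstant c := by
    rw [IsLocallyConstant.iff_eventually_eq]
    intro x
    filter_upwards [isOpen_induced_iff.2 ⟨_, isOpen_ball, rfl⟩ |>.mem_nhds
      (show x ∈ Subtype.val ⁻¹' ball x.1 (ρ x) from mem_ball_self (hρ x))] with y hy
    by_contra hne
    have h1 : volume (ball x.1 (ρ x) ∩ ball y.1 (ρ y)) = 0 := by
      refine measure_mono_null ?_ (ae_iff.1 ((hc x).and (hc y)))
      rintro z ⟨hz1, hz2⟩ ⟨h2, h3⟩
      exact hne ((h3 hz2).symm.trans (h2 hz1))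
    exact ((isOpen_ball.inter isOpen_ball).measure_pos volume ⟨y.1, hy, mem_ball_self (hρ y)⟩).ne' h1
  have : PreconnectedSpace (Ω : Set (E n)) := isPreconnected_iff_preconnectedSpace.1 hΩ.isPreconnected
  obtain ⟨x₁, hx₁⟩ := hΩ.nonempty
  refine ⟨c ⟨x₁, hx₁⟩, ?_⟩
  rw [EventuallyEq, ae_restrict_iff' Ω.isOpen.measurableSet, ae_iff]
  refine measure_null_of_locally_null _ fun x hx => ?_
  have hxΩ : x ∈ (Ω : Set (E n)) := by
    by_contra hx'
    exact hx fun h => absurd h hx'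
  refine ⟨{y | ¬(y ∈ ball x (ρ ⟨x, hxΩ⟩) → v y = c ⟨x, hxΩ⟩)}, ?_, ae_iff.1 (hc ⟨x, hxΩ⟩)⟩
  filter_upwards [self_mem_nhdsWithin, mem_nhdsWithin_of_mem_nhds (ball_mem_nhds x (hρ ⟨x, hxΩ⟩))]
    with y hy hyb
  rw [Classical.not_imp] at hy ⊢
  exact ⟨hyb, by rw [hlc.apply_eq_of_preconnectedSpace ⟨x, hxΩ⟩ ⟨x₁, hx₁⟩]; exact hy.2⟩

end constancy

/-! ### Nonlocal gradient of `u` versus gradient of `Q * u`. -/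

section equivalence

theorem continuous_conv {K φ : E n → ℝ} (hK : Integrable K) (hφ : Continuous φ) {C : ℝ}
    (hC : ∀ x, |φ x| ≤ C) : Continuous (conv K φ) ∧ ∀ x, |conv K φ x| ≤ (∫ z, ‖K z‖) * C := by
  have h1 : conv K φ = fun x => corr K (fun y => φ (-y)) (-x) := by
    ext x
    rw [conv, corr, ← integral_sub_left_eq_self _ volume x]
    simp [sub_eq_add_neg]
  rw [h1]
  exact ⟨(continuous_corr hK (by fun_prop) fun x => hC _).comp continuous_neg,
    fun x => abs_corr_le hK (fun x => hC _) _⟩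

theorem integral_mul_conv_comm {K X φ : E n → ℝ} (hK : Integrable K) (hKe : ∀ x, K (-x) = K x)
    (hX : Integrable X) (hφ : Continuous φ) {C : ℝ} (hC : ∀ x, |φ x| ≤ C) :
    ∫ x, φ x * conv K X x = ∫ x, X x * conv K φ x := by
  rw [integral_mul_conv hK hX hφ hC]
  have h2 : Integrable (fun p : E n × E n => K p.1 * X p.2 * φ (p.2 + p.1))
      (volume.prod volume) :=
    (hK.mul_prod hX).mul_bdd (c := C) (Continuous.aestronglyMeasurable (by fun_prop))
      (Eventually.of_forall fun p => hC _)
  simp_rw [corr, ← integral_const_mul, ← mul_assoc]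
  rw [integral_integral_swap h2]
  refine integral_congr_ae (Eventually.of_forall fun x => ?_)
  simp only [conv]
  rw [← integral_const_mul, ← integral_sub_right_eq_self (fun z => K z * X x * φ (x + z)) x]
  refine integral_congr_ae (Eventually.of_forall fun y => ?_)
  simp only [add_sub_cancel]
  rw [← hKe (x - y), neg_sub]
  ring

variable {Ω : Opens (E n)} {u : E n → ℝ} {v : E n → E n}

theorem convQ_eq_conv_indicator (x : E n) : convQ s δ w wbar Ω u x =
    conv (Q s δ w wbar) ((enlarge δ Ω).indicator u) x := by
  rw [convQ, conv, ← integral_indicator isOpen_thickening.measurableSet]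
  refine integral_congr_ae (Eventually.of_forall fun y => ?_)
  by_cases hy : y ∈ enlarge δ Ω
  · simp only [indicator_of_mem hy]
  · simp only [indicator_of_notMem hy, mul_zero]

theorem divergence_eq_zero {ψ : E n → E n} {x : E n} (hx : x ∉ tsupport ψ) : divergence ψ x = 0 := by
  have : fderiv ℝ ψ x = 0 := by
    by_contra h
    exact hx (support_fderiv_subset ℝ h)
  simp [divergence, this]

/-- The nonlocal divergence is `Q * div ψ`, and convolution with the even kernel `Q` can be moved to
`u`. Boundedness of `Q * div ψ` provides the absolute convergence demanded in the weak formulation.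
-/
theorem integral_mul_nonlocalDiv (hw : IsCutoff δ w wbar) (hδ : 0 < δ) (hn : 1 ≤ n) (hs0 : 0 < s)
    (hs1 : s < 1) (hu : IntegrableOn u (enlarge δ Ω)) (ψ : 𝓓(Ω, E n)) :
    IntegrableOn (fun x => u x * nonlocalDiv s δ w ψ x) (enlarge δ Ω) ∧
    ∫ x in enlarge δ Ω, u x * nonlocalDiv s δ w ψ x =
      ∫ x in (Ω : Set (E n)), convQ s δ w wbar Ω u x * divergence ψ x := by
  have hQ := integrable_Q hw hδ hn hs0 hs1
  have hU : Integrable ((enlarge δ Ω).indicator u) :=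
    (integrable_indicator_iff isOpen_thickening.measurableSet).2 hu
  have hψ1 : ContDiff ℝ 1 ψ := ψ.contDiff.of_le (by exact_mod_cast le_top)
  have hdc : Continuous (divergence ψ) := continuous_divergence hψ1
  have hds : HasCompactSupport (divergence ψ) := HasCompactSupport.intro
    ψ.hasCompactSupport fun x hx => divergence_eq_zero hx
  obtain ⟨C, hC⟩ := hdc.bounded_above_of_compact_support hds
  have hdiv : nonlocalDiv s δ w ψ = conv (Q s δ w wbar) (divergence ψ) := by
    ext x
    rw [nonlocalDiv_eq hw hδ hn hs0 hs1 hψ1, conv, ← integral_sub_left_eq_self _ volume x]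
    simp
  obtain ⟨hcc, hcb⟩ := continuous_conv hQ hdc hC
  constructor
  · rw [hdiv]
    exact hu.mul_bdd hcc.aestronglyMeasurable (Eventually.of_forall hcb)
  · have h1 := integral_mul_conv_comm hQ (fun x => Q_neg x) hU hdc hC
    rw [hdiv, ← integral_indicator isOpen_thickening.measurableSet,
      setIntegral_eq_integral_of_forall_compl_eq_zero (s := (Ω : Set (E n)))
      (fun x hx => by rw [divergence_eq_zero fun h => hx (ψ.tsupport_subset h), mul_zero])]
    simp_rw [convQ_eq_conv_indicator, mul_comm _ (divergence ψ _)]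
    rw [h1]
    refine integral_congr_ae (Eventually.of_forall fun y => ?_)
    by_cases hy : y ∈ enlarge δ Ω
    · simp only [indicator_of_mem hy]
    · simp only [indicator_of_notMem hy, zero_mul]

theorem integrableOn_convQ (hw : IsCutoff δ w wbar) (hδ : 0 < δ) (hn : 1 ≤ n) (hs0 : 0 < s)
    (hs1 : s < 1) (hu : IntegrableOn u (enlarge δ Ω)) :
    IntegrableOn (convQ s δ w wbar Ω u) (Ω : Set (E n)) := by
  rw [show convQ s δ w wbar Ω u = _ from funext fun x => convQ_eq_conv_indicator x]
  exact (integrable_conv (integrable_Q hw hδ hn hs0 hs1)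
    ((integrable_indicator_iff isOpen_thickening.measurableSet).2 hu)).integrableOn

/-- The weak nonlocal gradient of `u` is the weak gradient of `Q * u`. -/
theorem hasWeakNonlocalGrad_iff (hw : IsCutoff δ w wbar) (hδ : 0 < δ) (hn : 1 ≤ n) (hs0 : 0 < s)
    (hs1 : s < 1) (hu : IntegrableOn u (enlarge δ Ω)) (hv : IntegrableOn v (Ω : Set (E n))) :
    HasWeakNonlocalGrad s δ w Ω u v ↔ HasWeakGrad Ω (convQ s δ w wbar Ω u) v := by
  have hf := integrableOn_convQ hw hδ hn hs0 hs1 hu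
  constructor
  · intro h φ
    refine ext_inner_left ℝ fun z => ?_
    have hc : Continuous (gradient φ) :=
      (InnerProductSpace.toDual ℝ (E n)).symm.continuous.comp
        (φ.contDiff.continuous_fderiv (by simp))
    have hs : HasCompactSupport (gradient φ) :=
      (φ.hasCompactSupport.fderiv (𝕜 := ℝ)).comp_left (map_zero _)
    obtain ⟨C, hC⟩ := hc.bounded_above_of_compact_support hs
    obtain ⟨C', hC'⟩ := φ.continuous.bounded_above_of_compact_support φ.hasCompactSupport
    have h1 : IntegrableOn (fun x => convQ s δ w wbar Ω u x • gradient φ x) (Ω : Set (E n)) :=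
      Integrable.smul_bdd hf C hc.aestronglyMeasurable (Eventually.of_forall hC)
    have h2 : IntegrableOn (fun x => φ x • v x) (Ω : Set (E n)) :=
      Integrable.bdd_smul hv C' φ.continuous.aestronglyMeasurable (Eventually.of_forall hC')
    rw [inner_neg_right, ← integral_inner h1, ← integral_inner h2]
    -- Fields of the form `φ z` with constant `z` recover the component of the weak gradient
    -- identity along `z`.
    let ψ : 𝓓(Ω, E n) := ⟨fun x => φ x • z, φ.contDiff.smul contDiff_const,
      φ.hasCompactSupport.smul_right,
      (closure_mono (Function.support_smul_subset_left _ _)).trans φ.tsupport_subset⟩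
    have hd : ∀ x, divergence ψ x = inner ℝ z (gradient φ x) := fun x => by
      have h3 : HasFDerivAt ψ ((fderiv ℝ φ x).smulRight z) x :=
        ((φ.contDiff.differentiable (by simp) x).hasFDerivAt).smul_const z
      rw [real_inner_comm, gradient, InnerProductSpace.toDual_symm_apply, clm_apply_eq_sum,
        divergence, h3.fderiv]
      exact Finset.sum_congr rfl fun i _ => by simp [mul_comm]
    have h4 := (h ψ).2
    rw [(integral_mul_nonlocalDiv hw hδ hn hs0 hs1 hu ψ).2] at h4
    simp only [hd] at h4
    simp only [inner_smul_right]
    rw [← neg_eq_iff_eq_neg, ← h4]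
    refine integral_congr_ae (Eventually.of_forall fun x => ?_)
    change inner ℝ (v x) (φ x • z) = _
    rw [inner_smul_right, real_inner_comm]
  · intro h ψ
    obtain ⟨hi, he⟩ := integral_mul_nonlocalDiv (wbar := wbar) hw hδ hn hs0 hs1 hu ψ
    refine ⟨hi, ?_⟩
    rw [he]
    have hψ1 : ContDiff ℝ 1 ψ := ψ.contDiff.of_le (by exact_mod_cast le_top)
    -- Conversely, a general field is tested component by component, and the scalar identities are
    -- summed.
    let θ : Fin n → 𝓓(Ω, ℝ) := fun i => ⟨fun x => ψ x i, by have := ψ.contDiff; fun_prop,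
      ψ.hasCompactSupport.comp_left (g := fun y : E n => y i) rfl,
      (closure_mono fun x hx => by
        contrapose! hx
        simp only [Function.mem_support, not_not] at hx ⊢
        simp [hx]).trans ψ.tsupport_subset⟩
    have hθ : ∀ i x, fderiv ℝ (θ i) x (EuclideanSpace.single i 1) =
        fderiv ℝ ψ x (EuclideanSpace.single i 1) i := fun i x => by
      have h3 : HasFDerivAt (θ i) ((EuclideanSpace.proj (𝕜 := ℝ) i).comp (fderiv ℝ ψ x)) x :=
        (EuclideanSpace.proj (𝕜 := ℝ) i).hasFDerivAt.comp x
          (hψ1.differentiable one_ne_zero x).hasFDerivAt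
      rw [h3.fderiv]
      rfl
    have hkey := fun i => h.integral_mul_fderiv hf hv (θ i) (EuclideanSpace.single i 1)
    have i1 : ∀ i, IntegrableOn (fun x => convQ s δ w wbar Ω u x *
        fderiv ℝ (θ i) x (EuclideanSpace.single i 1)) (Ω : Set (E n)) := fun i => by
      have hcf : Continuous (fderiv ℝ (θ i)) := (θ i).contDiff.continuous_fderiv (by simp)
      obtain ⟨C, hC⟩ := hcf.bounded_above_of_compact_support ((θ i).hasCompactSupport.fderiv (𝕜 := ℝ))
      refine hf.mul_bdd (c := C * ‖(EuclideanSpace.single i 1 : E n)‖) (by fun_prop)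
        (Eventually.of_forall fun x => ?_)
      exact (ContinuousLinearMap.le_opNorm _ _).trans (mul_le_mul_of_nonneg_right (hC x) (norm_nonneg _))
    have i2 : ∀ i, IntegrableOn (fun x => θ i x * inner ℝ (EuclideanSpace.single i 1) (v x))
        (Ω : Set (E n)) := fun i => by
      obtain ⟨C, hC⟩ := (θ i).continuous.bounded_above_of_compact_support (θ i).hasCompactSupport
      exact (hv.const_inner _).bdd_mul (c := C) (θ i).continuous.aestronglyMeasurable
        (Eventually.of_forall hC)
    have e1 : ∀ x, inner ℝ (v x) (ψ x) =
        ∑ i, θ i x * inner ℝ (EuclideanSpace.single i 1) (v x) := fun x => by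
      rw [inner_eq_sum]
      refine Finset.sum_congr rfl fun i _ => ?_
      rw [EuclideanSpace.inner_single_left]
      change v x i * ψ x i = ψ x i * _
      simp [mul_comm]
    have e2 : ∀ x, convQ s δ w wbar Ω u x * divergence ψ x = ∑ i, convQ s δ w wbar Ω u x *
        fderiv ℝ (θ i) x (EuclideanSpace.single i 1) := fun x => by
      rw [divergence, Finset.mul_sum]
      exact Finset.sum_congr rfl fun i _ => by rw [hθ]
    simp_rw [e1, e2]
    rw [integral_finsetSum _ fun i _ => i2 i, integral_finsetSum _ fun i _ => i1 i,
      ← Finset.sum_neg_distrib]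
    exact Finset.sum_congr rfl fun i _ => by rw [hkey i, neg_neg]

end equivalence

end NonlocalGradient

/-! ### The convolution as a linear map between the Sobolev spaces, and the theorem. -/

namespace NonlocalGradient

open Set Filter Topology Metric

variable {n : ℕ} {s δ : ℝ} {w : E n → ℝ} {wbar : ℝ → ℝ}

section assembly

variable {Ω : Opens (E n)} {p : ℝ≥0∞}

theorem HasWeakGrad.congr {f f' : E n → ℝ} {v : E n → E n} (h : HasWeakGrad Ω f v)
    (hf : f' =ᵐ[volume.restrict (Ω : Set (E n))] f) : HasWeakGrad Ω f' v := fun φ => by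
  rw [← h φ]
  refine integral_congr_ae ?_
  filter_upwards [hf] with x hx
  rw [hx]

theorem HasWeakGrad.congr_right {f : E n → ℝ} {v v' : E n → E n} (h : HasWeakGrad Ω f v)
    (hv : v' =ᵐ[volume.restrict (Ω : Set (E n))] v) : HasWeakGrad Ω f v' := fun φ => by
  rw [h φ]
  congr 1
  refine integral_congr_ae ?_
  filter_upwards [hv] with x hx
  rw [hx]

theorem convQ_congr {u u' : E n → ℝ} (h : u =ᵐ[volume.restrict (enlarge δ Ω)] u') :
    convQ s δ w wbar Ω u = convQ s δ w wbar Ω u' := by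
  ext x
  refine integral_congr_ae ?_
  filter_upwards [h] with y hy
  rw [hy]

theorem memLp_convQ (hw : IsCutoff δ w wbar) (hδ : 0 < δ) (hn : 1 ≤ n) (hs0 : 0 < s)
    (hs1 : s < 1) (hp : 1 ≤ p) {u : E n → ℝ} (hu : MemLp u p (volume.restrict (enlarge δ Ω))) :
    MemLp (convQ s δ w wbar Ω u) p (volume.restrict (Ω : Set (E n))) := by
  rw [show convQ s δ w wbar Ω u = _ from funext fun x => convQ_eq_conv_indicator x]
  exact (memLp_conv hp (integrable_Q hw hδ hn hs0 hs1)
    ((memLp_indicator_iff_restrict isOpen_thickening.measurableSet).2 hu)).restrict _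

theorem ae_convQ_add (hw : IsCutoff δ w wbar) (hδ : 0 < δ) (hn : 1 ≤ n) (hs0 : 0 < s)
    (hs1 : s < 1) {u u' : E n → ℝ} (hu : IntegrableOn u (enlarge δ Ω))
    (hu' : IntegrableOn u' (enlarge δ Ω)) :
    ∀ᵐ x, convQ s δ w wbar Ω (u + u') x = convQ s δ w wbar Ω u x + convQ s δ w wbar Ω u' x := by
  have hQ := integrable_Q hw hδ hn hs0 hs1
  have hm : MeasurableSet (enlarge δ Ω) := isOpen_thickening.measurableSet
  filter_upwards [ae_integrable_conv_integrand hQ ((integrable_indicator_iff hm).2 hu),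
    ae_integrable_conv_integrand hQ ((integrable_indicator_iff hm).2 hu')] with x h1 h2
  simp only [convQ_eq_conv_indicator, conv]
  rw [← integral_add h1 h2]
  simp only [indicator_add', Pi.add_apply, mul_add]

theorem convQ_smul (c : ℝ) (u : E n → ℝ) (x : E n) :
    convQ s δ w wbar Ω (c • u) x = c * convQ s δ w wbar Ω u x := by
  simp only [convQ, Pi.smul_apply, smul_eq_mul, mul_left_comm _ c]
  exact integral_const_mul _ _

variable [Fact (1 ≤ p)]

theorem integrableOn_Lp {F : Type*} [NormedAddCommGroup F] {U : Set (E n)}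
    (hU : Bornology.IsBounded U) (f : Lp F p (volume.restrict U)) : IntegrableOn f U := by
  have : Fact (volume U < ∞) := ⟨hU.measure_lt_top⟩
  exact (Lp.memLp f).integrable Fact.out

/-- The class of `Q * u` in `Lᵖ(Ω)`. -/
noncomputable def convQLp (hw : IsCutoff δ w wbar) (hδ : 0 < δ) (hn : 1 ≤ n) (hs0 : 0 < s)
    (hs1 : s < 1) (u : LpEnl p δ Ω) : LpΩ p Ω :=
  (memLp_convQ hw hδ hn hs0 hs1 Fact.out (Lp.memLp u)).toLp (convQ s δ w wbar Ω u)

theorem coeFn_convQLp (hw : IsCutoff δ w wbar) (hδ : 0 < δ) (hn : 1 ≤ n) (hs0 : 0 < s)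
    (hs1 : s < 1) (u : LpEnl p δ Ω) : (convQLp hw hδ hn hs0 hs1 u : E n → ℝ)
      =ᵐ[volume.restrict (Ω : Set (E n))] convQ s δ w wbar Ω u :=
  MemLp.coeFn_toLp (memLp_convQ hw hδ hn hs0 hs1 Fact.out (Lp.memLp u))

theorem convQLp_add (hw : IsCutoff δ w wbar) (hδ : 0 < δ) (hn : 1 ≤ n) (hs0 : 0 < s)
    (hs1 : s < 1) (hΩ : Bornology.IsBounded (Ω : Set (E n))) (u u' : LpEnl p δ Ω) :
    convQLp hw hδ hn hs0 hs1 (u + u') =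
      convQLp hw hδ hn hs0 hs1 u + convQLp hw hδ hn hs0 hs1 u' := by
  refine Lp.ext ?_
  filter_upwards [coeFn_convQLp hw hδ hn hs0 hs1 (u + u'), coeFn_convQLp hw hδ hn hs0 hs1 u,
    coeFn_convQLp hw hδ hn hs0 hs1 u',
    Lp.coeFn_add (convQLp hw hδ hn hs0 hs1 u) (convQLp hw hδ hn hs0 hs1 u'),
    ae_restrict_of_ae (ae_convQ_add (s := s) hw hδ hn hs0 hs1 (integrableOn_Lp hΩ.thickening u)
      (integrableOn_Lp hΩ.thickening u'))] with x h1 h2 h3 h4 h5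
  rw [h1, h4, Pi.add_apply, h2, h3, convQ_congr (Lp.coeFn_add u u'), h5]

theorem convQLp_smul (hw : IsCutoff δ w wbar) (hδ : 0 < δ) (hn : 1 ≤ n) (hs0 : 0 < s)
    (hs1 : s < 1) (c : ℝ) (u : LpEnl p δ Ω) :
    convQLp hw hδ hn hs0 hs1 (c • u) = c • convQLp hw hδ hn hs0 hs1 u := by
  refine Lp.ext ?_
  filter_upwards [coeFn_convQLp hw hδ hn hs0 hs1 (c • u), coeFn_convQLp hw hδ hn hs0 hs1 u,
    Lp.coeFn_smul c (convQLp hw hδ hn hs0 hs1 u)] with x h1 h2 h4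
  rw [h1, h4, Pi.smul_apply, h2, convQ_congr (Lp.coeFn_smul c u), convQ_smul, smul_eq_mul]

theorem HasWeakNonlocalGrad.hasWeakGrad_convQLp (hw : IsCutoff δ w wbar) (hδ : 0 < δ) (hn : 1 ≤ n)
    (hs0 : 0 < s) (hs1 : s < 1) (hΩ : Bornology.IsBounded (Ω : Set (E n))) {u : LpEnl p δ Ω}
    {v : LpVec p Ω} (h : HasWeakNonlocalGrad s δ w Ω u v) :
    HasWeakGrad Ω (convQLp hw hδ hn hs0 hs1 u) v :=
  ((hasWeakNonlocalGrad_iff hw hδ hn hs0 hs1 (integrableOn_Lp hΩ.thickening u)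
    (integrableOn_Lp hΩ v)).1 h).congr (coeFn_convQLp hw hδ hn hs0 hs1 u)

/-- The convolution with `Q`, as a linear map from the nonlocal Sobolev space to `W^{1,p}`. -/
noncomputable def convQMap (hw : IsCutoff δ w wbar) (hδ : 0 < δ) (hn : 1 ≤ n) (hs0 : 0 < s)
    (hs1 : s < 1) (hΩ : Bornology.IsBounded (Ω : Set (E n))) : H s δ w p Ω →ₗ[ℝ] W p Ω where
  toFun u := ⟨convQLp hw hδ hn hs0 hs1 u.1, D s δ w p Ω u,
    (D_spec s δ w p Ω u).hasWeakGrad_convQLp hw hδ hn hs0 hs1 hΩ⟩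
  map_add' u u' := Subtype.ext (convQLp_add hw hδ hn hs0 hs1 hΩ u.1 u'.1)
  map_smul' c u := Subtype.ext (convQLp_smul hw hδ hn hs0 hs1 c u.1)

theorem coeFn_convQMap (hw : IsCutoff δ w wbar) (hδ : 0 < δ) (hn : 1 ≤ n) (hs0 : 0 < s)
    (hs1 : s < 1) (hΩ : Bornology.IsBounded (Ω : Set (E n))) (u : H s δ w p Ω) :
    ((convQMap hw hδ hn hs0 hs1 hΩ u : LpΩ p Ω) : E n → ℝ) =ᵐ[volume.restrict (Ω : Set (E n))]
      convQ s δ w wbar Ω ((u : LpEnl p δ Ω) : E n → ℝ) :=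
  coeFn_convQLp hw hδ hn hs0 hs1 u.1

theorem grad_convQMap (hw : IsCutoff δ w wbar) (hδ : 0 < δ) (hn : 1 ≤ n) (hs0 : 0 < s)
    (hs1 : s < 1) (hΩ : Bornology.IsBounded (Ω : Set (E n))) (u : H s δ w p Ω) :
    grad p Ω (convQMap hw hδ hn hs0 hs1 hΩ u) = D s δ w p Ω u :=
  (grad_spec p Ω _).unique ((D_spec s δ w p Ω u).hasWeakGrad_convQLp hw hδ hn hs0 hs1 hΩ)

theorem ker_grad_le_Const (hΩ : Bornology.IsBounded (Ω : Set (E n)))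
    (hc : IsConnected (Ω : Set (E n))) : LinearMap.ker (grad p Ω) ≤ Const p Ω := fun v hv => by
  have h1 := grad_spec p Ω v
  rw [LinearMap.mem_ker.1 hv] at h1
  exact (h1.congr_right (Lp.coeFn_zero _ _ _).symm).ae_eq_const (integrableOn_Lp hΩ _) hc

theorem norm_Wtilde (V : Wtilde p Ω) : ‖V‖ = ‖gradTilde p Ω V‖ := rfl

theorem norm_Htilde (U : Htilde s δ w p Ω) : ‖U‖ = ‖Dtilde s δ w p Ω U‖ := rfl

/-- The convolution with `Q` is onto `W^{1,p}`. -/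
theorem convQMap_surjective (hw : IsCutoff δ w wbar) (hδ : 0 < δ) (hn : 1 ≤ n) (hs0 : 0 < s)
    (hs1 : s < 1) (hΩ : IsBoundedLipschitzDomain Ω) :
    Function.Surjective (convQMap (p := p) (s := s) hw hδ hn hs0 hs1 hΩ.bounded) := by
  intro v
  obtain ⟨u, hu, hvu⟩ := (grad_spec p Ω v).exists_convQ_ae_eq (s := s) hw hδ hn hs0 hs1 Fact.out hΩ
    (Lp.memLp _) (Lp.memLp _)
  have hcongr : convQ s δ w wbar Ω (hu.toLp u) = convQ s δ w wbar Ω u := convQ_congr hu.coeFn_toLp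
  -- The preimage lies in the nonlocal space with no further estimate: its nonlocal gradient is the
  -- gradient of `v`, already in `L^p`.
  have hH : HasWeakNonlocalGrad s δ w Ω (hu.toLp u) (grad p Ω v) := by
    rw [hasWeakNonlocalGrad_iff hw hδ hn hs0 hs1 (integrableOn_Lp hΩ.bounded.thickening _)
      (integrableOn_Lp hΩ.bounded _), hcongr]
    exact (grad_spec p Ω v).congr hvu.symm
  refine ⟨⟨hu.toLp u, _, hH⟩, Subtype.ext (Lp.ext ?_)⟩
  refine (coeFn_convQMap hw hδ hn hs0 hs1 hΩ.bounded _).trans ?_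
  rw [hcongr]
  exact hvu.symm

end assembly

end NonlocalGradient

open NonlocalGradient in
theorem theorem4p1 {n : ℕ} (hn : 1 ≤ n) {s δ : ℝ} (hs0 : 0 < s) (hs1 : s < 1) (hδ : 0 < δ)
    (w : E n → ℝ) (wbar : ℝ → ℝ) (hw : IsCutoff δ w wbar)
    (Ω : Opens (E n)) (hΩ : IsBoundedLipschitzDomain Ω)
    (p : ℝ≥0∞) [Fact (1 ≤ p)] :
    ∃ T : H s δ w p Ω →ₗ[ℝ] W p Ω,
      (∀ u : H s δ w p Ω,
        ((T u : LpΩ p Ω) : E n → ℝ) =ᵐ[volume.restrict (Ω : Set (E n))]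
          convQ s δ w wbar Ω ((u : LpEnl p δ Ω) : E n → ℝ)) ∧
      ∃ Φ : Htilde s δ w p Ω ≃ₗᵢ[ℝ] Wtilde p Ω,
        (∀ u : H s δ w p Ω, Φ (Htilde.mk s δ w p Ω u) = Wtilde.mk p Ω (T u)) ∧
        (∀ U : Htilde s δ w p Ω, gradTilde p Ω (Φ U) = Dtilde s δ w p Ω U) ∧
        (∀ V : Wtilde p Ω, Dtilde s δ w p Ω (Φ.symm V) = gradTilde p Ω V) := by
  let T : H s δ w p Ω →ₗ[ℝ] W p Ω := convQMap hw hδ hn hs0 hs1 hΩ.bounded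
  have hT : ∀ u, grad p Ω (T u) = D s δ w p Ω u := grad_convQMap hw hδ hn hs0 hs1 hΩ.bounded
  have hTs : Function.Surjective T := convQMap_surjective hw hδ hn hs0 hs1 hΩ
  -- If the nonlocal gradient of `u` vanishes, so does the gradient of `Q * u`; connectedness of `Ω`
  -- makes `Q * u` constant.
  have hker : N s δ w p Ω ≤ LinearMap.ker (Wtilde.mk p Ω ∘ₗ T) := fun u hu => by
    rw [LinearMap.mem_ker, LinearMap.comp_apply]
    refine (Submodule.Quotient.mk_eq_zero _).2 (ker_grad_le_Const hΩ.bounded hΩ.connected ?_)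
    rw [LinearMap.mem_ker, hT]
    exact LinearMap.mem_ker.1 hu
  let L : Htilde s δ w p Ω →ₗ[ℝ] Wtilde p Ω := (N s δ w p Ω).liftQ (Wtilde.mk p Ω ∘ₗ T) hker
  have hL : ∀ u, L (Htilde.mk s δ w p Ω u) = Wtilde.mk p Ω (T u) := fun u => rfl
  have hgrad : ∀ U, gradTilde p Ω (L U) = Dtilde s δ w p Ω U := fun U => by
    obtain ⟨u, rfl⟩ := Submodule.Quotient.mk_surjective _ U
    exact hT u
  have hinj : Function.Injective L := fun U U' h => by
    apply Dtilde_injective s δ w p Ω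
    rw [← hgrad, ← hgrad, h]
  have hsurj : Function.Surjective L := fun V => by
    obtain ⟨v, rfl⟩ := Submodule.Quotient.mk_surjective _ V
    obtain ⟨u, rfl⟩ := hTs v
    exact ⟨Htilde.mk s δ w p Ω u, hL u⟩
  -- Both norms are pulled back from `L^p` along the gradients, so the relation between the
  -- gradients is already the isometry.
  have hnorm : ∀ U, ‖L U‖ = ‖U‖ := fun U => by
    rw [norm_Wtilde, norm_Htilde, hgrad]
  let Φ : Htilde s δ w p Ω ≃ₗᵢ[ℝ] Wtilde p Ω :=
    { LinearEquiv.ofBijective L ⟨hinj, hsurj⟩ with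
      norm_map' := hnorm }
  refine ⟨T, coeFn_convQMap hw hδ hn hs0 hs1 hΩ.bounded, Φ, hL, hgrad, fun V => ?_⟩
  obtain ⟨U, rfl⟩ := Φ.surjective V
  rw [Φ.symm_apply_apply]
  exact (hgrad U).symm
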